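/- **Theorem 11.** Let $\lambda\in\mathbb{C}$ with $|\lambda|<\sqrt{2\pi}$, let $\mathbb{R}_+=(0,\infty)$ and $\sigma=\{s\in\mathbb{C}:\operatorname{Re}s=\tfrac12\}$. Functions are complex-valued and equations between $L_2$ functions are understood almost everywhere. For $G\in L_2(\sigma)$ its inverse Mellin transform is the function $$\frac{1}{2\pi i}\int_\sigma G(s)\,x^{-s}\,ds:=\lim_{N\to\infty}\frac{1}{2\pi}\int_{-N}^{N}G(\tfrac12+i\tau)\,x^{-1/2-i\tau}\,d\tau ,$$ the limit being taken in the norm of $L_2(\mathbb{R}_+)$. Consider the integro-functional equation $$\frac{2^{3/2}}{\sqrt{\pi}}\;PV\!\int_0^\infty\left[\frac1\pi\log\frac{x}{t}-1\right]\frac{t\,f(t)}{x^2-t^2}\,dt=\frac{\lambda}{x}\,f\!\left(\frac1x\right),\qquad x>0, \tag{A}$$ where $PV$ denotes the Cauchy principal value at $t=x$. (i) (Necessity) If $f\in L_2(\mathbb{R}_+)$ is a solution of (A), then there is a function $\varphi\in L_2(\sigma)$ with $\varphi(s)=\varphi(1-s)$, $s\in\sigma$, such that $$f(x)=\frac{1}{2\pi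 i}\int_\sigma\left[\sqrt{\frac{\pi}{2}}\;\frac{1+\sin(\pi s)}{\sin^2(\pi s/2)}+\lambda\right]^{-1}\varphi(s)\,x^{-s}\,ds,\qquad x>0, \tag{B}$$ the integral being convergent in the mean square sense. (ii) (Sufficiency) Let $\varphi\in L_2(\sigma)$ satisfy $\varphi(s)=\varphi(1-s)$, $s\in\sigma$, and let $\mu$ be its inverse Mellin transform. Then for every $x>0$ the integrals in $$(2\pi-\lambda^2)\,\mu(x)+4\int_0^\infty\frac{\mu(t)}{x+t}\,dt+\frac{2}{\pi}\int_0^\infty\frac{\log(x/t)\,\mu(t)}{x-t}\,dt=0,\qquad x\in\mathbb{R}_+, \tag{C}$$ converge absolutely; and if $\mu$ is a solution of (C), then the integral in (B) converges in the mean square sense and the function $f\in L_2(\mathbb{R}_+)$ defined by (B) is a solution of (A). -/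

import Mathlib

open MeasureTheory Set Filter Topology

noncomputable section

namespace HartleyFourier

/-- The half-line `ℝ₊ = (0, ∞)` with Lebesgue measure. -/
def halfLine : Measure ℝ := volume.restrict (Ioi (0 : ℝ))

/-- The parametrization `τ ↦ 1/2 + iτ` of the critical line `σ = {s : Re s = 1/2}`. -/
def line (τ : ℝ) : ℂ := 1 / 2 + (τ : ℂ) * Complex.I

/-- `φ ∈ L₂(σ)`; only the values of `φ` on the line `σ` matter. -/
def MemL2Line (φ : ℂ → ℂ) : Prop := MemLp (fun τ : ℝ => φ (line τ)) 2 volume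

/-- `(1 / 2πi) ∫ G(s) x^{-s} ds` over the segment of `σ` from `1/2 - iN` to `1/2 + iN`,
with `s = 1/2 + iτ`, `ds = i dτ`. -/
def truncInvMellin (G : ℂ → ℂ) (N x : ℝ) : ℂ :=
  (1 / (2 * (Real.pi : ℂ))) * ∫ τ in (-N)..N, G (line τ) * (x : ℂ) ^ (-line τ)

/-- `f ∈ L₂(ℝ₊)` is the inverse Mellin transform
`f(x) = (1 / 2πi) ∫_σ G(s) x^{-s} ds` of `G ∈ L₂(σ)`, the integral being convergent in the
mean square sense with respect to the norm of `L₂(ℝ₊)`. -/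
structure IsInvMellin (G : ℂ → ℂ) (f : ℝ → ℂ) : Prop where
  memL2Line : MemL2Line G
  memLp : MemLp f 2 halfLine
  tendsto : Tendsto (fun N : ℝ => eLpNorm (fun x => truncInvMellin G N x - f x) 2 halfLine)
    atTop (𝓝 0)

/-- `v = PV ∫_0^∞ g(t) dt` with the (only) singularity at `t = x`. -/
def HasPV (g : ℝ → ℂ) (x : ℝ) (v : ℂ) : Prop :=
  (∀ ε : ℝ, 0 < ε → IntegrableOn g {t : ℝ | 0 < t ∧ ε < |t - x|}) ∧
  Tendsto (fun ε : ℝ => ∫ t in {t : ℝ | 0 < t ∧ ε < |t - x|}, g t) (𝓝[>] 0) (𝓝 v)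

/-- The kernel `[(1/π) log(x/t) - 1] t / (x² - t²)`. -/
def kernel (x t : ℝ) : ℝ :=
  (1 / Real.pi * Real.log (x / t) - 1) * (t / (x ^ 2 - t ^ 2))

/-- The integro-functional equation
`(2^{3/2} / √π) PV ∫_0^∞ [(1/π) log(x/t) - 1] t f(t) / (x² - t²) dt = (λ/x) f(1/x)`
for almost every `x > 0`. -/
def SolvesIntegroFunctional (lam : ℂ) (f : ℝ → ℂ) : Prop :=
  ∀ᵐ x ∂halfLine, ∃ v : ℂ, HasPV (fun t : ℝ => (kernel x t : ℂ) * f t) x v ∧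
    (((2 : ℝ) ^ ((3 : ℝ) / 2) / Real.sqrt Real.pi : ℝ) : ℂ) * v =
      lam / (x : ℂ) * f (1 / x)

/-- `√(π/2) (1 + sin πs) / sin²(πs/2)`. -/
def symbol (s : ℂ) : ℂ :=
  ((Real.sqrt (Real.pi / 2) : ℝ) : ℂ) *
    ((1 + Complex.sin (Real.pi * s)) / Complex.sin (Real.pi * s / 2) ^ 2)

/-- Absolute convergence, at the point `x`, of `∫_0^∞ μ(t)/(x+t) dt` and
`∫_0^∞ log(x/t) μ(t)/(x-t) dt`. -/
def IntegralsConverge (μ : ℝ → ℂ) (x : ℝ) : Prop :=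
  IntegrableOn (fun t : ℝ => μ t / ((x + t : ℝ) : ℂ)) (Ioi 0) ∧
  IntegrableOn (fun t : ℝ => (Real.log (x / t) : ℂ) * μ t / ((x - t : ℝ) : ℂ)) (Ioi 0)

/-- The integral equation
`(2π - λ²) μ(x) + 4 ∫_0^∞ μ(t)/(x+t) dt + (2/π) ∫_0^∞ log(x/t) μ(t)/(x-t) dt = 0`
for almost every `x > 0`. -/
def SolvesIntegralEquation (lam : ℂ) (μ : ℝ → ℂ) : Prop :=
  ∀ᵐ x ∂halfLine,
    (2 * (Real.pi : ℂ) - lam ^ 2) * μ x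
      + 4 * (∫ t in Ioi (0 : ℝ), μ t / ((x + t : ℝ) : ℂ))
      + 2 / (Real.pi : ℂ) *
          (∫ t in Ioi (0 : ℝ), (Real.log (x / t) : ℂ) * μ t / ((x - t : ℝ) : ℂ)) = 0

end HartleyFourier

end

open MeasureTheory Set Filter Topology

noncomputable section

namespace HartleyFourier

open scoped FourierTransform SchwartzMap ComplexConjugate Convolution

/-! Put x = e^u and m(u) = e^{u/2} f(e^u). This identifies L₂(ℝ₊) with L₂(ℝ), and the inverse Mellin
transform on s = 1/2 + iτ becomes the inverse Fourier transform with τ = -2πξ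
(`isInvMellin_iff_isFourierPair`). The function f(1/x)/x becomes m(-u), so that s is replaced by 1 -
s, and the integral operators become convolutions. The kernels 1/(2 cosh(v/2)) and v/(2 sinh(v/2))
have transforms π/cosh πτ and its square. The singular kernel has transform `multiplier`, which is
`symbol` up to the constant in front of the integral (`symbol_line`).

Write S for the symbol and F for the Mellin transform of f. Equation (A) is equivalent to S(s)F(s) =
λF(1-s) almost everywhere on the line (`solvesIntegroFunctional_iff`), and (C) implies (S(s)S(1-s) -
λ²)φ(s) = 0 (`SolvesIntegralEquation.multiplier_mul_eq_zero`). The rest is algebra, with 1/(S + λ)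
bounded because |S| > √(2π) > |λ|. Adding λF(s) to the first relation gives (S + λ)F = λ(F(s) +
F(1-s)), whose right side is the symmetric φ. Conversely, for F = φ/(S + λ) with φ symmetric,
clearing denominators in SF = λF(1-s) leaves the second relation.

The analytic difficulty is that the principal value is a pointwise limit, whereas the multiplier
only defines an L₂ class W. Almost everywhere convergence is proved without maximal functions. The
kernel truncated at scale ε is compared with the singular kernel smoothed by a triangle of width ε.
Smoothing the operator is the same as smoothing W (`integral_pvTriangle_mul`), which tends to W(u)
at Lebesgue points of W. The difference of the two kernels is dominated by a Poisson kernel and its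
integral tends to 0, so it disappears in the limit at Lebesgue points of m
(`IsLebesguePoint.tendsto_integral_of_le_poisson`). -/

/-! ### The Fourier transform of square integrable functions -/

/-- `G` represents the `L²` Fourier transform of the square integrable function `g`. -/
def IsFourierPair (g G : ℝ → ℂ) : Prop :=
  ∃ (hg : MemLp g 2) (hG : MemLp G 2), 𝓕 (hg.toLp g) = hG.toLp G

namespace IsFourierPair

variable {g g' G G' : ℝ → ℂ}

lemma memLp_left (h : IsFourierPair g G) : MemLp g 2 := h.1

lemma memLp_right (h : IsFourierPair g G) : MemLp G 2 := h.2.1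

lemma congr_left (h : IsFourierPair g G) (hg : g =ᵐ[volume] g') : IsFourierPair g' G := by
  obtain ⟨h1, h2, h3⟩ := h
  refine ⟨h1.ae_eq hg, h2, ?_⟩
  rw [← h3, MemLp.toLp_congr h1 (h1.ae_eq hg) hg]

lemma congr_right (h : IsFourierPair g G) (hG : G =ᵐ[volume] G') : IsFourierPair g G' := by
  obtain ⟨h1, h2, h3⟩ := h
  refine ⟨h1, h2.ae_eq hG, ?_⟩
  rw [h3, MemLp.toLp_congr h2 (h2.ae_eq hG) hG]

lemma unique_right (h : IsFourierPair g G) (h' : IsFourierPair g G') : G =ᵐ[volume] G' := by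
  obtain ⟨h1, h2, h3⟩ := h
  obtain ⟨h1', h2', h3'⟩ := h'
  exact (MemLp.toLp_eq_toLp_iff h2 h2').1 (h3.symm.trans h3')

lemma unique_left (h : IsFourierPair g G) (h' : IsFourierPair g' G) : g =ᵐ[volume] g' := by
  obtain ⟨h1, h2, h3⟩ := h
  obtain ⟨h1', h2', h3'⟩ := h'
  refine (MemLp.toLp_eq_toLp_iff h1 h1').1 ?_
  exact (Lp.fourierTransformₗᵢ ℝ ℂ).injective (h3.trans h3'.symm)

lemma add (h : IsFourierPair g G) (h' : IsFourierPair g' G') :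
    IsFourierPair (g + g') (G + G') := by
  obtain ⟨h1, h2, h3⟩ := h
  obtain ⟨h1', h2', h3'⟩ := h'
  refine ⟨h1.add h1', h2.add h2', ?_⟩
  rw [MemLp.toLp_add h1 h1', MemLp.toLp_add h2 h2', FourierTransform.fourier_add, h3, h3']

lemma const_smul (c : ℂ) (h : IsFourierPair g G) : IsFourierPair (c • g) (c • G) := by
  obtain ⟨h1, h2, h3⟩ := h
  refine ⟨h1.const_smul c, h2.const_smul c, ?_⟩
  rw [MemLp.toLp_const_smul c h1, MemLp.toLp_const_smul c h2, FourierTransform.fourier_smul, h3]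

lemma sub (h : IsFourierPair g G) (h' : IsFourierPair g' G') :
    IsFourierPair (g - g') (G - G') := by
  have := h.add (h'.const_smul (-1))
  simpa [sub_eq_add_neg] using this

lemma eLpNorm_eq (h : IsFourierPair g G) : eLpNorm g 2 volume = eLpNorm G 2 volume := by
  obtain ⟨h1, h2, h3⟩ := h
  have := congrArg norm h3
  rw [Lp.norm_fourier_eq, Lp.norm_toLp, Lp.norm_toLp] at this
  exact (ENNReal.toReal_eq_toReal_iff' h1.2.ne h2.2.ne).1 this

lemma integral_conj_mul (h : IsFourierPair g G) (h' : IsFourierPair g' G') :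
    ∫ x, conj (g x) * g' x = ∫ ξ, conj (G ξ) * G' ξ := by
  obtain ⟨h1, h2, h3⟩ := h
  obtain ⟨h1', h2', h3'⟩ := h'
  have := Lp.inner_fourier_eq (h1.toLp g) (h1'.toLp g')
  rw [h3, h3', L2.inner_def, L2.inner_def] at this
  have e1 : ∫ x, conj (g x) * g' x = ∫ x, inner ℂ (h1.toLp g x) (h1'.toLp g' x) := by
    refine integral_congr_ae ?_
    filter_upwards [h1.coeFn_toLp, h1'.coeFn_toLp] with x hx hx'
    rw [hx, hx', RCLike.inner_apply, mul_comm]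
  have e2 : ∫ x, conj (G x) * G' x = ∫ x, inner ℂ (h2.toLp G x) (h2'.toLp G' x) := by
    refine integral_congr_ae ?_
    filter_upwards [h2.coeFn_toLp, h2'.coeFn_toLp] with x hx hx'
    rw [hx, hx', RCLike.inner_apply, mul_comm]
  rw [e1, e2, this]

end IsFourierPair

lemma exists_isFourierPair {g : ℝ → ℂ} (hg : MemLp g 2) : ∃ G, IsFourierPair g G :=
  ⟨(𝓕 (hg.toLp g) : Lp ℂ 2 volume), hg, Lp.memLp _, by rw [Lp.toLp_coeFn]⟩

lemma exists_isFourierPair_left {G : ℝ → ℂ} (hG : MemLp G 2) : ∃ g, IsFourierPair g G :=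
  ⟨(𝓕⁻ (hG.toLp G) : Lp ℂ 2 volume), Lp.memLp _, hG, by
    rw [Lp.toLp_coeFn, FourierTransform.fourier_fourierInv_eq]⟩

/-- An L² class is determined by the tempered distribution it induces, and the Fourier transform of
distributions is defined by duality. This replaces an identity in L² by identities between
integrals. -/
lemma isFourierPair_iff_schwartz {g G : ℝ → ℂ} (hg : MemLp g 2) (hG : MemLp G 2) :
    IsFourierPair g G ↔ ∀ h : 𝓢(ℝ, ℂ), ∫ ξ, h ξ * G ξ = ∫ x, 𝓕 (h : ℝ → ℂ) x * g x := by
  have e1 : ∀ h : 𝓢(ℝ, ℂ), Lp.toTemperedDistribution (hG.toLp G) h = ∫ ξ, h ξ * G ξ := by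
    intro h
    rw [Lp.toTemperedDistribution_apply]
    refine integral_congr_ae ?_
    filter_upwards [hG.coeFn_toLp] with x hx
    rw [hx, smul_eq_mul]
  have e2 : ∀ h : 𝓢(ℝ, ℂ), Lp.toTemperedDistribution (𝓕 (hg.toLp g)) h
      = ∫ x, 𝓕 (h : ℝ → ℂ) x * g x := by
    intro h
    rw [← Lp.fourier_toTemperedDistribution_eq, TemperedDistribution.fourier_apply,
      Lp.toTemperedDistribution_apply]
    refine integral_congr_ae ?_
    filter_upwards [hg.coeFn_toLp] with x hx
    rw [hx, smul_eq_mul, SchwartzMap.fourier_coe]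
  constructor
  · rintro ⟨h1, h2, h3⟩ h
    rw [← e1, ← e2, h3]
  · intro H
    refine ⟨hg, hG, ?_⟩
    have : (𝓕 (hg.toLp g) - hG.toLp G) ∈ (Lp.toTemperedDistributionCLM ℂ volume 2).ker := by
      rw [LinearMap.mem_ker, map_sub, sub_eq_zero]
      ext h
      exact (e2 h).trans ((H h).symm.trans (e1 h).symm)
    rw [Lp.ker_toTemperedDistributionCLM_eq_bot] at this
    exact sub_eq_zero.1 this

lemma integral_fourier_mul_eq_flip {p q : ℝ → ℂ} (hp : Integrable p) (hq : Integrable q) :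
    ∫ ξ, 𝓕 p ξ * q ξ = ∫ x, p x * 𝓕 q x := by
  have := VectorFourier.integral_fourierIntegral_smul_eq_flip (L := innerₗ ℝ)
    Real.continuous_fourierChar continuous_inner hp hq
  simpa using! this

lemma norm_fourier_le {p : ℝ → ℂ} (ξ : ℝ) : ‖𝓕 p ξ‖ ≤ ∫ x, ‖p x‖ :=
  VectorFourier.norm_fourierIntegral_le_integral_norm _ _ _ _ _

lemma continuous_fourier {p : ℝ → ℂ} (hp : Integrable p) : Continuous (𝓕 p) :=
  VectorFourier.fourierIntegral_continuous Real.continuous_fourierChar continuous_inner hp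

/-- On `L¹ ∩ L²` the `L²` Fourier transform is given by the Fourier integral. -/
lemma isFourierPair_fourier {p : ℝ → ℂ} (hp : Integrable p) (hp2 : MemLp p 2) :
    IsFourierPair p (𝓕 p) := by
  obtain ⟨P, hP⟩ := exists_isFourierPair hp2
  refine hP.congr_right ?_
  refine ae_eq_of_integral_contDiff_smul_eq (hP.memLp_right.locallyIntegrable (by norm_num))
    (continuous_fourier hp).locallyIntegrable ?_
  intro h h1 h2
  have hg₁ : HasCompactSupport (Complex.ofRealCLM ∘ h) := h2.comp_left rfl
  have hg₂ : ContDiff ℝ (↑(⊤ : ℕ∞)) (Complex.ofRealCLM ∘ h) := by fun_prop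
  have key := (isFourierPair_iff_schwartz hp2 hP.memLp_right).1 hP (hg₁.toSchwartzMap hg₂)
  rw [integral_fourier_mul_eq_flip (SchwartzMap.integrable _) hp] at key
  simpa using key

/-- On `L¹ ∩ L²` the inverse `L²` Fourier transform is given by the inverse Fourier integral. -/
lemma isFourierPair_fourierInv {P : ℝ → ℂ} (hP : Integrable P) (hP2 : MemLp P 2) :
    IsFourierPair (𝓕⁻ P) P := by
  -- Square integrability comes from the forward transform, of which 𝓕⁻ P is the reflection.
  have h1 : MemLp (𝓕⁻ P) 2 := by
    have := (isFourierPair_fourier hP hP2).memLp_right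
    have h2 := this.comp_measurePreserving (Measure.measurePreserving_neg volume)
    refine h2.ae_eq (Eventually.of_forall fun x => ?_)
    simp [Real.fourierInv_eq_fourier_neg]
  refine (isFourierPair_iff_schwartz h1 hP2).2 fun h => ?_
  have e : ∀ x, 𝓕 (h : ℝ → ℂ) x * 𝓕⁻ P x = 𝓕 P (-x) * 𝓕⁻ (h : ℝ → ℂ) (-x) := by
    intro x
    rw [Real.fourierInv_eq_fourier_neg, Real.fourierInv_eq_fourier_neg, neg_neg, mul_comm]
  simp_rw [e]
  have hinv : 𝓕⁻ (h : ℝ → ℂ) = (𝓕⁻ h : 𝓢(ℝ, ℂ)) := (SchwartzMap.fourierInv_coe h).symm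
  rw [integral_neg_eq_self (fun x => 𝓕 P x * 𝓕⁻ (h : ℝ → ℂ) x), hinv,
    integral_fourier_mul_eq_flip hP (SchwartzMap.integrable _), ← SchwartzMap.fourier_coe,
    FourierTransform.fourier_fourierInv_eq]
  simp_rw [mul_comm]

lemma IsFourierPair.comp_neg {g G : ℝ → ℂ} (h : IsFourierPair g G) :
    IsFourierPair (fun x => g (-x)) (fun ξ => G (-ξ)) := by
  have h1 : MemLp (fun x => g (-x)) 2 :=
    h.memLp_left.comp_measurePreserving (Measure.measurePreserving_neg volume)
  have h2 : MemLp (fun x => G (-x)) 2 :=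
    h.memLp_right.comp_measurePreserving (Measure.measurePreserving_neg volume)
  refine (isFourierPair_iff_schwartz h1 h2).2 fun s => ?_
  have key := (isFourierPair_iff_schwartz h.memLp_left h.memLp_right).1 h
    (SchwartzMap.compCLMOfContinuousLinearEquiv ℂ (ContinuousLinearEquiv.neg ℝ) s)
  have e : 𝓕 (fun x => s (-x)) = fun ξ => 𝓕 (s : ℝ → ℂ) (-ξ) := by
    ext ξ
    rw [← Real.fourierInv_eq_fourier_neg, Real.fourierInv_eq_fourier_comp_neg]
  have e2 : ((SchwartzMap.compCLMOfContinuousLinearEquiv ℂ (ContinuousLinearEquiv.neg ℝ) s :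
      𝓢(ℝ, ℂ)) : ℝ → ℂ) = fun x => s (-x) := by
    ext x; simp
  rw [e2, e] at key
  rw [← integral_neg_eq_self, ← integral_neg_eq_self (fun x => 𝓕 (s : ℝ → ℂ) x * g (-x))]
  simpa using key

lemma fourier_conj_translate (κ : ℝ → ℂ) (u ξ : ℝ) :
    𝓕 (fun w => conj (κ (u - w))) ξ
      = conj (Complex.exp (2 * Real.pi * ξ * u * Complex.I) * 𝓕 κ ξ) := by
  rw [Real.fourier_eq', Real.fourier_eq', ← integral_sub_left_eq_self _ volume u,
    ← integral_const_mul, ← integral_conj]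
  refine integral_congr_ae (Eventually.of_forall fun v => ?_)
  simp only [smul_eq_mul, map_mul, sub_sub_cancel, ← Complex.exp_conj, ← mul_assoc,
    ← Complex.exp_add]
  congr 2
  simp [Complex.conj_ofNat]
  ring

/-- The convolution at u is the inner product of g with a conjugated, reflected translate of κ, so
Parseval applies. The identity holds at every u, which the pointwise limits below require. -/
lemma IsFourierPair.integral_kernel_mul {g G κ : ℝ → ℂ} (h : IsFourierPair g G)
    (hκ : Integrable κ) (hκ2 : MemLp κ 2) (u : ℝ) :
    ∫ w, κ (u - w) * g w = 𝓕⁻ (fun ξ => 𝓕 κ ξ * G ξ) u := by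
  have c1 : Integrable (fun w => conj (κ (u - w))) := by
    have := hκ.comp_sub_left u
    exact (Complex.conjLIE.integrable_comp_iff (φ := fun w => κ (u - w))).2 this
  have c2 : MemLp (fun w => conj (κ (u - w))) 2 :=
    (hκ2.comp_measurePreserving (Measure.measurePreserving_sub_left volume u)).star
  have key := (isFourierPair_fourier c1 c2).integral_conj_mul h
  simp only [fourier_conj_translate, Complex.conj_conj] at key
  rw [key, Real.fourierInv_eq']
  refine integral_congr_ae (Eventually.of_forall fun ξ => ?_)
  simp only [smul_eq_mul, ← mul_assoc]
  congr 3
  simp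
  ring

/-- Convolution with a kernel in `L¹ ∩ L²` is the Fourier multiplier with symbol `𝓕 κ`. -/
theorem IsFourierPair.convolution {g G κ : ℝ → ℂ} (h : IsFourierPair g G) (hκ : Integrable κ)
    (hκ2 : MemLp κ 2) :
    IsFourierPair (fun u => ∫ w, κ (u - w) * g w) (fun ξ => 𝓕 κ ξ * G ξ) := by
  have hm : AEStronglyMeasurable (𝓕 κ) volume := (continuous_fourier hκ).aestronglyMeasurable
  have hκp := isFourierPair_fourier hκ hκ2
  have hI : Integrable (fun ξ => 𝓕 κ ξ * G ξ) := hκp.memLp_right.integrable_mul h.memLp_right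
  have hL : MemLp (fun ξ => 𝓕 κ ξ * G ξ) 2 :=
    h.memLp_right.of_le_mul (c := ∫ x, ‖κ x‖) (hm.mul h.memLp_right.1) <|
      Eventually.of_forall fun ξ => by
        rw [norm_mul]
        exact mul_le_mul_of_nonneg_right (norm_fourier_le ξ) (norm_nonneg _)
  exact (isFourierPair_fourierInv hI hL).congr_left
    (Eventually.of_forall fun u => (h.integral_kernel_mul hκ hκ2 u).symm)

/-! ### Logarithmic coordinates -/

lemma exp_image_univ : Real.exp '' univ = Ioi 0 := by
  rw [image_univ, Real.range_exp]

/-- Lebesgue measure on `ℝ` with density `e^u`, whose image under `exp` is `halfLine`. -/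
def expMeasure : Measure ℝ := volume.withDensity fun u => ENNReal.ofReal (Real.exp u)

lemma measurableEmbedding_exp : MeasurableEmbedding Real.exp :=
  Real.isOpenEmbedding_exp.measurableEmbedding

lemma lintegral_halfLine (F : ℝ → ENNReal) :
    ∫⁻ x, F x ∂halfLine = ∫⁻ u, ENNReal.ofReal (Real.exp u) * F (Real.exp u) := by
  have := lintegral_image_eq_lintegral_abs_deriv_mul MeasurableSet.univ
    (fun x _ => (Real.hasDerivAt_exp x).hasDerivWithinAt) Real.exp_injective.injOn F
  rw [exp_image_univ] at this
  simpa [halfLine] using this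

lemma map_exp_expMeasure : expMeasure.map Real.exp = halfLine := by
  refine Measure.ext_of_lintegral _ fun F hF => ?_
  rw [lintegral_halfLine, lintegral_map hF Real.measurable_exp, expMeasure]
  exact lintegral_withDensity_eq_lintegral_mul _ (by fun_prop) (hF.comp Real.measurable_exp)

lemma ae_halfLine_iff {P : ℝ → Prop} :
    (∀ᵐ x ∂halfLine, P x) ↔ ∀ᵐ u : ℝ, P (Real.exp u) := by
  rw [← map_exp_expMeasure, measurableEmbedding_exp.ae_map_iff, expMeasure,
    ae_withDensity_iff (by fun_prop)]
  simp [Real.exp_pos]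

lemma aestronglyMeasurable_halfLine_iff {f : ℝ → ℂ} :
    AEStronglyMeasurable f halfLine ↔
      AEStronglyMeasurable (fun u => f (Real.exp u)) volume := by
  rw [← map_exp_expMeasure, measurableEmbedding_exp.aestronglyMeasurable_map_iff]
  refine ⟨fun h => h.mono_ac ?_, fun h => h.mono_ac (withDensity_absolutelyContinuous _ _)⟩
  exact withDensity_absolutelyContinuous' (by fun_prop)
    (Eventually.of_forall fun u => by simp [Real.exp_pos])

/-- The unitary change of variables `f ↦ e^{u/2} f(e^u)` from `L₂(ℝ₊)` to `L₂(ℝ)`. -/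
def logPullback (f : ℝ → ℂ) (u : ℝ) : ℂ := (Real.exp (u / 2) : ℂ) * f (Real.exp u)

lemma logPullback_sub (f g : ℝ → ℂ) :
    logPullback (fun x => f x - g x) = logPullback f - logPullback g := by
  ext u; simp [logPullback, mul_sub]

lemma eLpNorm_halfLine (f : ℝ → ℂ) :
    eLpNorm f 2 halfLine = eLpNorm (logPullback f) 2 volume := by
  rw [eLpNorm_eq_lintegral_rpow_enorm_toReal (by norm_num) (by norm_num),
    eLpNorm_eq_lintegral_rpow_enorm_toReal (by norm_num) (by norm_num), lintegral_halfLine]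
  congr 1
  refine lintegral_congr fun u => ?_
  rw [logPullback, enorm_mul, ENNReal.mul_rpow_of_nonneg _ _ (by norm_num)]
  congr 1
  rw [← ofReal_norm, Complex.norm_real, Real.norm_of_nonneg (Real.exp_pos _).le,
    ENNReal.ofReal_rpow_of_pos (Real.exp_pos _), ← Real.exp_mul]
  congr 2
  simp

lemma memLp_halfLine_iff {f : ℝ → ℂ} :
    MemLp f 2 halfLine ↔ MemLp (logPullback f) 2 volume := by
  rw [MemLp, MemLp, eLpNorm_halfLine, aestronglyMeasurable_halfLine_iff]
  refine and_congr_left fun _ => ⟨fun h => ?_, fun h => ?_⟩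
  · exact AEStronglyMeasurable.mul (by fun_prop) h
  · have h2 : AEStronglyMeasurable
        (fun u => (Real.exp (-(u / 2)) : ℂ) * logPullback f u) volume :=
      AEStronglyMeasurable.mul (by fun_prop) h
    refine h2.congr (Eventually.of_forall fun u => ?_)
    simp only [logPullback, ← mul_assoc, ← Complex.ofReal_mul, ← Real.exp_add]
    simp

lemma integral_Ioi_eq_integral_exp (F : ℝ → ℂ) :
    ∫ t in Ioi (0 : ℝ), F t = ∫ w, (Real.exp w : ℂ) * F (Real.exp w) := by
  have := integral_image_eq_integral_abs_deriv_smul MeasurableSet.univ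
    (fun x _ => (Real.hasDerivAt_exp x).hasDerivWithinAt) Real.exp_injective.injOn F
  rw [exp_image_univ] at this
  simpa [halfLine] using this

lemma integrableOn_Ioi_iff_exp (F : ℝ → ℂ) :
    IntegrableOn F (Ioi 0) ↔ Integrable (fun w => (Real.exp w : ℂ) * F (Real.exp w)) := by
  have := integrableOn_image_iff_integrableOn_abs_deriv_smul MeasurableSet.univ
    (fun x _ => (Real.hasDerivAt_exp x).hasDerivWithinAt) Real.exp_injective.injOn F
  rw [exp_image_univ] at this
  simpa [halfLine] using this

/-! ### The inverse Mellin transform as a Fourier transform -/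

/-- The parameter `τ = -2πξ` of the point of the critical line attached to the frequency `ξ`. -/
def freq (ξ : ℝ) : ℝ := -(2 * Real.pi) * ξ

lemma freq_neg (ξ : ℝ) : freq (-ξ) = -freq ξ := by simp [freq]

lemma ae_freq_iff {P : ℝ → Prop} : (∀ᵐ ξ, P (freq ξ)) ↔ ∀ᵐ τ, P τ := by
  have hne : -(2 * Real.pi) ≠ 0 := by simp [Real.pi_ne_zero]
  have he : MeasurableEmbedding freq := (Homeomorph.mulLeft₀ _ hne).measurableEmbedding
  have := he.ae_map_iff (μ := volume) (p := P)
  rw [← this]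
  have e : Measure.map freq volume = ENNReal.ofReal |(-(2 * Real.pi))⁻¹| • volume :=
    Real.map_volume_mul_left hne
  rw [e, Measure.ae_ennreal_smul_measure_iff]
  simp [Real.pi_ne_zero]

lemma memLp_comp_freq_iff {F : ℝ → ℂ} : MemLp (fun ξ => F (freq ξ)) 2 ↔ MemLp F 2 := by
  have hne : -(2 * Real.pi) ≠ 0 := by simp [Real.pi_ne_zero]
  have he : MeasurableEmbedding freq := (Homeomorph.mulLeft₀ _ hne).measurableEmbedding
  have e : Measure.map freq volume = ENNReal.ofReal |(-(2 * Real.pi))⁻¹| • volume :=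
    Real.map_volume_mul_left hne
  have h1 := he.memLp_map_measure_iff (μ := volume) (p := 2) (g := F)
  rw [e] at h1
  refine h1.symm.trans ⟨fun h => ?_, fun h => h.smul_measure ENNReal.ofReal_ne_top⟩
  have hc : ENNReal.ofReal |(-(2 * Real.pi))⁻¹| ≠ 0 := by simp [Real.pi_ne_zero]
  have := h.smul_measure (c := (ENNReal.ofReal |(-(2 * Real.pi))⁻¹|)⁻¹) (ENNReal.inv_ne_top.2 hc)
  rwa [smul_smul, ENNReal.inv_mul_cancel hc ENNReal.ofReal_ne_top, one_smul] at this

lemma tendsto_eLpNorm_two_of_dominated {ι : Type*} {l : Filter ι} [l.IsCountablyGenerated]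
    {F : ι → ℝ → ℂ} {f B : ℝ → ℂ} (hB : MemLp B 2) (hf : AEStronglyMeasurable f volume)
    (hF : ∀ᶠ i in l, AEStronglyMeasurable (F i) volume)
    (hFB : ∀ᶠ i in l, ∀ x, ‖F i x - f x‖ ≤ ‖B x‖)
    (hlim : ∀ x, Tendsto (fun i => F i x) l (𝓝 (f x))) :
    Tendsto (fun i => eLpNorm (F i - f) 2 volume) l (𝓝 0) := by
  simp_rw [eLpNorm_eq_lintegral_rpow_enorm_toReal (p := 2) (by norm_num) (by norm_num)]
  have key : Tendsto (fun i => ∫⁻ x, ‖(F i - f) x‖ₑ ^ (2 : ENNReal).toReal) l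
      (𝓝 (∫⁻ _ : ℝ, 0)) := by
    refine tendsto_lintegral_filter_of_dominated_convergence'
      (fun x => ‖B x‖ₑ ^ (2 : ENNReal).toReal) ?_ ?_ ?_ ?_
    · filter_upwards [hF] with i hi
      exact (hi.sub hf).enorm.pow_const _
    · filter_upwards [hFB] with i hi
      refine Eventually.of_forall fun x => ?_
      refine ENNReal.rpow_le_rpow ?_ (by norm_num)
      exact enorm_le_iff_norm_le.2 (hi x)
    · exact (lintegral_rpow_enorm_lt_top_of_eLpNorm_lt_top (by norm_num) (by norm_num) hB.2).ne
    · refine Eventually.of_forall fun x => ?_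
      have h1 : Tendsto (fun i => (F i - f) x) l (𝓝 0) := by
        simpa using (hlim x).sub_const (f x)
      have h2 := (h1.enorm).ennrpow_const (2 : ENNReal).toReal
      simpa using h2
  have h3 := key.ennrpow_const (1 / (2 : ENNReal).toReal)
  simpa using h3

/-- The integrand of the truncated inverse Mellin transform, as a function of the frequency. -/
def truncFreq (G : ℂ → ℂ) (N ξ : ℝ) : ℂ :=
  (Ioc (-N) N).indicator (fun τ => G (line τ)) (freq ξ)

lemma memLp_truncFreq {G : ℂ → ℂ} (hG : MemL2Line G) (N : ℝ) : MemLp (truncFreq G N) 2 :=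
  memLp_comp_freq_iff.2 (hG.indicator measurableSet_Ioc)

lemma integrable_truncFreq {G : ℂ → ℂ} (hG : MemL2Line G) (N : ℝ) :
    Integrable (truncFreq G N) := by
  have hne : -(2 * Real.pi) ≠ 0 := by simp [Real.pi_ne_zero]
  have h1 : IntegrableOn (fun τ => G (line τ)) (Ioc (-N) N) := by
    have : IsFiniteMeasure (volume.restrict (Ioc (-N) N)) :=
      ⟨by simp⟩
    exact (hG.restrict _).integrable (by norm_num)
  exact ((integrable_indicator_iff measurableSet_Ioc).2 h1).comp_mul_left' hne

/-- The weight e^{u/2} cancels the real part 1/2 of the exponent and leaves a pure character. -/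
lemma ofReal_exp_cpow_neg_line (u τ : ℝ) :
    (Real.exp (u / 2) : ℂ) * ((Real.exp u : ℝ) : ℂ) ^ (-line τ)
      = Complex.exp (-(τ * u) * Complex.I) := by
  rw [Complex.cpow_def_of_ne_zero (by exact_mod_cast (Real.exp_pos u).ne'), ← Complex.ofReal_log
    (Real.exp_pos u).le, Real.log_exp, Complex.ofReal_exp, ← Complex.exp_add]
  congr 1
  simp only [line]
  push_cast
  ring

lemma logPullback_truncInvMellin (G : ℂ → ℂ) {N : ℝ} (hN : 0 ≤ N) (u : ℝ) :
    logPullback (truncInvMellin G N) u = FourierTransformInv.fourierInv (truncFreq G N) u := by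
  rw [logPullback, truncInvMellin, intervalIntegral.integral_of_le (by linarith),
    ← integral_indicator measurableSet_Ioc, mul_left_comm, ← integral_const_mul,
    Real.fourierInv_eq']
  set Φ : ℝ → ℂ := fun τ => Complex.exp (-(τ * u) * Complex.I) *
    (Ioc (-N) N).indicator (fun τ => G (line τ)) τ with hΦ
  have e1 : ∀ τ : ℝ, (Real.exp (u / 2) : ℂ) * (Ioc (-N) N).indicator
      (fun τ => G (line τ) * ((Real.exp u : ℝ) : ℂ) ^ (-line τ)) τ = Φ τ := by
    intro τ
    simp only [hΦ]
    by_cases h : τ ∈ Ioc (-N) N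
    · rw [indicator_of_mem h, indicator_of_mem h, ← ofReal_exp_cpow_neg_line]
      ring
    · rw [indicator_of_notMem h, indicator_of_notMem h, mul_zero, mul_zero]
  have e2 : ∀ ξ : ℝ, Complex.exp (↑(2 * Real.pi * inner ℝ ξ u) * Complex.I) • truncFreq G N ξ
      = Φ (-(2 * Real.pi) * ξ) := by
    intro ξ
    simp only [hΦ, truncFreq, smul_eq_mul, freq]
    congr 2
    simp
    ring
  simp_rw [e1, e2]
  rw [Measure.integral_comp_mul_left Φ]
  -- The Jacobian of τ = -2πξ is the factor 1/(2π) of the inverse Mellin integral.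
  have : |(-(2 * Real.pi))⁻¹| = (2 * Real.pi)⁻¹ := by
    rw [inv_neg, abs_neg, abs_of_pos (by positivity)]
  rw [this, Complex.real_smul]
  push_cast
  ring

lemma tendsto_truncFreq {G : ℂ → ℂ} (hG : MemL2Line G) :
    Tendsto (fun N => eLpNorm (truncFreq G N - fun ξ => G (line (freq ξ))) 2 volume)
      atTop (𝓝 0) := by
  have hG' : MemLp (fun ξ => G (line (freq ξ))) 2 :=
    memLp_comp_freq_iff.2 hG
  refine tendsto_eLpNorm_two_of_dominated hG' hG'.1
    (Eventually.of_forall fun N => (memLp_truncFreq hG N).1)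
    (Eventually.of_forall fun N ξ => ?_) fun ξ => ?_
  · simp only [truncFreq, indicator]
    split_ifs <;> simp
  · refine tendsto_const_nhds.congr' ?_
    filter_upwards [eventually_gt_atTop |freq ξ|] with N hN
    rw [truncFreq, indicator_of_mem]
    exact ⟨by linarith [neg_abs_le (freq ξ)], by linarith [le_abs_self (freq ξ)]⟩

lemma ae_eq_of_tendsto_eLpNorm {ι : Type*} {l : Filter ι} [l.NeBot] {F : ι → ℝ → ℂ}
    {f g : ℝ → ℂ} (hF : ∀ i, MemLp (F i) 2) (hf : MemLp f 2) (hg : MemLp g 2)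
    (h1 : Tendsto (fun i => eLpNorm (F i - f) 2 volume) l (𝓝 0))
    (h2 : Tendsto (fun i => eLpNorm (F i - g) 2 volume) l (𝓝 0)) : f =ᵐ[volume] g := by
  have h : eLpNorm (f - g) 2 volume ≤ 0 := by
    have h3 := h1.add h2
    rw [add_zero] at h3
    refine ge_of_tendsto h3 (Eventually.of_forall fun i => ?_)
    have : f - g = (F i - g) - (F i - f) := by abel
    rw [this, add_comm]
    exact eLpNorm_sub_le ((hF i).sub hg).1 ((hF i).sub hf).1 (by norm_num)
  have := (eLpNorm_eq_zero_iff (hf.sub hg).1 (by norm_num)).1 (le_antisymm h bot_le)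
  filter_upwards [this] with x hx
  exact sub_eq_zero.1 hx

/-- In logarithmic coordinates the inverse Mellin transform is the inverse Fourier transform. -/
theorem isInvMellin_iff_isFourierPair {G : ℂ → ℂ} {f : ℝ → ℂ} :
    IsInvMellin G f ↔ IsFourierPair (logPullback f) (fun ξ => G (line (freq ξ))) := by
  have hpair : ∀ {N : ℝ}, MemL2Line G → 0 ≤ N →
      IsFourierPair (logPullback (truncInvMellin G N)) (truncFreq G N) := by
    intro N hG hN
    refine (isFourierPair_fourierInv (integrable_truncFreq hG N) (memLp_truncFreq hG N)).congr_left
      (Eventually.of_forall fun u => (logPullback_truncInvMellin G hN u).symm)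
  have hnorm : ∀ {g : ℝ → ℂ}, MemL2Line G →
      IsFourierPair g (fun ξ => G (line (freq ξ))) →
      Tendsto (fun N => eLpNorm (logPullback (truncInvMellin G (max N 0)) - g) 2 volume)
        atTop (𝓝 0) := by
    intro g hG hg
    refine (tendsto_truncFreq hG).congr' ?_
    filter_upwards [eventually_ge_atTop 0] with N hN
    rw [max_eq_left hN]
    exact ((hpair hG hN).sub hg).eLpNorm_eq.symm
  constructor
  · rintro ⟨hG, hf, hlim⟩
    obtain ⟨g, hg⟩ := exists_isFourierPair_left (memLp_comp_freq_iff.2 hG)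
    refine hg.congr_left ?_
    -- Replacing N by max N 0 puts every member of the family in L² and does not affect the limit.
    refine ae_eq_of_tendsto_eLpNorm (F := fun N => logPullback (truncInvMellin G (max N 0)))
      (fun N => (hpair hG (le_max_right N 0)).memLp_left) hg.memLp_left
      (memLp_halfLine_iff.1 hf) (hnorm hG hg) ?_
    refine hlim.congr' ?_
    filter_upwards [eventually_ge_atTop 0] with N hN
    rw [max_eq_left hN, eLpNorm_halfLine, logPullback_sub]
  · intro h
    have hG : MemL2Line G := memLp_comp_freq_iff.1 h.memLp_right
    refine ⟨hG, memLp_halfLine_iff.2 h.memLp_left, ?_⟩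
    refine (hnorm hG h).congr' ?_
    filter_upwards [eventually_ge_atTop 0] with N hN
    rw [max_eq_left hN, eLpNorm_halfLine, logPullback_sub]

/-! ### Fourier integrals of hyperbolic kernels -/

/-- The Fourier integral in the variable dual to the parameter of the critical line. -/
lemma fourier_eq_integral_freq (κ : ℝ → ℂ) (ξ : ℝ) :
    𝓕 κ ξ = ∫ v, κ v * Complex.exp (freq ξ * v * Complex.I) := by
  rw [Real.fourier_eq']
  refine integral_congr_ae (Eventually.of_forall fun v => ?_)
  simp only [smul_eq_mul, freq]
  rw [mul_comm]
  congr 2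
  simp
  ring

/-- `1 / (2 cosh (v/2))`. -/
def kSech (v : ℝ) : ℝ := 1 / (2 * Real.cosh (v / 2))

/-- `1 / (2 sinh (v/2))`. -/
def kCsch (v : ℝ) : ℝ := 1 / (2 * Real.sinh (v / 2))

/-- `v / (2 sinh (v/2))`. -/
def kLog (v : ℝ) : ℝ := v * kCsch v

lemma kSech_pos (v : ℝ) : 0 < kSech v := by
  have := Real.cosh_pos (v / 2)
  unfold kSech; positivity

lemma kSech_le_one (v : ℝ) : kSech v ≤ 1 := by
  have := Real.one_le_cosh (v / 2)
  rw [kSech, div_le_one (by positivity)]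
  linarith

lemma kSech_neg (v : ℝ) : kSech (-v) = kSech v := by
  simp [kSech, neg_div]

lemma kCsch_neg (v : ℝ) : kCsch (-v) = -kCsch v := by
  simp [kCsch, neg_div]

lemma kLog_neg (v : ℝ) : kLog (-v) = kLog v := by
  simp [kLog, kCsch_neg]

lemma kCsch_pos {v : ℝ} (hv : 0 < v) : 0 < kCsch v := by
  have := Real.sinh_pos_iff.2 (half_pos hv)
  unfold kCsch; positivity

lemma kCsch_le_inv {v : ℝ} (hv : 0 < v) : kCsch v ≤ 1 / v := by
  have := Real.self_le_sinh_iff.2 (half_pos hv).le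
  unfold kCsch
  exact one_div_le_one_div_of_le hv (by linarith)

lemma abs_kCsch_le_inv (v : ℝ) : |kCsch v| ≤ 1 / |v| := by
  rcases lt_trichotomy v 0 with h | h | h
  · have := kCsch_le_inv (neg_pos.2 h)
    have h2 := kCsch_pos (neg_pos.2 h)
    rw [← abs_neg, ← kCsch_neg, abs_of_pos h2, abs_of_neg h]
    exact this
  · simp [h, kCsch]
  · rw [abs_of_pos (kCsch_pos h), abs_of_pos h]
    exact kCsch_le_inv h

lemma kLog_nonneg (v : ℝ) : 0 ≤ kLog v := by
  rcases lt_trichotomy v 0 with h | h | h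
  · rw [← kLog_neg]
    exact mul_nonneg (by linarith) (kCsch_pos (neg_pos.2 h)).le
  · simp [h, kLog]
  · exact mul_nonneg h.le (kCsch_pos h).le

lemma kLog_le_one (v : ℝ) : kLog v ≤ 1 := by
  refine (le_abs_self _).trans ?_
  rw [kLog, abs_mul]
  refine (mul_le_mul_of_nonneg_left (abs_kCsch_le_inv v) (abs_nonneg v)).trans ?_
  rw [mul_one_div]
  exact div_self_le_one _

lemma measurable_kSech : Measurable kSech := by
  unfold kSech; fun_prop

lemma measurable_kCsch : Measurable kCsch := by
  unfold kCsch; fun_prop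

lemma measurable_kLog : Measurable kLog := measurable_id.mul measurable_kCsch

lemma abs_mul_kSech_le (v : ℝ) : |v * kSech v| ≤ kLog v := by
  rcases lt_trichotomy v 0 with h | h | h
  · rw [← kLog_neg, ← kSech_neg, abs_mul, abs_of_neg h, abs_of_pos (kSech_pos _), kLog]
    refine mul_le_mul_of_nonneg_left ?_ (by linarith)
    have := Real.sinh_pos_iff.2 (half_pos (neg_pos.2 h))
    exact one_div_le_one_div_of_le (by positivity) (by linarith [Real.sinh_lt_cosh (-v / 2)])
  · simp [h, kLog]
  · rw [abs_mul, abs_of_pos h, abs_of_pos (kSech_pos _), kLog]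
    refine mul_le_mul_of_nonneg_left ?_ (by linarith)
    have := Real.sinh_pos_iff.2 (half_pos h)
    exact one_div_le_one_div_of_le (by positivity) (by linarith [Real.sinh_lt_cosh (v / 2)])

lemma log_sigmoid (v : ℝ) : Real.log (Real.sigmoid v) = v / 2 + Real.log (kSech v) := by
  have : Real.sigmoid v = Real.exp (v / 2) * kSech v := by
    rw [Real.sigmoid_def, kSech, Real.cosh_eq]
    have h1 := Real.exp_pos (v / 2)
    have h2 : Real.exp (-v) = Real.exp (-(v / 2)) * Real.exp (-(v / 2)) := by
      rw [← Real.exp_add]; ring_nf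
    have h3 : Real.exp (v / 2) * Real.exp (-(v / 2)) = 1 := by
      rw [← Real.exp_add]; simp
    have h4 := Real.exp_pos (-(v / 2))
    rw [h2]
    field_simp
    nlinarith
  rw [this, Real.log_mul (Real.exp_pos _).ne' (kSech_pos v).ne', Real.log_exp]

/-- With x = `Real.sigmoid v` one has dx = x(1-x) dv, x = e^{v/2} `kSech v` and 1 - x = e^{-v/2}
`kSech v`. The product x^s (1-x)^{1-s} is therefore e^{(s-1/2)v} `kSech v`. -/
lemma sigmoid_beta_integrand (τ v : ℝ) :
    |Real.sigmoid v * (1 - Real.sigmoid v)| • ((Real.sigmoid v : ℂ) ^ (line τ - 1) *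
      (1 - (Real.sigmoid v : ℂ)) ^ ((1 - line τ) - 1))
      = (kSech v : ℂ) * Complex.exp (τ * v * Complex.I) := by
  have h1 := Real.sigmoid_pos v
  have h2 : 0 < 1 - Real.sigmoid v := by rw [← Real.sigmoid_neg]; exact Real.sigmoid_pos _
  have e1 : Real.log (1 - Real.sigmoid v) = -v / 2 + Real.log (kSech v) := by
    rw [← Real.sigmoid_neg, log_sigmoid, kSech_neg]
  have a1 : (Real.sigmoid v : ℂ) = Complex.exp ((v / 2 + Real.log (kSech v) : ℝ) : ℂ) := by
    rw [← Complex.ofReal_exp, ← log_sigmoid, Real.exp_log h1]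
  have a2 : (1 - (Real.sigmoid v : ℂ))
      = Complex.exp ((-v / 2 + Real.log (kSech v) : ℝ) : ℂ) := by
    rw [← Complex.ofReal_exp, ← e1, Real.exp_log h2]; push_cast; ring
  have p1 : ∀ (y : ℝ) (s : ℂ), Complex.exp (y : ℂ) ^ s = Complex.exp (y * s) := by
    intro y s
    rw [Complex.cpow_def_of_ne_zero (Complex.exp_ne_zero _), ← Complex.ofReal_exp,
      ← Complex.ofReal_log (Real.exp_pos _).le, Real.log_exp]
  rw [abs_of_pos (mul_pos h1 h2), Complex.real_smul, Complex.ofReal_mul, Complex.ofReal_sub,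
    Complex.ofReal_one, a2, a1, p1, p1, ← Complex.exp_add, ← Complex.exp_add, ← Complex.exp_add]
  have a3 : (kSech v : ℂ) = Complex.exp ((Real.log (kSech v) : ℝ) : ℂ) := by
    rw [← Complex.ofReal_exp, Real.exp_log (kSech_pos v)]
  conv_rhs => rw [a3, ← Complex.exp_add]
  congr 1
  simp only [line]
  push_cast
  ring

lemma line_re (τ : ℝ) : (line τ).re = 1 / 2 := by simp [line]

lemma one_sub_line (τ : ℝ) : 1 - line τ = line (-τ) := by
  simp only [line]; push_cast; ring

lemma integrable_kSech_mul_exp (τ : ℝ) :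
    Integrable fun v : ℝ => (kSech v : ℂ) * Complex.exp (τ * v * Complex.I) := by
  have h := Complex.betaIntegral_convergent (u := line τ) (v := 1 - line τ)
    (by rw [line_re]; norm_num) (by rw [one_sub_line, line_re]; norm_num)
  rw [intervalIntegrable_iff_integrableOn_Ioo_of_le zero_le_one, ← Real.range_sigmoid,
    ← image_univ, integrableOn_image_iff_integrableOn_abs_deriv_smul MeasurableSet.univ
    (fun x _ => (Real.hasDerivAt_sigmoid x).hasDerivWithinAt) Real.sigmoid_injective.injOn,
    integrableOn_univ] at h
  refine h.congr (Eventually.of_forall fun v => ?_)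
  exact sigmoid_beta_integrand τ v

lemma integrable_kSech : Integrable fun v : ℝ => (kSech v : ℂ) := by
  simpa using integrable_kSech_mul_exp 0

/-- The substitution x = `Real.sigmoid v` makes this Euler's integral B(s, 1-s) = Γ(s)Γ(1-s) = π/sin
πs, and sin π(1/2 + iτ) = cosh πτ. -/
lemma integral_kSech_mul_exp (τ : ℝ) :
    ∫ v : ℝ, (kSech v : ℂ) * Complex.exp (τ * v * Complex.I)
      = (Real.pi / Real.cosh (Real.pi * τ) : ℝ) := by
  have h := Complex.Gamma_mul_Gamma_eq_betaIntegral (s := line τ) (t := 1 - line τ)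
    (by rw [line_re]; norm_num) (by rw [one_sub_line, line_re]; norm_num)
  rw [Complex.Gamma_mul_Gamma_one_sub, add_sub_cancel, Complex.Gamma_one, one_mul,
    Complex.betaIntegral, intervalIntegral.integral_of_le zero_le_one, integral_Ioc_eq_integral_Ioo,
    ← Real.range_sigmoid, ← image_univ,
    integral_image_eq_integral_abs_deriv_smul MeasurableSet.univ
    (fun x _ => (Real.hasDerivAt_sigmoid x).hasDerivWithinAt) Real.sigmoid_injective.injOn] at h
  simp only [sigmoid_beta_integrand, Measure.restrict_univ] at h
  rw [← h]
  have : Complex.sin (Real.pi * line τ) = (Real.cosh (Real.pi * τ) : ℝ) := by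
    have e : (Real.pi : ℂ) * line τ = Real.pi * τ * Complex.I + Real.pi / 2 := by
      simp only [line]; ring
    rw [e, Complex.sin_add_pi_div_two, Complex.cos_mul_I]
    push_cast; rfl
  rw [this]
  push_cast; rfl

lemma tendsto_log_cosh_sub : Tendsto (fun y => Real.log (Real.cosh y) - y) atTop
    (𝓝 (Real.log (1 / 2))) := by
  have h1 : ∀ y, Real.log (Real.cosh y) - y = Real.log ((1 + Real.exp (-(2 * y))) / 2) := by
    intro y
    rw [← Real.log_exp y, ← Real.log_div (Real.cosh_pos _).ne' (Real.exp_pos _).ne', Real.log_exp]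
    congr 1
    rw [Real.cosh_eq, div_eq_iff (Real.exp_pos _).ne']
    have : Real.exp (-y) = Real.exp (-(2 * y)) * Real.exp y := by
      rw [← Real.exp_add]; ring_nf
    rw [this]; ring
  simp_rw [h1]
  refine (Real.continuousAt_log (by norm_num)).tendsto.comp ?_
  have h2 : Tendsto (fun y : ℝ => Real.exp (-(2 * y))) atTop (𝓝 0) :=
    Real.tendsto_exp_neg_atTop_nhds_zero.comp (tendsto_id.const_mul_atTop (by norm_num))
  simpa using (h2.const_add 1).div_const 2

lemma hasDerivAt_log_cosh (y : ℝ) :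
    HasDerivAt (fun y => Real.log (Real.cosh y)) (Real.sinh y / Real.cosh y) y :=
  (Real.hasDerivAt_cosh y).log (Real.cosh_pos y).ne'

lemma integrable_kSech_real : Integrable kSech := by
  have := integrable_kSech.re
  simpa using this

/-- By the addition theorem for sinh, log cosh(t/2) - log cosh((x-t)/2) is a primitive of 2
sinh(x/2) times the integrand. Its limits at ±∞ are ±x/2. -/
lemma integral_kSech_mul_kSech {x : ℝ} (hx : x ≠ 0) :
    ∫ t, kSech t * kSech (x - t) = kLog x := by
  set F : ℝ → ℝ := fun t =>
    Real.log (Real.cosh (t / 2)) - Real.log (Real.cosh ((x - t) / 2)) with hF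
  have hsx : Real.sinh (x / 2) ≠ 0 := by
    rw [Ne, Real.sinh_eq_zero]; simpa using hx
  have hder : ∀ t, HasDerivAt F (2 * Real.sinh (x / 2) * (kSech t * kSech (x - t))) t := by
    intro t
    have d1 := (hasDerivAt_log_cosh (t / 2)).comp t ((hasDerivAt_id t).div_const 2)
    have d2 := (hasDerivAt_log_cosh ((x - t) / 2)).comp t
      (((hasDerivAt_id t).const_sub x).div_const 2)
    convert! d1.sub d2 using 1
    have c1 := (Real.cosh_pos (t / 2)).ne'
    have c2 := (Real.cosh_pos ((x - t) / 2)).ne'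
    have e : Real.sinh (x / 2) = Real.sinh (t / 2) * Real.cosh ((x - t) / 2)
        + Real.cosh (t / 2) * Real.sinh ((x - t) / 2) := by
      rw [← Real.sinh_add]; ring_nf
    rw [e]
    simp only [kSech]
    field_simp
    ring
  have htop : Tendsto F atTop (𝓝 (x / 2)) := by
    have t1 := tendsto_log_cosh_sub.comp (tendsto_id.atTop_div_const (two_pos (α := ℝ)))
    have t2 := tendsto_log_cosh_sub.comp
      ((tendsto_atTop_add_const_right atTop (-x) tendsto_id).atTop_div_const (two_pos (α := ℝ)))
    have t3 := (t1.sub t2).add_const (x / 2)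
    rw [sub_self, zero_add] at t3
    refine t3.congr fun t => ?_
    have : Real.cosh ((x - t) / 2) = Real.cosh ((t + -x) / 2) := by
      rw [← Real.cosh_neg]; ring_nf
    simp only [hF, Function.comp, id, this]
    ring
  have hbot : Tendsto F atBot (𝓝 (-(x / 2))) := by
    have t1 := (htop.comp (tendsto_atTop_add_const_left atBot x tendsto_neg_atBot_atTop)).neg
    refine t1.congr fun t => ?_
    simp only [hF, Function.comp]
    ring_nf
  have hint : Integrable fun t => kSech t * kSech (x - t) := by
    refine (integrable_kSech_real.comp_sub_left x).bdd_mul (c := 1)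
      measurable_kSech.aestronglyMeasurable (Eventually.of_forall fun t => ?_)
    rw [Real.norm_of_nonneg (kSech_pos t).le]
    exact kSech_le_one t
  have := integral_of_hasDerivAt_of_tendsto hder (hint.const_mul _) hbot htop
  rw [integral_const_mul] at this
  rw [kLog, kCsch]
  field_simp
  linarith

lemma ae_ne_zero : ∀ᵐ x : ℝ, x ≠ 0 := by
  simp [ae_iff]

/-- Equality fails at the single point 0, where division by zero gives `kLog 0 = 0` while the
convolution is 1. This identity is why the transform of `kLog` is the square of that of `kSech`. -/
lemma kSech_convolution_kSech :
    ((fun v : ℝ => (kSech v : ℂ)) ⋆[ContinuousLinearMap.mul ℂ ℂ] (fun v : ℝ => (kSech v : ℂ)))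
      =ᵐ[volume] fun v => (kLog v : ℂ) := by
  filter_upwards [ae_ne_zero] with x hx
  rw [convolution_def, ← integral_kSech_mul_kSech hx, ← integral_complex_ofReal]
  simp

lemma integrable_kLog : Integrable fun v : ℝ => (kLog v : ℂ) :=
  (integrable_kSech.integrable_convolution _ integrable_kSech).congr kSech_convolution_kSech

lemma integrable_kLog_real : Integrable kLog := by
  simpa using integrable_kLog.re

lemma fourier_kSech (ξ : ℝ) :
    𝓕 (fun v : ℝ => (kSech v : ℂ)) ξ = (Real.pi / Real.cosh (Real.pi * freq ξ) : ℝ) := by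
  rw [fourier_eq_integral_freq, integral_kSech_mul_exp]

lemma fourier_kLog (ξ : ℝ) :
    𝓕 (fun v : ℝ => (kLog v : ℂ)) ξ
      = ((Real.pi / Real.cosh (Real.pi * freq ξ)) ^ 2 : ℝ) := by
  have h := Real.fourier_mul_convolution_eq integrable_kSech integrable_kSech ξ
  rw [fourier_kSech] at h
  rw [Complex.ofReal_pow, sq, ← h, Real.fourier_eq', Real.fourier_eq']
  refine integral_congr_ae ?_
  filter_upwards [kSech_convolution_kSech] with v hv
  rw [hv]

lemma integral_kLog_mul_exp (τ : ℝ) :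
    ∫ v : ℝ, (kLog v : ℂ) * Complex.exp (τ * v * Complex.I)
      = ((Real.pi / Real.cosh (Real.pi * τ)) ^ 2 : ℝ) := by
  have h := fourier_kLog (τ / (-(2 * Real.pi)))
  rw [fourier_eq_integral_freq] at h
  have : freq (τ / (-(2 * Real.pi))) = τ := by
    rw [freq]; field_simp
  rwa [this] at h

lemma memLp_two_of_bounded {κ : ℝ → ℂ} (hκ : Integrable κ) (C : ℝ) (hC : ∀ v, ‖κ v‖ ≤ C) :
    MemLp κ 2 := by
  rw [memLp_two_iff_integrable_sq_norm hκ.1]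
  have : Integrable fun v => ‖κ v‖ * ‖κ v‖ :=
    hκ.norm.bdd_mul (c := C) hκ.1.norm (Eventually.of_forall fun v => by simpa using hC v)
  simpa [sq] using this

lemma memLp_kSech : MemLp (fun v : ℝ => (kSech v : ℂ)) 2 :=
  memLp_two_of_bounded integrable_kSech 1 fun v => by
    rw [Complex.norm_real, Real.norm_of_nonneg (kSech_pos v).le]; exact kSech_le_one v

lemma memLp_kLog : MemLp (fun v : ℝ => (kLog v : ℂ)) 2 :=
  memLp_two_of_bounded integrable_kLog 1 fun v => by
    rw [Complex.norm_real, Real.norm_of_nonneg (kLog_nonneg v)]; exact kLog_le_one v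

lemma integrable_mul_kSech : Integrable fun v : ℝ => ((v * kSech v : ℝ) : ℂ) := by
  refine integrable_kLog_real.mono' ?_ (Eventually.of_forall fun v => ?_)
  · exact (Complex.measurable_ofReal.comp (measurable_id.mul measurable_kSech)).aestronglyMeasurable
  · rw [Complex.norm_real]; exact abs_mul_kSech_le v

lemma norm_exp_ofReal_mul_I (τ v : ℝ) : ‖Complex.exp (τ * v * Complex.I)‖ = 1 := by
  rw [← Complex.ofReal_mul, Complex.norm_exp_ofReal_mul_I]

lemma hasDerivAt_exp_mul_I (τ v : ℝ) :
    HasDerivAt (fun t : ℝ => Complex.exp (t * v * Complex.I))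
      (v * Complex.I * Complex.exp (τ * v * Complex.I)) τ := by
  have h1 : HasDerivAt (fun t : ℝ => (t : ℂ) * v * Complex.I) (1 * v * Complex.I) τ :=
    (((hasDerivAt_id τ).ofReal_comp).mul_const _).mul_const _
  convert h1.cexp using 1
  ring

/-- Differentiate the transform of `kSech` in τ under the integral sign; `kLog` is an integrable
majorant of the derivative. -/
lemma integral_mul_kSech_mul_exp (τ : ℝ) :
    ∫ v : ℝ, ((v * kSech v : ℝ) : ℂ) * Complex.exp (τ * v * Complex.I)
      = (Real.pi ^ 2 * Real.sinh (Real.pi * τ) / Real.cosh (Real.pi * τ) ^ 2 : ℝ)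
        * Complex.I := by
  have hd := (hasDerivAt_integral_of_dominated_loc_of_deriv_le (μ := volume) (x₀ := τ)
    (s := univ) (bound := kLog)
    (F := fun (t : ℝ) (v : ℝ) => (kSech v : ℂ) * Complex.exp (t * v * Complex.I))
    (F' := fun (t : ℝ) (v : ℝ) =>
      (kSech v : ℂ) * (v * Complex.I * Complex.exp (t * v * Complex.I)))
    Filter.univ_mem (Eventually.of_forall fun t => (integrable_kSech_mul_exp t).1)
    (integrable_kSech_mul_exp τ)
    (by
      refine AEStronglyMeasurable.mul integrable_kSech.1 ?_
      exact Continuous.aestronglyMeasurable (by fun_prop))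
    (Eventually.of_forall fun v t _ => by
      rw [norm_mul, norm_mul, norm_exp_ofReal_mul_I, norm_mul, Complex.norm_I]
      have := abs_mul_kSech_le v
      rw [abs_mul] at this
      simpa [mul_comm] using this)
    integrable_kLog_real
    (Eventually.of_forall fun v t _ => (hasDerivAt_exp_mul_I t v).const_mul _)).2
  simp only [integral_kSech_mul_exp] at hd
  have hd2 : HasDerivAt (fun t : ℝ => ((Real.pi / Real.cosh (Real.pi * t) : ℝ) : ℂ))
      ((-(Real.pi ^ 2 * Real.sinh (Real.pi * τ) / Real.cosh (Real.pi * τ) ^ 2) : ℝ) : ℂ) τ := by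
    refine HasDerivAt.ofReal_comp ?_
    have h1 : HasDerivAt (fun t : ℝ => Real.cosh (Real.pi * t))
        (Real.sinh (Real.pi * τ) * (Real.pi * 1)) τ :=
      ((hasDerivAt_id τ).const_mul Real.pi).cosh
    refine ((hasDerivAt_const τ Real.pi).div h1 (Real.cosh_pos _).ne').congr_deriv ?_
    ring
  have key := hd.unique hd2
  have e : ∀ v : ℝ, (kSech v : ℂ) * (v * Complex.I * Complex.exp (τ * v * Complex.I))
      = Complex.I * (((v * kSech v : ℝ) : ℂ) * Complex.exp (τ * v * Complex.I)) := by
    intro v; push_cast; ring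
  simp_rw [e] at key
  rw [integral_const_mul] at key
  have := congrArg (fun z => -Complex.I * z) key
  simp only [← mul_assoc, neg_mul, Complex.I_mul_I, neg_neg, one_mul] at this
  rw [this]
  push_cast
  ring

lemma abs_kCsch_mul_sin_le (τ v : ℝ) : |kCsch v * Real.sin (τ * v)| ≤ |τ| * kLog v := by
  have h1 : |Real.sin (τ * v)| ≤ |τ| * |v| := by
    rw [← abs_mul]; exact Real.abs_sin_le_abs
  have h2 : |v| * |kCsch v| = kLog v := by
    rw [← abs_mul, ← kLog, abs_of_nonneg (kLog_nonneg v)]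
  rw [abs_mul, ← h2, ← mul_assoc, mul_comm]
  exact mul_le_mul_of_nonneg_right h1 (abs_nonneg _)

lemma integrable_kCsch_mul_sin (τ : ℝ) : Integrable fun v => kCsch v * Real.sin (τ * v) :=
  (integrable_kLog_real.const_mul |τ|).mono'
    (measurable_kCsch.mul (by fun_prop)).aestronglyMeasurable
    (Eventually.of_forall fun v => abs_kCsch_mul_sin_le τ v)

lemma integral_kLog_mul_cos (τ : ℝ) :
    ∫ v, kLog v * Real.cos (τ * v) = (Real.pi / Real.cosh (Real.pi * τ)) ^ 2 := by
  have h := congrArg Complex.re (integral_kLog_mul_exp τ)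
  rw [Complex.ofReal_re, ← RCLike.re_eq_complex_re, ← integral_re] at h
  · rw [← h]
    refine integral_congr_ae (Eventually.of_forall fun v => ?_)
    simp [← Complex.ofReal_mul, Complex.exp_ofReal_mul_I_re]
  · refine (integrable_kLog.mul_bdd (c := 1) ?_ (Eventually.of_forall fun v => ?_))
    · exact Continuous.aestronglyMeasurable (by fun_prop)
    · rw [norm_exp_ofReal_mul_I]

lemma hasDerivAt_tanh_pi (τ : ℝ) : HasDerivAt (fun t => Real.pi * Real.tanh (Real.pi * t))
    ((Real.pi / Real.cosh (Real.pi * τ)) ^ 2) τ := by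
  have h0 : HasDerivAt (fun t : ℝ => Real.pi * t) (Real.pi * 1) τ :=
    (hasDerivAt_id τ).const_mul Real.pi
  have h := ((h0.sinh).div h0.cosh (Real.cosh_pos _).ne').const_mul Real.pi
  have e : (fun t => Real.pi * Real.tanh (Real.pi * t)) =
      fun t => Real.pi * ((fun t => Real.sinh (Real.pi * t)) / fun t => Real.cosh (Real.pi * t)) t := by
    ext t; simp [Real.tanh_eq_sinh_div_cosh]
  rw [e]
  convert! h using 1
  have := Real.cosh_sq (Real.pi * τ)
  have hc := (Real.cosh_pos (Real.pi * τ)).ne'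
  field_simp
  rw [this]; ring

/-- Differentiation in τ multiplies by v and removes the singularity: the derivative is the cosine
integral of `kLog`, which is (π/cosh πτ)². This is also the derivative of π tanh πτ, and both sides
vanish at τ = 0. -/
lemma integral_kCsch_mul_sin (τ : ℝ) :
    ∫ v, kCsch v * Real.sin (τ * v) = Real.pi * Real.tanh (Real.pi * τ) := by
  have hd : ∀ τ : ℝ, HasDerivAt (fun t => ∫ v, kCsch v * Real.sin (t * v))
      ((Real.pi / Real.cosh (Real.pi * τ)) ^ 2) τ := by
    intro τ
    have := (hasDerivAt_integral_of_dominated_loc_of_deriv_le (μ := volume) (x₀ := τ)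
      (s := univ) (bound := kLog) (F := fun (t : ℝ) (v : ℝ) => kCsch v * Real.sin (t * v))
      (F' := fun (t : ℝ) (v : ℝ) => kLog v * Real.cos (t * v))
      Filter.univ_mem (Eventually.of_forall fun t => (integrable_kCsch_mul_sin t).1)
      (integrable_kCsch_mul_sin τ)
      (measurable_kLog.mul (by fun_prop)).aestronglyMeasurable
      (Eventually.of_forall fun v t _ => by
        rw [norm_mul, Real.norm_of_nonneg (kLog_nonneg v)]
        exact mul_le_of_le_one_right (kLog_nonneg v) (Real.abs_cos_le_one _))
      integrable_kLog_real
      (Eventually.of_forall fun v t _ => by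
        have h0 : HasDerivAt (fun t : ℝ => t * v) (1 * v) t := (hasDerivAt_id t).mul_const v
        refine ((h0.sin).const_mul (kCsch v)).congr_deriv ?_
        simp only [kLog]; ring)).2
    rwa [integral_kLog_mul_cos] at this
  have hz : ∀ τ : ℝ, HasDerivAt (fun t => (∫ v, kCsch v * Real.sin (t * v))
      - Real.pi * Real.tanh (Real.pi * t)) 0 τ := by
    intro τ
    have h := (hd τ).sub (hasDerivAt_tanh_pi τ)
    rw [sub_self] at h
    exact h
  have := is_const_of_deriv_eq_zero (fun t => (hz t).differentiableAt) (fun t => (hz t).deriv) τ 0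
  simp at this
  linarith

/-! ### The truncated kernel and its multiplier -/

lemma hasDerivAt_kCsch {v : ℝ} (hv : 0 < v) :
    HasDerivAt kCsch (-(Real.cosh (v / 2) / (4 * Real.sinh (v / 2) ^ 2))) v := by
  have hs := (Real.sinh_pos_iff.2 (half_pos hv)).ne'
  have h1 : HasDerivAt (fun v : ℝ => 2 * Real.sinh (v / 2))
      (2 * (Real.cosh (v / 2) * (1 / 2))) v :=
    (((hasDerivAt_id v).div_const 2).sinh).const_mul 2
  have h2 := (hasDerivAt_const v (1 : ℝ)).div h1 (by simpa using hs)
  refine h2.congr_deriv ?_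
  field_simp
  ring

lemma tendsto_kCsch_atTop : Tendsto kCsch atTop (𝓝 0) := by
  refine squeeze_zero' ?_ ?_ tendsto_inv_atTop_zero
  · filter_upwards [eventually_gt_atTop 0] with v hv using (kCsch_pos hv).le
  · filter_upwards [eventually_gt_atTop 0] with v hv
    simpa using kCsch_le_inv hv

/-- Integrate by parts. Since `kCsch` decreases to 0, the boundary term and the remaining integral
are each at most `kCsch c` ≤ 1/c, and the primitive of the sine contributes 1/τ. -/
lemma abs_integral_Ioi_kCsch_mul_sin_le_div {c τ : ℝ} (hc : 0 < c) (hτ : 0 < τ) :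
    |∫ v in Ioi c, kCsch v * Real.sin (τ * v)| ≤ 2 / (c * τ) := by
  set p' : ℝ → ℝ := fun v => -(Real.cosh (v / 2) / (4 * Real.sinh (v / 2) ^ 2)) with hp'
  have hder : ∀ v ∈ Ici c, HasDerivAt kCsch (p' v) v := fun v hv =>
    hasDerivAt_kCsch (hc.trans_le hv)
  have hneg : ∀ v ∈ Ioi c, p' v ≤ 0 := fun v _ => by
    have := Real.cosh_pos (v / 2)
    simp only [hp', neg_nonpos]
    positivity
  have hint := integrableOn_Ioi_deriv_of_nonpos' hder hneg tendsto_kCsch_atTop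
  have hval := integral_Ioi_of_hasDerivAt_of_nonpos' hder hneg tendsto_kCsch_atTop
  have hintc : IntegrableOn (fun v => Real.cos (τ * v) * p' v) (Ioi c) :=
    hint.bdd_mul (c := 1) (Continuous.aestronglyMeasurable (by fun_prop))
      (Eventually.of_forall fun v => Real.abs_cos_le_one _)
  have hints : IntegrableOn (fun v => kCsch v * Real.sin (τ * v)) (Ioi c) :=
    (integrable_kCsch_mul_sin τ).integrableOn
  have hd : ∀ v ∈ Ici c, HasDerivAt (fun v => -(Real.cos (τ * v) * kCsch v) / τ)
      (kCsch v * Real.sin (τ * v) - Real.cos (τ * v) * p' v / τ) v := by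
    intro v hv
    have h0 : HasDerivAt (fun v : ℝ => τ * v) (τ * 1) v := (hasDerivAt_id v).const_mul τ
    refine (((h0.cos.mul (hder v hv)).neg).div_const τ).congr_deriv ?_
    field_simp
    ring
  have hlim : Tendsto (fun v => -(Real.cos (τ * v) * kCsch v) / τ) atTop (𝓝 0) := by
    have : Tendsto (fun v => Real.cos (τ * v) * kCsch v) atTop (𝓝 0) := by
      refine squeeze_zero_norm' ?_ tendsto_kCsch_atTop
      filter_upwards [eventually_gt_atTop 0] with v hv
      rw [norm_mul, Real.norm_of_nonneg (kCsch_pos hv).le]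
      exact mul_le_of_le_one_left (kCsch_pos hv).le (Real.abs_cos_le_one _)
    simpa using this.neg.div_const τ
  have key := integral_Ioi_of_hasDerivAt_of_tendsto' hd (hints.sub (hintc.div_const τ)) hlim
  rw [integral_sub hints (hintc.div_const τ), integral_div] at key
  have hb : |∫ v in Ioi c, Real.cos (τ * v) * p' v| ≤ kCsch c := by
    calc |∫ v in Ioi c, Real.cos (τ * v) * p' v|
        ≤ ∫ v in Ioi c, -p' v := by
          refine norm_integral_le_of_norm_le (f := fun v => Real.cos (τ * v) * p' v)
            hint.neg ?_
          refine (ae_restrict_iff' measurableSet_Ioi).2 (Eventually.of_forall fun v hv => ?_)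
          rw [norm_mul, Real.norm_of_nonpos (hneg v hv)]
          exact mul_le_of_le_one_left (by linarith [hneg v hv]) (Real.abs_cos_le_one _)
      _ = kCsch c := by rw [integral_neg, hval]; ring
  have hc2 : |Real.cos (τ * c) * kCsch c| ≤ kCsch c := by
    rw [abs_mul, abs_of_pos (kCsch_pos hc)]
    exact mul_le_of_le_one_left (kCsch_pos hc).le (Real.abs_cos_le_one _)
  have e : ∫ v in Ioi c, kCsch v * Real.sin (τ * v)
      = (Real.cos (τ * c) * kCsch c + ∫ v in Ioi c, Real.cos (τ * v) * p' v) / τ := by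
    rw [add_div]
    linarith [neg_div τ (Real.cos (τ * c) * kCsch c)]
  rw [e, abs_div, abs_of_pos hτ, div_le_div_iff₀ hτ (by positivity)]
  have h3 : kCsch c * c ≤ 1 := by
    have := mul_le_mul_of_nonneg_right (kCsch_le_inv hc) hc.le
    rwa [one_div_mul_cancel hc.ne'] at this
  have h4 := abs_add_le (Real.cos (τ * c) * kCsch c) (∫ v in Ioi c, Real.cos (τ * v) * p' v)
  nlinarith [mul_pos hc hτ, abs_nonneg (Real.cos (τ * c) * kCsch c +
    ∫ v in Ioi c, Real.cos (τ * v) * p' v)]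

/-- The bound is uniform in a and τ, which makes the truncated kernels uniformly bounded multipliers
and permits dominated convergence as a → 0. -/
lemma abs_integral_Ioi_kCsch_mul_sin_le {a : ℝ} (ha : 0 < a) (τ : ℝ) :
    |∫ v in Ioi a, kCsch v * Real.sin (τ * v)| ≤ 3 := by
  have hpos : ∀ τ : ℝ, 0 < τ → |∫ v in Ioi a, kCsch v * Real.sin (τ * v)| ≤ 3 := by
    intro τ hτ
    -- Below 1/τ the estimate |sin τv| ≤ τv costs at most 1; beyond c the oscillation costs at most
    -- 2/(cτ) ≤ 2.
    set c := max a (1 / τ) with hcdef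
    have hac : a ≤ c := le_max_left _ _
    have hc : 0 < c := ha.trans_le hac
    have hcτ : 1 ≤ c * τ := by
      have := mul_le_mul_of_nonneg_right (le_max_right a (1 / τ)) hτ.le
      rwa [one_div_mul_cancel hτ.ne'] at this
    have hI := integrable_kCsch_mul_sin τ
    rw [← Ioc_union_Ioi_eq_Ioi hac, setIntegral_union (Ioc_disjoint_Ioi le_rfl) measurableSet_Ioi
      hI.integrableOn hI.integrableOn]
    have h1 : ‖∫ v in Ioc a c, kCsch v * Real.sin (τ * v)‖ ≤ τ * volume.real (Ioc a c) := by
      refine norm_setIntegral_le_of_norm_le_const (by simp) fun v _ => ?_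
      refine (abs_kCsch_mul_sin_le τ v).trans ?_
      rw [abs_of_pos hτ]
      exact mul_le_of_le_one_right hτ.le (kLog_le_one v)
    have h2 : τ * volume.real (Ioc a c) ≤ 1 := by
      rw [Real.volume_real_Ioc_of_le hac]
      rcases max_cases a (1 / τ) with ⟨h, _⟩ | ⟨h, _⟩
      · rw [hcdef, h]; simp
      · rw [hcdef, h, mul_sub, mul_one_div_cancel hτ.ne']
        nlinarith
    have h3 := abs_integral_Ioi_kCsch_mul_sin_le_div hc hτ
    have h4 : 2 / (c * τ) ≤ 2 := div_le_self (by norm_num) hcτ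
    have h5 := abs_add_le (∫ v in Ioc a c, kCsch v * Real.sin (τ * v))
      (∫ v in Ioi c, kCsch v * Real.sin (τ * v))
    rw [Real.norm_eq_abs] at h1
    linarith
  rcases lt_trichotomy τ 0 with h | h | h
  · have := hpos (-τ) (by linarith)
    simpa [neg_mul, integral_neg] using this
  · simp [h]
  · exact hpos τ h

lemma two_mul_integral_Ioi_kCsch_mul_sin (τ : ℝ) :
    2 * ∫ v in Ioi (0 : ℝ), kCsch v * Real.sin (τ * v) = Real.pi * Real.tanh (Real.pi * τ) := by
  rw [← integral_kCsch_mul_sin, ← integral_comp_abs]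
  refine integral_congr_ae (Eventually.of_forall fun v => ?_)
  dsimp only
  rcases le_total 0 v with h | h
  · rw [abs_of_nonneg h]
  · rw [abs_of_nonpos h, kCsch_neg, mul_neg, Real.sin_neg, neg_mul_neg]

lemma tendsto_integral_indicator {ι : Type*} {l : Filter ι} [l.IsCountablyGenerated]
    {E : Type*} [NormedAddCommGroup E] [NormedSpace ℝ E] {μ : Measure ℝ} {f : ℝ → E}
    {s : ι → Set ℝ} (hf : Integrable f μ) (hs : ∀ i, MeasurableSet (s i))
    (hlim : ∀ᵐ v ∂μ, ∀ᶠ i in l, v ∈ s i) :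
    Tendsto (fun i => ∫ v, (s i).indicator f v ∂μ) l (𝓝 (∫ v, f v ∂μ)) := by
  refine tendsto_integral_filter_of_dominated_convergence (fun v => ‖f v‖)
    (Eventually.of_forall fun i => hf.1.indicator (hs i))
    (Eventually.of_forall fun i => Eventually.of_forall fun v => norm_indicator_le_norm_self _ _)
    hf.norm ?_
  filter_upwards [hlim] with v hv
  refine tendsto_const_nhds.congr' ?_
  filter_upwards [hv] with i hi
  rw [indicator_of_mem hi]

/-- The points `v = u - w` for which `t = e^w` has distance larger than `ε e^u` from `e^u`. -/
def cutSet (ε : ℝ) : Set ℝ := Ioi (-Real.log (1 - ε)) ∪ Iio (-Real.log (1 + ε))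

lemma measurableSet_cutSet (ε : ℝ) : MeasurableSet (cutSet ε) :=
  measurableSet_Ioi.union measurableSet_Iio

section cut

variable {ε : ℝ}

lemma log_one_add_ge (h0 : 0 < ε) (h1 : ε ≤ 1 / 2) : ε / 2 ≤ Real.log (1 + ε) := by
  have h := Real.one_sub_inv_le_log_of_pos (x := 1 + ε) (by linarith)
  refine le_trans ?_ h
  rw [inv_eq_one_div, one_sub_div (by linarith), add_sub_cancel_left]
  exact div_le_div_of_nonneg_left h0.le (by linarith) (by linarith)

/-- The interval |t - x| ≤ εx is not symmetric in logarithmic coordinates. Its endpoints are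
unbalanced by -log(1-ε²) = O(ε²), which is negligible against a kernel of size 1/ε. -/
lemma neg_log_one_sub_sub_le (h0 : 0 < ε) (h1 : ε ≤ 1 / 2) :
    -Real.log (1 - ε) - Real.log (1 + ε) ≤ 2 * ε ^ 2 := by
  have hp : 0 < 1 - ε ^ 2 := by nlinarith
  have h := Real.one_sub_inv_le_log_of_pos hp
  have e : Real.log (1 - ε ^ 2) = Real.log (1 - ε) + Real.log (1 + ε) := by
    rw [← Real.log_mul (by linarith) (by linarith)]; ring_nf
  have h2 : (1 - ε ^ 2)⁻¹ ≤ 1 + 2 * ε ^ 2 := by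
    rw [inv_le_iff_one_le_mul₀ hp]
    have : 0 ≤ ε ^ 2 * (1 - 2 * ε ^ 2) := mul_nonneg (sq_nonneg ε) (by nlinarith)
    nlinarith
  linarith

lemma log_one_add_le_neg_log_one_sub (h0 : 0 < ε) (h1 : ε ≤ 1 / 2) :
    Real.log (1 + ε) ≤ -Real.log (1 - ε) := by
  have h2 := Real.log_le_sub_one_of_pos (x := 1 - ε) (by linarith)
  have h3 := Real.log_le_sub_one_of_pos (x := 1 + ε) (by linarith)
  linarith

lemma le_abs_of_mem_cutSet (h0 : 0 < ε) (h1 : ε ≤ 1 / 2) {v : ℝ} (hv : v ∈ cutSet ε) :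
    ε / 2 ≤ |v| := by
  have h2 := log_one_add_ge h0 h1
  have h3 := log_one_add_le_neg_log_one_sub h0 h1
  rcases hv with hv | hv
  · exact (h2.trans (h3.trans (le_of_lt hv))).trans (le_abs_self v)
  · refine le_trans ?_ (neg_le_abs v)
    have : v < -Real.log (1 + ε) := hv
    linarith

lemma eventually_mem_cutSet {v : ℝ} (hv : v ≠ 0) : ∀ᶠ ε in 𝓝[>] (0 : ℝ), v ∈ cutSet ε := by
  have t1 : Tendsto (fun ε : ℝ => -Real.log (1 - ε)) (𝓝[>] 0) (𝓝 0) := by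
    have : ContinuousAt (fun ε : ℝ => -Real.log (1 - ε)) 0 :=
      (ContinuousAt.log (by fun_prop) (by norm_num)).neg
    have h := this.tendsto
    simp only [sub_zero, Real.log_one, neg_zero] at h
    exact h.mono_left nhdsWithin_le_nhds
  have t2 : Tendsto (fun ε : ℝ => -Real.log (1 + ε)) (𝓝[>] 0) (𝓝 0) := by
    have : ContinuousAt (fun ε : ℝ => -Real.log (1 + ε)) 0 :=
      (ContinuousAt.log (by fun_prop) (by norm_num)).neg
    have h := this.tendsto
    simp only [add_zero, Real.log_one, neg_zero] at h
    exact h.mono_left nhdsWithin_le_nhds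
  rcases lt_or_gt_of_ne hv with h | h
  · filter_upwards [t2.eventually (lt_mem_nhds h)] with ε hε using Or.inr hε
  · filter_upwards [t1.eventually (gt_mem_nhds h)] with ε hε using Or.inl hε

end cut

/-- The part of the kernel without singularity. -/
def regularKernel (v : ℝ) : ℝ := kLog v / Real.pi - v * kSech v / Real.pi + kSech v

/-- The kernel of the integro-functional equation in logarithmic coordinates. -/
def hartleyKernel (v : ℝ) : ℝ := 1 / 2 * (regularKernel v - kCsch v)

/-- The restriction of `hartleyKernel` to `cutSet ε`. -/
def cutKernel (ε v : ℝ) : ℂ := (cutSet ε).indicator (fun v => (hartleyKernel v : ℂ)) v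

/-- The Fourier multiplier of the principal value convolution with `hartleyKernel`. -/
def multiplier (τ : ℝ) : ℂ :=
  1 / 2 * ((((Real.pi / Real.cosh (Real.pi * τ)) ^ 2 : ℝ) : ℂ) / Real.pi
    - ((Real.pi ^ 2 * Real.sinh (Real.pi * τ) / Real.cosh (Real.pi * τ) ^ 2 : ℝ) : ℂ)
        * Complex.I / Real.pi
    + (Real.pi / Real.cosh (Real.pi * τ) : ℝ)
    - (Real.pi * Real.tanh (Real.pi * τ) : ℝ) * Complex.I)

lemma measurable_regularKernel : Measurable regularKernel :=
  ((measurable_kLog.div_const _).sub ((measurable_id.mul measurable_kSech).div_const _)).add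
    measurable_kSech

lemma integrable_mul_exp {κ : ℝ → ℂ} (hκ : Integrable κ) (τ : ℝ) :
    Integrable fun v : ℝ => κ v * Complex.exp (τ * v * Complex.I) :=
  hκ.mul_bdd (c := 1) (Continuous.aestronglyMeasurable (by fun_prop))
    (Eventually.of_forall fun v => by rw [norm_exp_ofReal_mul_I])

lemma ofReal_regularKernel (v : ℝ) : (regularKernel v : ℂ)
    = (kLog v : ℂ) / Real.pi - ((v * kSech v : ℝ) : ℂ) / Real.pi + (kSech v : ℂ) := by
  rw [regularKernel]; push_cast; ring

lemma integrable_regularKernel : Integrable fun v => (regularKernel v : ℂ) := by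
  simp_rw [ofReal_regularKernel]
  exact ((integrable_kLog.div_const _).sub (integrable_mul_kSech.div_const _)).add integrable_kSech

lemma abs_regularKernel_le (v : ℝ) : |regularKernel v| ≤ 3 := by
  have hπ : 1 ≤ Real.pi := by linarith [Real.pi_gt_three]
  have h1 : |kLog v / Real.pi| ≤ 1 := by
    rw [abs_div, abs_of_pos Real.pi_pos, abs_of_nonneg (kLog_nonneg v)]
    exact (div_le_self (kLog_nonneg v) hπ).trans (kLog_le_one v)
  have h2 : |v * kSech v / Real.pi| ≤ 1 := by
    rw [abs_div, abs_of_pos Real.pi_pos]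
    exact ((div_le_self (abs_nonneg _) hπ).trans (abs_mul_kSech_le v)).trans (kLog_le_one v)
  have h3 : |kSech v| ≤ 1 := by
    rw [abs_of_pos (kSech_pos v)]; exact kSech_le_one v
  rw [abs_le] at *
  unfold regularKernel
  constructor <;> linarith

lemma integral_regularKernel_mul_exp (τ : ℝ) :
    ∫ v : ℝ, (regularKernel v : ℂ) * Complex.exp (τ * v * Complex.I)
      = (((Real.pi / Real.cosh (Real.pi * τ)) ^ 2 : ℝ) : ℂ) / Real.pi
    - ((Real.pi ^ 2 * Real.sinh (Real.pi * τ) / Real.cosh (Real.pi * τ) ^ 2 : ℝ) : ℂ)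
        * Complex.I / Real.pi
    + (Real.pi / Real.cosh (Real.pi * τ) : ℝ) := by
  have i1 := (integrable_mul_exp integrable_kLog τ).div_const (Real.pi : ℂ)
  have i2 := (integrable_mul_exp integrable_mul_kSech τ).div_const (Real.pi : ℂ)
  have i3 := integrable_kSech_mul_exp τ
  have i12 : Integrable fun v : ℝ => (kLog v : ℂ) * Complex.exp (τ * v * Complex.I) / Real.pi
      - ((v * kSech v : ℝ) : ℂ) * Complex.exp (τ * v * Complex.I) / Real.pi := i1.sub i2
  rw [← integral_kLog_mul_exp, ← integral_mul_kSech_mul_exp, ← integral_kSech_mul_exp,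
    ← integral_div, ← integral_div, ← integral_sub i1 i2, ← integral_add i12 i3]
  refine integral_congr_ae (Eventually.of_forall fun v => ?_)
  dsimp only
  rw [ofReal_regularKernel]
  ring

section cutKernel

variable {ε : ℝ}

lemma norm_cutKernel_le (h0 : 0 < ε) (h1 : ε ≤ 1 / 2) (v : ℝ) :
    ‖cutKernel ε v‖ ≤ |regularKernel v| + 2 / ε * kLog v := by
  have hk := kLog_nonneg v
  by_cases hv : v ∈ cutSet ε
  · rw [cutKernel, indicator_of_mem hv, Complex.norm_real, hartleyKernel, Real.norm_eq_abs, abs_mul,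
      abs_of_pos (by norm_num : (0 : ℝ) < 1 / 2)]
    have h2 := le_abs_of_mem_cutSet h0 h1 hv
    have h3 : |kCsch v| ≤ 2 / ε * kLog v := by
      rw [← abs_of_nonneg hk, kLog, abs_mul, ← mul_assoc]
      refine le_mul_of_one_le_left (abs_nonneg _) ?_
      rw [div_mul_eq_mul_div, one_le_div h0]
      linarith
    have h4 := abs_sub (regularKernel v) (kCsch v)
    have h5 := abs_nonneg (regularKernel v - kCsch v)
    linarith
  · rw [cutKernel, indicator_of_notMem hv, norm_zero]
    positivity

lemma measurable_cutKernel (ε : ℝ) : Measurable (cutKernel ε) := by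
  refine Measurable.indicator (Complex.measurable_ofReal.comp ?_) (measurableSet_cutSet ε)
  exact (measurable_regularKernel.sub measurable_kCsch).const_mul _

lemma integrable_cutKernel (h0 : 0 < ε) (h1 : ε ≤ 1 / 2) : Integrable (cutKernel ε) := by
  have h2 : Integrable fun v => |regularKernel v| + 2 / ε * kLog v := by
    refine Integrable.add ?_ (integrable_kLog_real.const_mul _)
    simpa using integrable_regularKernel.norm
  exact h2.mono' (measurable_cutKernel ε).aestronglyMeasurable
    (Eventually.of_forall (norm_cutKernel_le h0 h1))

lemma memLp_cutKernel (h0 : 0 < ε) (h1 : ε ≤ 1 / 2) : MemLp (cutKernel ε) 2 := by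
  refine memLp_two_of_bounded (integrable_cutKernel h0 h1) (3 + 2 / ε) fun v => ?_
  refine (norm_cutKernel_le h0 h1 v).trans (add_le_add (abs_regularKernel_le v) ?_)
  exact mul_le_of_le_one_right (by positivity) (kLog_le_one v)

end cutKernel

/-! ### The symbol and the multiplier on the critical line. -/

lemma one_add_sinh_mul_I_mul (τ : ℝ) :
    (1 + (Real.sinh (Real.pi * τ) : ℂ) * Complex.I) * (1 - (Real.sinh (Real.pi * τ) : ℂ) * Complex.I)
      = (Real.cosh (Real.pi * τ) : ℂ) ^ 2 := by
  have h : (Real.cosh (Real.pi * τ) : ℂ) ^ 2 = (Real.sinh (Real.pi * τ) : ℂ) ^ 2 + 1 := by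
    exact_mod_cast Real.cosh_sq (Real.pi * τ)
  rw [h]
  linear_combination (-(Real.sinh (Real.pi * τ) : ℂ) ^ 2) * Complex.I_sq

lemma ofReal_cosh_ne_zero (x : ℝ) : (Real.cosh x : ℂ) ≠ 0 := by
  exact_mod_cast (Real.cosh_pos x).ne'

lemma one_add_sinh_mul_I_ne_zero (τ : ℝ) :
    1 + (Real.sinh (Real.pi * τ) : ℂ) * Complex.I ≠ 0 := by
  intro h
  have := one_add_sinh_mul_I_mul τ
  rw [h, zero_mul] at this
  exact pow_ne_zero 2 (ofReal_cosh_ne_zero _) this.symm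

/-- On the line sin πs = cosh πτ and cos πs = -i sinh πτ, so the half-angle formula gives sin²(πs/2)
= (1 + i sinh πτ)/2. -/
lemma symbol_line_eq (τ : ℝ) :
    symbol (line τ) = (Real.sqrt (2 * Real.pi) : ℂ) * (1 + (Real.cosh (Real.pi * τ) : ℂ))
      / (1 + (Real.sinh (Real.pi * τ) : ℂ) * Complex.I) := by
  have e : (Real.pi : ℂ) * line τ = ((Real.pi * τ : ℝ) : ℂ) * Complex.I + Real.pi / 2 := by
    simp only [line]; push_cast; ring
  have h1 : Complex.sin (Real.pi * line τ) = (Real.cosh (Real.pi * τ) : ℂ) := by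
    rw [e, Complex.sin_add_pi_div_two, Complex.cos_mul_I, Complex.ofReal_cosh]
  have h2 : Complex.cos (Real.pi * line τ) = -((Real.sinh (Real.pi * τ) : ℂ) * Complex.I) := by
    rw [e, Complex.cos_add_pi_div_two, Complex.sin_mul_I, Complex.ofReal_sinh]
  have h3 : Complex.sin (Real.pi * line τ / 2) ^ 2
      = (1 + (Real.sinh (Real.pi * τ) : ℂ) * Complex.I) / 2 := by
    rw [Complex.sin_sq, Complex.cos_sq, mul_div_cancel₀ _ (two_ne_zero' ℂ), h2]
    ring
  have h4 : Real.sqrt (2 * Real.pi) = 2 * Real.sqrt (Real.pi / 2) := by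
    rw [Real.sqrt_eq_iff_mul_self_eq (by positivity) (by positivity)]
    have := Real.mul_self_sqrt (show 0 ≤ Real.pi / 2 by positivity)
    linear_combination (-4) * this
  have h5 := one_add_sinh_mul_I_ne_zero τ
  rw [symbol, h1, h3, h4]
  push_cast at *
  field_simp

/-- With c = cosh πτ and σ = sinh πτ, the four transforms add up to (π/2)(1 + c)(1 - iσ)/c², and c²
= (1 + iσ)(1 - iσ). -/
lemma multiplier_eq (τ : ℝ) :
    multiplier τ = Real.pi / 2 * (1 + (Real.cosh (Real.pi * τ) : ℂ))
      / (1 + (Real.sinh (Real.pi * τ) : ℂ) * Complex.I) := by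
  have h5 := one_add_sinh_mul_I_ne_zero τ
  have h6 := ofReal_cosh_ne_zero (Real.pi * τ)
  have h7 : (Real.pi : ℂ) ≠ 0 := by exact_mod_cast Real.pi_ne_zero
  have key := one_add_sinh_mul_I_mul τ
  rw [eq_div_iff h5, multiplier, Real.tanh_eq_sinh_div_cosh]
  set c : ℂ := (Real.cosh (Real.pi * τ) : ℂ) with hc
  set s : ℂ := (Real.sinh (Real.pi * τ) : ℂ) with hs
  have e : (1 / 2 : ℂ) * ((((Real.pi / Real.cosh (Real.pi * τ)) ^ 2 : ℝ) : ℂ) / Real.pi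
    - ((Real.pi ^ 2 * Real.sinh (Real.pi * τ) / Real.cosh (Real.pi * τ) ^ 2 : ℝ) : ℂ)
        * Complex.I / Real.pi
    + (Real.pi / Real.cosh (Real.pi * τ) : ℝ)
    - (Real.pi * (Real.sinh (Real.pi * τ) / Real.cosh (Real.pi * τ)) : ℝ) * Complex.I)
      = Real.pi / 2 * (1 + c) * (1 - s * Complex.I) / c ^ 2 := by
    simp only [Complex.ofReal_div, Complex.ofReal_mul, Complex.ofReal_pow, ← hc, ← hs]
    field_simp
    ring
  rw [e, div_mul_eq_mul_div, div_eq_iff (pow_ne_zero 2 h6)]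
  linear_combination (Real.pi / 2 * (1 + c)) * key

/-- The multiplier of the singular integral operator is the symbol of the equation. -/
lemma symbol_line (τ : ℝ) :
    (((2 : ℝ) ^ ((3 : ℝ) / 2) / Real.sqrt Real.pi : ℝ) : ℂ) * multiplier τ
      = symbol (line τ) := by
  have h1 : (2 : ℝ) ^ ((3 : ℝ) / 2) / Real.sqrt Real.pi * (Real.pi / 2)
      = Real.sqrt (2 * Real.pi) := by
    have h2 : (2 : ℝ) ^ ((3 : ℝ) / 2) = 2 * Real.sqrt 2 := by
      rw [show (3 : ℝ) / 2 = 1 + 1 / 2 by norm_num, Real.rpow_add two_pos, Real.rpow_one,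
        ← Real.sqrt_eq_rpow]
    have h3 := Real.mul_self_sqrt Real.pi_pos.le
    have h4 := Real.sqrt_pos.2 Real.pi_pos
    rw [h2, Real.sqrt_mul two_pos.le, div_mul_eq_mul_div, div_eq_iff h4.ne']
    linear_combination (-Real.sqrt 2) * h3
  rw [symbol_line_eq, multiplier_eq, ← h1]
  push_cast
  ring

/-- `|symbol|` exceeds `√(2π)` on the critical line. -/
lemma sqrt_lt_norm_symbol_line (τ : ℝ) : Real.sqrt (2 * Real.pi) < ‖symbol (line τ)‖ := by
  have hc := Real.cosh_pos (Real.pi * τ)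
  have h1 : ‖1 + (Real.sinh (Real.pi * τ) : ℂ) * Complex.I‖ = Real.cosh (Real.pi * τ) := by
    have h := Complex.norm_add_mul_I 1 (Real.sinh (Real.pi * τ))
    rw [Complex.ofReal_one] at h
    rw [h, one_pow, add_comm, ← Real.cosh_sq, Real.sqrt_sq hc.le]
  have h2 : ‖1 + (Real.cosh (Real.pi * τ) : ℂ)‖ = 1 + Real.cosh (Real.pi * τ) := by
    rw [← Complex.ofReal_one, ← Complex.ofReal_add, Complex.norm_real,
      Real.norm_of_nonneg (by linarith)]
  have h3 : 0 < Real.sqrt (2 * Real.pi) := Real.sqrt_pos.2 (by positivity)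
  rw [symbol_line_eq, norm_div, norm_mul, h1, h2, Complex.norm_real, Real.norm_of_nonneg h3.le,
    lt_div_iff₀ hc]
  nlinarith

/-- The two denominators are conjugate, with product cosh² πτ. Expanding the square gives 2π +
4·(π/cosh πτ) + (2/π)·(π/cosh πτ)², which are the transforms of the three operators in the integral
equation, apart from λ². -/
lemma symbol_line_mul_symbol_line_neg (τ : ℝ) :
    symbol (line τ) * symbol (line (-τ))
      = 2 * Real.pi * (1 + 1 / (Real.cosh (Real.pi * τ) : ℂ)) ^ 2 := by
  have h5 := one_add_sinh_mul_I_ne_zero τ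
  have h6 := ofReal_cosh_ne_zero (Real.pi * τ)
  have key := one_add_sinh_mul_I_mul τ
  have h8 : 1 - (Real.sinh (Real.pi * τ) : ℂ) * Complex.I ≠ 0 := by
    intro h
    rw [h, mul_zero] at key
    exact pow_ne_zero 2 h6 key.symm
  have h7 : (Real.sqrt (2 * Real.pi) : ℂ) * (Real.sqrt (2 * Real.pi) : ℂ) = 2 * Real.pi := by
    exact_mod_cast Real.mul_self_sqrt (show 0 ≤ 2 * Real.pi by positivity)
  rw [symbol_line_eq, symbol_line_eq, mul_neg, Real.cosh_neg, Real.sinh_neg, Complex.ofReal_neg,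
    neg_mul, ← sub_eq_add_neg, div_mul_div_comm, key, ← h7]
  field_simp
  ring

/-! ### The integral operators in logarithmic coordinates -/

lemma exp_eq_sq (u : ℝ) : Real.exp u = Real.exp (u / 2) ^ 2 := by
  rw [← Real.exp_nat_mul]; ring_nf

lemma kSech_sub (u w : ℝ) : kSech (u - w) = Real.exp (u / 2) * Real.exp (w / 2) /
    (Real.exp (u / 2) ^ 2 + Real.exp (w / 2) ^ 2) := by
  have hp := Real.exp_pos (u / 2)
  have hq := Real.exp_pos (w / 2)
  rw [kSech, Real.cosh_eq, sub_div, neg_sub, Real.exp_sub, Real.exp_sub]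
  field_simp

lemma kCsch_sub (u w : ℝ) : kCsch (u - w) = Real.exp (u / 2) * Real.exp (w / 2) /
    (Real.exp (u / 2) ^ 2 - Real.exp (w / 2) ^ 2) := by
  have hp := Real.exp_pos (u / 2)
  have hq := Real.exp_pos (w / 2)
  rw [kCsch, Real.sinh_eq, mul_div_cancel₀ _ (two_ne_zero' ℝ), sub_div u w, neg_sub, Real.exp_sub,
    Real.exp_sub, div_sub_div _ _ hq.ne' hp.ne', one_div_div]
  ring_nf

lemma exp_mul_div_add (μ : ℝ → ℂ) (u w : ℝ) :
    (Real.exp w : ℂ) * (μ (Real.exp w) / ((Real.exp u + Real.exp w : ℝ) : ℂ))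
      = (Real.exp (-(u / 2)) : ℂ) * ((kSech (u - w) : ℂ) * logPullback μ w) := by
  have hp := (Real.exp_pos (u / 2)).ne'
  have h : Real.exp w / (Real.exp u + Real.exp w)
      = Real.exp (-(u / 2)) * (kSech (u - w) * Real.exp (w / 2)) := by
    rw [kSech_sub, exp_eq_sq u, exp_eq_sq w, Real.exp_neg]
    field_simp
  have h' := congrArg (fun r : ℝ => (r : ℂ) * μ (Real.exp w)) h
  simp only [Complex.ofReal_div, Complex.ofReal_mul] at h'
  rw [logPullback]
  linear_combination h'

lemma exp_mul_log_div_sub (μ : ℝ → ℂ) (u w : ℝ) :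
    (Real.exp w : ℂ) * ((Real.log (Real.exp u / Real.exp w) : ℂ) * μ (Real.exp w) /
        ((Real.exp u - Real.exp w : ℝ) : ℂ))
      = (Real.exp (-(u / 2)) : ℂ) * ((kLog (u - w) : ℂ) * logPullback μ w) := by
  have hp := (Real.exp_pos (u / 2)).ne'
  have h : Real.exp w * (Real.log (Real.exp u / Real.exp w) / (Real.exp u - Real.exp w))
      = Real.exp (-(u / 2)) * (kLog (u - w) * Real.exp (w / 2)) := by
    rw [kLog, kCsch_sub, ← Real.exp_sub, Real.log_exp, exp_eq_sq u, exp_eq_sq w, Real.exp_neg]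
    field_simp
  have h' := congrArg (fun r : ℝ => (r : ℂ) * μ (Real.exp w)) h
  simp only [Complex.ofReal_div, Complex.ofReal_mul] at h'
  rw [logPullback]
  linear_combination h'

lemma integrable_kernel_mul {κ m : ℝ → ℂ} (hκ : MemLp κ 2) (hm : MemLp m 2) (u : ℝ) :
    Integrable fun w => κ (u - w) * m w :=
  (hκ.comp_measurePreserving (Measure.measurePreserving_sub_left volume u)).integrable_mul hm

/-- In logarithmic coordinates both kernels are translates of L² functions, so Cauchy–Schwarz gives
absolute convergence at every point. -/
lemma integralsConverge_of_memLp {μ : ℝ → ℂ} (hμ : MemLp μ 2 halfLine) {x : ℝ} (hx : 0 < x) :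
    IntegralsConverge μ x := by
  have hm := memLp_halfLine_iff.1 hμ
  obtain ⟨u, rfl⟩ : ∃ u, Real.exp u = x := ⟨Real.log x, Real.exp_log hx⟩
  constructor
  · rw [integrableOn_Ioi_iff_exp]
    simp_rw [exp_mul_div_add]
    exact (integrable_kernel_mul memLp_kSech hm u).const_mul _
  · rw [integrableOn_Ioi_iff_exp]
    simp_rw [exp_mul_log_div_sub]
    exact (integrable_kernel_mul memLp_kLog hm u).const_mul _

lemma exp_neg_half_mul_exp_half (u : ℝ) :
    (Real.exp (u / 2) : ℂ) * (Real.exp (-(u / 2)) : ℂ) = 1 := by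
  rw [← Complex.ofReal_mul, ← Real.exp_add]; simp

/-- The integral equation says that its Fourier multiplier annihilates the Mellin transform. -/
theorem SolvesIntegralEquation.multiplier_mul_eq_zero {lam : ℂ} {μ : ℝ → ℂ} {φ : ℂ → ℂ}
    (h : SolvesIntegralEquation lam μ) (hμ : IsInvMellin φ μ) :
    ∀ᵐ τ : ℝ, (symbol (line τ) * symbol (line (-τ)) - lam ^ 2) * φ (line τ) = 0 := by
  have hp := isInvMellin_iff_isFourierPair.1 hμ
  have p1 := hp.convolution integrable_kSech memLp_kSech
  have p2 := hp.convolution integrable_kLog memLp_kLog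
  have p := ((hp.const_smul (2 * (Real.pi : ℂ) - lam ^ 2)).add (p1.const_smul 4)).add
    (p2.const_smul (2 / (Real.pi : ℂ)))
  have h0 : IsFourierPair (0 : ℝ → ℂ) 0 := by
    have := hp.sub hp
    simpa using this
  -- Multiplied by e^{u/2}, the integral equation says that the combination of convolutions in `p`
  -- vanishes almost everywhere; hence so does its transform.
  have hz := (p.congr_left (g' := 0) (by
    filter_upwards [ae_halfLine_iff.1 h] with u hu
    rw [integral_Ioi_eq_integral_exp, integral_Ioi_eq_integral_exp] at hu
    simp_rw [exp_mul_div_add, exp_mul_log_div_sub] at hu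
    rw [integral_const_mul, integral_const_mul] at hu
    have e := exp_neg_half_mul_exp_half u
    simp only [Pi.add_apply, Pi.smul_apply, smul_eq_mul, Pi.zero_apply]
    have hu' := congrArg (fun z => (Real.exp (u / 2) : ℂ) * z) hu
    simp only [mul_zero] at hu'
    rw [← hu', logPullback]
    linear_combination (-(4 * (∫ w, (kSech (u - w) : ℂ) * logPullback μ w)
      + 2 / (Real.pi : ℂ) * ∫ w, (kLog (u - w) : ℂ) * logPullback μ w)) * e)).unique_right h0
  refine ae_freq_iff.1 ?_
  filter_upwards [hz] with ξ hξ
  simp only [Pi.add_apply, Pi.smul_apply, smul_eq_mul, Pi.zero_apply, fourier_kSech,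
    fourier_kLog] at hξ
  rw [symbol_line_mul_symbol_line_neg, ← hξ]
  have h7 : (Real.pi : ℂ) ≠ 0 := by exact_mod_cast Real.pi_ne_zero
  have h6 := ofReal_cosh_ne_zero (Real.pi * freq ξ)
  rw [Complex.ofReal_pow, Complex.ofReal_div]
  field_simp
  ring

/-- A cut of radius proportional to x depends on u - w only, so the truncated operator is a
convolution. -/
lemma mem_cutSet_iff {ε : ℝ} (h0 : 0 < ε) (h1 : ε ≤ 1 / 2) (u w : ℝ) :
    u - w ∈ cutSet ε ↔ ε * Real.exp u < |Real.exp w - Real.exp u| := by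
  have hu := Real.exp_pos u
  have e : Real.exp w - Real.exp u = (Real.exp (w - u) - 1) * Real.exp u := by
    rw [sub_mul, ← Real.exp_add]; ring_nf
  rw [e, abs_mul, abs_of_pos hu, mul_lt_mul_iff_left₀ hu, lt_abs, cutSet]
  have a1 : u - w ∈ Ioi (-Real.log (1 - ε)) ↔ ε < -(Real.exp (w - u) - 1) := by
    have : ε < -(Real.exp (w - u) - 1) ↔ Real.exp (w - u) < 1 - ε := by
      constructor <;> intro h <;> linarith
    rw [this, ← Real.lt_log_iff_exp_lt (by linarith), mem_Ioi]
    constructor <;> intro h <;> linarith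
  have a2 : u - w ∈ Iio (-Real.log (1 + ε)) ↔ ε < Real.exp (w - u) - 1 := by
    have : ε < Real.exp (w - u) - 1 ↔ 1 + ε < Real.exp (w - u) := by
      constructor <;> intro h <;> linarith
    rw [this, ← Real.log_lt_iff_lt_exp (by linarith), mem_Iio]
    constructor <;> intro h <;> linarith
  rw [mem_union, a1, a2, or_comm]

/-- With p = e^{u/2} and q = e^{w/2}, partial fractions give pq/(p²-q²) - pq/(p²+q²) = 2pq³/(p⁴-q⁴).
The diagonal is excluded: division by zero makes `kernel x x = 0`, while `hartleyKernel 0` is 1/4.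
-/
lemma exp_mul_kernel_mul (f : ℝ → ℂ) {u w : ℝ} (h : u ≠ w) :
    (Real.exp w : ℂ) * ((kernel (Real.exp u) (Real.exp w) : ℂ) * f (Real.exp w))
      = (Real.exp (-(u / 2)) : ℂ) * ((hartleyKernel (u - w) : ℂ) * logPullback f w) := by
  have hp := Real.exp_pos (u / 2)
  have hq := Real.exp_pos (w / 2)
  have h1 : Real.exp w * kernel (Real.exp u) (Real.exp w)
      = Real.exp (-(u / 2)) * (hartleyKernel (u - w) * Real.exp (w / 2)) := by
    have hne : Real.exp (u / 2) - Real.exp (w / 2) ≠ 0 := by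
      rw [sub_ne_zero, Ne, Real.exp_eq_exp]
      intro h'; exact h (by linarith)
    have hsum : Real.exp (u / 2) + Real.exp (w / 2) ≠ 0 := by positivity
    have h2 : Real.exp (u / 2) ^ 2 - Real.exp (w / 2) ^ 2 ≠ 0 := by
      rw [sq_sub_sq]; exact mul_ne_zero hsum hne
    have h3 : Real.exp (u / 2) ^ 2 + Real.exp (w / 2) ^ 2 ≠ 0 := by positivity
    have h4 : (Real.exp (u / 2) ^ 2) ^ 2 - (Real.exp (w / 2) ^ 2) ^ 2 ≠ 0 := by
      rw [sq_sub_sq]; exact mul_ne_zero h3 h2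
    have e : hartleyKernel (u - w)
        = 1 / 2 * (((u - w) / Real.pi - 1) * (kCsch (u - w) - kSech (u - w))) := by
      rw [hartleyKernel, regularKernel, kLog]; ring
    have e2 : kCsch (u - w) - kSech (u - w) = 2 * (Real.exp (u / 2) * Real.exp (w / 2) ^ 3) /
        ((Real.exp (u / 2) ^ 2) ^ 2 - (Real.exp (w / 2) ^ 2) ^ 2) := by
      rw [kCsch_sub, kSech_sub, div_sub_div _ _ h2 h3, sq_sub_sq (Real.exp (u / 2) ^ 2),
        mul_comm (Real.exp (u / 2) ^ 2 + _)]
      congr 1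
      ring
    rw [e, e2, kernel, ← Real.exp_sub, Real.log_exp, exp_eq_sq u, exp_eq_sq w, Real.exp_neg]
    field_simp
  have h' := congrArg (fun r : ℝ => (r : ℂ) * f (Real.exp w)) h1
  simp only [Complex.ofReal_mul] at h'
  rw [logPullback]
  linear_combination h'

/-! ### Approximate identities at Lebesgue points -/

/-- `u` is a Lebesgue point of `m`. -/
def IsLebesguePoint (m : ℝ → ℂ) (u : ℝ) : Prop :=
  Tendsto (fun r => ⨍ w in Metric.closedBall u r, ‖m w - m u‖) (𝓝[>] 0) (𝓝 0)

lemma ae_isLebesguePoint {m : ℝ → ℂ} (hm : MemLp m 2) : ∀ᵐ u, IsLebesguePoint m u := by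
  filter_upwards [IsUnifLocDoublingMeasure.ae_tendsto_average_norm_sub volume
    (hm.locallyIntegrable (by norm_num)) 1] with u hu
  refine hu (fun _ => u) (fun r => r) tendsto_id ?_
  filter_upwards [self_mem_nhdsWithin] with r hr
  have : (0 : ℝ) < r := hr
  simp [this.le]

/-- The Poisson kernel, up to normalization. -/
def poisson (η v : ℝ) : ℝ := η / (η ^ 2 + v ^ 2)

lemma poisson_nonneg {η : ℝ} (hη : 0 < η) (v : ℝ) : 0 ≤ poisson η v := by
  unfold poisson; positivity

lemma poisson_le_inv {η : ℝ} (hη : 0 < η) (v : ℝ) : poisson η v ≤ 1 / η := by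
  unfold poisson
  rw [div_le_div_iff₀ (by positivity) hη]
  nlinarith [sq_nonneg v]

lemma integrable_poisson {η : ℝ} (hη : 0 < η) : Integrable (poisson η) := by
  have h := (integrable_inv_one_add_sq.comp_div hη.ne').const_mul (1 / η)
  refine h.congr (Eventually.of_forall fun v => ?_)
  simp only [poisson]
  field_simp

/-- Take the least k with |v| ≤ 2^k η. If k ≥ 1 then |v| > 2^{k-1} η, so the kernel is at most
1/(4^{k-1} η); this is the source of the factor 4. -/
lemma exists_poisson_le {η : ℝ} (hη : 0 < η) (v : ℝ) :
    ∃ k : ℕ, |v| ≤ 2 ^ k * η ∧ poisson η v ≤ 4 * (1 / 4) ^ k / η := by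
  classical
  have hex : ∃ k : ℕ, |v| ≤ 2 ^ k * η := by
    obtain ⟨k, hk⟩ := pow_unbounded_of_one_lt (|v| / η) (one_lt_two)
    exact ⟨k, by rw [div_lt_iff₀ hη] at hk; exact hk.le⟩
  refine ⟨Nat.find hex, Nat.find_spec hex, ?_⟩
  rcases hk : Nat.find hex with _ | k
  · refine (poisson_le_inv hη v).trans ?_
    rw [pow_zero]
    exact div_le_div_of_nonneg_right (by norm_num) hη.le
  · have h1 : ¬ |v| ≤ 2 ^ k * η := Nat.find_min hex (by omega)
    have h2 : (2 ^ k * η) ^ 2 ≤ v ^ 2 := by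
      rw [← sq_abs v]
      exact pow_le_pow_left₀ (by positivity) (not_le.1 h1).le 2
    have h3 : (2 ^ k : ℝ) ^ 2 = 4 ^ k := by rw [← pow_mul, mul_comm, pow_mul]; norm_num
    have h4 : (4 : ℝ) * (1 / 4) ^ (k + 1) = 1 / 4 ^ k := by
      rw [pow_succ, one_div_pow]; ring
    rw [h4, poisson, div_div, div_le_div_iff₀ (by positivity) (by positivity)]
    rw [mul_pow, h3] at h2
    nlinarith

/-- The mean oscillation of `m` at `u` on the scale `r`, up to normalization. -/
def oscillation (m : ℝ → ℂ) (u r : ℝ) : ℝ :=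
  1 / r * ∫ w in Metric.closedBall u r, ‖m w - m u‖

lemma oscillation_nonneg (m : ℝ → ℂ) (u : ℝ) {r : ℝ} (hr : 0 < r) : 0 ≤ oscillation m u r :=
  mul_nonneg (by positivity) (integral_nonneg fun _ => norm_nonneg _)

lemma IsLebesguePoint.tendsto_oscillation {m : ℝ → ℂ} {u : ℝ} (h : IsLebesguePoint m u) :
    Tendsto (oscillation m u) (𝓝[>] 0) (𝓝 0) := by
  have h2 := Tendsto.const_mul (2 : ℝ) h
  rw [mul_zero] at h2
  refine h2.congr' ?_
  filter_upwards [self_mem_nhdsWithin] with r hr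
  have hr' : (0 : ℝ) < r := hr
  rw [setAverage_eq, Real.volume_real_closedBall hr'.le, oscillation, smul_eq_mul]
  field_simp

lemma integrableOn_norm_sub {m : ℝ → ℂ} (hm : MemLp m 2) (u r : ℝ) :
    IntegrableOn (fun w => ‖m w - m u‖) (Metric.closedBall u r) := by
  have h1 : IntegrableOn m (Metric.closedBall u r) :=
    (hm.locallyIntegrable (by norm_num)).integrableOn_isCompact (isCompact_closedBall u r)
  have h2 : IntegrableOn (fun _ : ℝ => m u) (Metric.closedBall u r) :=
    integrableOn_const (isCompact_closedBall u r).measure_lt_top.ne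
  exact (h1.sub h2).norm

/-- Small radii are controlled by the Lebesgue point, large ones by ‖m‖ ≤ ‖m‖² + 1 and the
finiteness of the L² norm. The bound dominates the dyadic sum over all scales. -/
lemma exists_oscillation_le {m : ℝ → ℂ} (hm : MemLp m 2) {u : ℝ} (h : IsLebesguePoint m u) :
    ∃ C : ℝ, ∀ r, 0 < r → oscillation m u r ≤ C := by
  have hev := h.tendsto_oscillation.eventually (gt_mem_nhds one_pos)
  obtain ⟨r₀, hr₀, hsmall⟩ := mem_nhdsGT_iff_exists_Ioo_subset.1 hev
  have hr₀' : (0 : ℝ) < r₀ := hr₀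
  have hsq : Integrable fun w => ‖m w‖ ^ 2 := (memLp_two_iff_integrable_sq_norm hm.1).1 hm
  set I := ∫ w, ‖m w‖ ^ 2 with hI
  have hI0 : 0 ≤ I := integral_nonneg fun _ => by positivity
  refine ⟨1 + (I / r₀ + 2 * (1 + ‖m u‖)), fun r hr => ?_⟩
  by_cases hrr : r < r₀
  · have : oscillation m u r < 1 := hsmall ⟨hr, hrr⟩
    have : 0 ≤ I / r₀ + 2 * (1 + ‖m u‖) := by positivity
    linarith
  · have hle : r₀ ≤ r := not_lt.1 hrr
    have hc : IntegrableOn (fun _ : ℝ => 1 + ‖m u‖) (Metric.closedBall u r) :=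
      integrableOn_const (isCompact_closedBall u r).measure_lt_top.ne
    have h1 : ∫ w in Metric.closedBall u r, ‖m w - m u‖
        ≤ ∫ w in Metric.closedBall u r, (‖m w‖ ^ 2 + (1 + ‖m u‖)) := by
      refine integral_mono (integrableOn_norm_sub hm u r) (hsq.integrableOn.add hc) fun w => ?_
      have := norm_sub_le (m w) (m u)
      have h2 : ‖m w‖ ≤ ‖m w‖ ^ 2 + 1 := by nlinarith [sq_nonneg (‖m w‖ - 1)]
      dsimp only
      linarith
    rw [integral_add hsq.integrableOn hc, setIntegral_const, Real.volume_real_closedBall hr.le,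
      smul_eq_mul] at h1
    have h2 : ∫ w in Metric.closedBall u r, ‖m w‖ ^ 2 ≤ I :=
      setIntegral_le_integral hsq (Eventually.of_forall fun w => by positivity)
    have h3 : oscillation m u r ≤ 1 / r * (I + 2 * r * (1 + ‖m u‖)) :=
      mul_le_mul_of_nonneg_left (by linarith) (by positivity)
    have h4 : 1 / r * (I + 2 * r * (1 + ‖m u‖)) = I / r + 2 * (1 + ‖m u‖) := by
      field_simp
    have h5 : I / r ≤ I / r₀ := div_le_div_of_nonneg_left hI0 hr₀' hle
    linarith

lemma tendsto_tsum_oscillation {m : ℝ → ℂ} (hm : MemLp m 2) {u : ℝ} (h : IsLebesguePoint m u) :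
    Tendsto (fun η => ∑' k : ℕ, 4 * (1 / 2) ^ k * oscillation m u (2 ^ k * η)) (𝓝[>] 0)
      (𝓝 0) := by
  obtain ⟨C, hC⟩ := exists_oscillation_le hm h
  have hs : Summable fun k : ℕ => 4 * (1 / 2 : ℝ) ^ k * C :=
    (summable_geometric_two.mul_left 4).mul_right C
  have key := tendsto_tsum_of_dominated_convergence
    (f := fun η (k : ℕ) => 4 * (1 / 2 : ℝ) ^ k * oscillation m u (2 ^ k * η))
    (g := fun _ => (0 : ℝ)) hs (fun k => by
      have h1 : Tendsto (fun η : ℝ => 2 ^ k * η) (𝓝[>] 0) (𝓝[>] 0) := by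
        refine tendsto_nhdsWithin_iff.2 ⟨?_, ?_⟩
        · have : Tendsto (fun η : ℝ => 2 ^ k * η) (𝓝 0) (𝓝 (2 ^ k * 0)) := tendsto_id.const_mul _
          rw [mul_zero] at this
          exact this.mono_left nhdsWithin_le_nhds
        · filter_upwards [self_mem_nhdsWithin] with η hη
          have : (0 : ℝ) < η := hη
          exact mul_pos (by positivity) this
      simpa using (h.tendsto_oscillation.comp h1).const_mul (4 * (1 / 2 : ℝ) ^ k))
    (by
      filter_upwards [self_mem_nhdsWithin] with η hη k
      have hη' : (0 : ℝ) < η := hη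
      have hpos : 0 < 2 ^ k * η := by positivity
      rw [Real.norm_of_nonneg (mul_nonneg (by positivity) (oscillation_nonneg m u hpos))]
      exact mul_le_mul_of_nonneg_left (hC _ hpos) (by positivity))
  simpa using key

/-- On the ball of radius 2^k η the weight 4·4^{-k}/η times the integral of ‖m - m(u)‖ equals
4·2^{-k} times the oscillation, which is summable in k. -/
lemma lintegral_poisson_mul_le {m : ℝ → ℂ} (hm : MemLp m 2) {u : ℝ} (h : IsLebesguePoint m u)
    {η : ℝ} (hη : 0 < η) :
    ∫⁻ w, ENNReal.ofReal (poisson η (u - w)) * ‖m w - m u‖ₑ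
      ≤ ENNReal.ofReal (∑' k : ℕ, 4 * (1 / 2) ^ k * oscillation m u (2 ^ k * η)) := by
  obtain ⟨C, hC⟩ := exists_oscillation_le hm h
  have hterm : ∀ k : ℕ, 0 ≤ 4 * (1 / 2 : ℝ) ^ k * oscillation m u (2 ^ k * η) := fun k =>
    mul_nonneg (by positivity) (oscillation_nonneg m u (by positivity))
  have hs : Summable fun k : ℕ => 4 * (1 / 2 : ℝ) ^ k * oscillation m u (2 ^ k * η) := by
    refine Summable.of_nonneg_of_le hterm (fun k => ?_)
      ((summable_geometric_two.mul_left 4).mul_right C)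
    exact mul_le_mul_of_nonneg_left (hC _ (by positivity)) (by positivity)
  rw [ENNReal.ofReal_tsum_of_nonneg hterm hs]
  have hmeas : AEMeasurable (fun w => ‖m w - m u‖ₑ) volume :=
    (hm.1.sub aestronglyMeasurable_const).enorm
  calc ∫⁻ w, ENNReal.ofReal (poisson η (u - w)) * ‖m w - m u‖ₑ
      ≤ ∫⁻ w, ∑' k : ℕ, ENNReal.ofReal (4 * (1 / 4) ^ k / η) *
          (Metric.closedBall u (2 ^ k * η)).indicator (fun w => ‖m w - m u‖ₑ) w := by
        refine lintegral_mono fun w => ?_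
        obtain ⟨k, hk1, hk2⟩ := exists_poisson_le hη (u - w)
        refine le_trans ?_ (ENNReal.le_tsum k)
        have hw : w ∈ Metric.closedBall u (2 ^ k * η) := by
          rw [Metric.mem_closedBall, Real.dist_eq, abs_sub_comm]; exact hk1
        rw [indicator_of_mem hw]
        gcongr
    _ = ∑' k : ℕ, ∫⁻ w, ENNReal.ofReal (4 * (1 / 4) ^ k / η) *
          (Metric.closedBall u (2 ^ k * η)).indicator (fun w => ‖m w - m u‖ₑ) w :=
        lintegral_tsum fun k => (hmeas.indicator measurableSet_closedBall).const_mul _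
    _ = ∑' k : ℕ, ENNReal.ofReal (4 * (1 / 2) ^ k * oscillation m u (2 ^ k * η)) := by
        refine tsum_congr fun k => ?_
        rw [lintegral_const_mul' _ _ ENNReal.ofReal_ne_top,
          lintegral_indicator measurableSet_closedBall]
        have h1 : ∫⁻ w in Metric.closedBall u (2 ^ k * η), ‖m w - m u‖ₑ
            = ENNReal.ofReal (∫ w in Metric.closedBall u (2 ^ k * η), ‖m w - m u‖) := by
          rw [ofReal_integral_eq_lintegral_ofReal (integrableOn_norm_sub hm u _)
            (Eventually.of_forall fun _ => norm_nonneg _)]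
          simp_rw [ofReal_norm]
        rw [h1, ← ENNReal.ofReal_mul (by positivity), oscillation]
        congr 1
        have h2 : ((1 : ℝ) / 2) ^ k = (1 / 4) ^ k * 2 ^ k := by
          rw [← mul_pow]; norm_num
        rw [h2]
        field_simp

/-- Families of kernels dominated by the Poisson kernel act at Lebesgue points as approximate
identities. -/
theorem IsLebesguePoint.tendsto_integral_of_le_poisson {m : ℝ → ℂ} (hm : MemLp m 2) {u : ℝ}
    (h : IsLebesguePoint m u) {E : ℝ → ℝ → ℂ} {C : ℝ} {c : ℂ}
    (hE : ∀ᶠ η in 𝓝[>] 0, AEStronglyMeasurable (E η) volume)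
    (hb : ∀ᶠ η in 𝓝[>] 0, ∀ v, ‖E η v‖ ≤ C * poisson η v)
    (hc : Tendsto (fun η => ∫ v, E η v) (𝓝[>] 0) (𝓝 c)) :
    Tendsto (fun η => ∫ w, E η (u - w) * m w) (𝓝[>] 0) (𝓝 (c * m u)) := by
  -- Write m(w) = m(u) + (m(w) - m(u)). The oscillating part is handled by the dyadic sum; the
  -- constant part contributes the total mass of the kernel.
  have h1 : Tendsto (fun η => ∫ w, E η (u - w) * (m w - m u)) (𝓝[>] 0) (𝓝 0) := by
    rw [tendsto_zero_iff_norm_tendsto_zero]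
    have h2 := (tendsto_tsum_oscillation hm h).const_mul |C|
    rw [mul_zero] at h2
    refine squeeze_zero' (Eventually.of_forall fun _ => norm_nonneg _) ?_ h2
    filter_upwards [hb, self_mem_nhdsWithin] with η hη hη0
    have hη0' : (0 : ℝ) < η := hη0
    have hnn : 0 ≤ ∑' k : ℕ, 4 * (1 / 2 : ℝ) ^ k * oscillation m u (2 ^ k * η) :=
      tsum_nonneg fun k => mul_nonneg (by positivity) (oscillation_nonneg m u (by positivity))
    rw [← ENNReal.ofReal_le_ofReal_iff (by positivity), ofReal_norm]
    calc ‖∫ w, E η (u - w) * (m w - m u)‖ₑ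
        ≤ ∫⁻ w, ‖E η (u - w) * (m w - m u)‖ₑ := enorm_integral_le_lintegral_enorm _
      _ ≤ ∫⁻ w, ENNReal.ofReal |C| *
            (ENNReal.ofReal (poisson η (u - w)) * ‖m w - m u‖ₑ) := by
          refine lintegral_mono fun w => ?_
          rw [enorm_mul, ← mul_assoc, ← ENNReal.ofReal_mul (abs_nonneg C), ← ofReal_norm (E _ _)]
          gcongr
          refine (hη _).trans ?_
          exact mul_le_mul_of_nonneg_right (le_abs_self C) (poisson_nonneg hη0' _)
      _ = ENNReal.ofReal |C| *
            ∫⁻ w, ENNReal.ofReal (poisson η (u - w)) * ‖m w - m u‖ₑ :=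
          lintegral_const_mul' _ _ ENNReal.ofReal_ne_top
      _ ≤ _ := by
          rw [ENNReal.ofReal_mul (abs_nonneg C)]
          gcongr
          exact lintegral_poisson_mul_le hm h hη0'
  have h3 := h1.add (hc.mul_const (m u))
  rw [zero_add] at h3
  refine h3.congr' ?_
  filter_upwards [hE, hb, self_mem_nhdsWithin] with η hEη hη hη0
  have hη0' : (0 : ℝ) < η := hη0
  have i1 : Integrable (E η) :=
    ((integrable_poisson hη0').const_mul C).mono' hEη (Eventually.of_forall hη)
  have i2 : MemLp (E η) 2 := by
    refine memLp_two_of_bounded i1 (|C| * (1 / η)) fun v => (hη v).trans ?_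
    refine (mul_le_mul_of_nonneg_right (le_abs_self C) (poisson_nonneg hη0' v)).trans ?_
    exact mul_le_mul_of_nonneg_left (poisson_le_inv hη0' v) (abs_nonneg C)
  have i3 := integrable_kernel_mul i2 hm u
  have i4 : Integrable fun w => E η (u - w) * m u := (i1.comp_sub_left u).mul_const _
  rw [← integral_sub_left_eq_self (E η) volume u, ← integral_mul_const]
  simp_rw [mul_sub]
  rw [integral_sub i3 i4, sub_add_cancel]

/-- The triangular approximate identity. -/
def triangle (η v : ℝ) : ℝ := max 0 (η - |v|) / η ^ 2

section triangle

variable {η : ℝ}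

lemma triangle_nonneg (η v : ℝ) : 0 ≤ triangle η v := by
  unfold triangle; positivity

lemma triangle_neg (η v : ℝ) : triangle η (-v) = triangle η v := by simp [triangle]

lemma triangle_eq_zero {v : ℝ} (h : η ≤ |v|) : triangle η v = 0 := by
  rw [triangle, max_eq_left (by linarith), zero_div]

lemma continuous_triangle (η : ℝ) : Continuous (triangle η) := by
  unfold triangle; fun_prop

lemma triangle_le (hη : 0 < η) (v : ℝ) : triangle η v ≤ 2 * poisson η v := by
  rcases le_or_gt η |v| with h | h
  · rw [triangle_eq_zero h]
    exact mul_nonneg two_pos.le (poisson_nonneg hη v)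
  · rw [triangle, max_eq_right (by linarith), poisson, mul_div_assoc',
      div_le_div_iff₀ (by positivity) (by positivity)]
    have h2 : v ^ 2 ≤ η ^ 2 := by rw [← sq_abs v]; exact pow_le_pow_left₀ (abs_nonneg v) h.le 2
    have h3 : (η - |v|) * (η ^ 2 + v ^ 2) ≤ η * (2 * η ^ 2) :=
      mul_le_mul (by linarith [abs_nonneg v]) (by linarith) (by positivity) hη.le
    linarith

/-- The Lipschitz bound is what makes the symmetrized principal value integrand bounded near the
singularity. -/
lemma abs_triangle_sub_le (hη : 0 < η) (x y : ℝ) :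
    |triangle η x - triangle η y| ≤ |x - y| / η ^ 2 := by
  rw [triangle, triangle, ← sub_div, abs_div, abs_of_pos (show 0 < η ^ 2 by positivity)]
  refine div_le_div_of_nonneg_right ?_ (by positivity)
  refine (abs_max_sub_max_le_max 0 (η - |x|) 0 (η - |y|)).trans ?_
  rw [sub_self, abs_zero, max_eq_right (abs_nonneg _), sub_sub_sub_cancel_left, abs_sub_comm]
  exact abs_abs_sub_abs_le_abs_sub x y

lemma integrable_triangle (hη : 0 < η) : Integrable (triangle η) :=
  ((integrable_poisson hη).const_mul 2).mono' (continuous_triangle η).aestronglyMeasurable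
    (Eventually.of_forall fun v => by
      rw [Real.norm_of_nonneg (triangle_nonneg η v)]; exact triangle_le hη v)

lemma memLp_triangle (hη : 0 < η) : MemLp (fun v => (triangle η v : ℂ)) 2 := by
  refine memLp_two_of_bounded (integrable_triangle hη).ofReal (2 * (1 / η)) fun v => ?_
  rw [Complex.norm_real, Real.norm_of_nonneg (triangle_nonneg η v)]
  exact (triangle_le hη v).trans (mul_le_mul_of_nonneg_left (poisson_le_inv hη v) two_pos.le)

lemma integral_triangle (hη : 0 < η) : ∫ v, triangle η v = 1 := by
  have e : ∀ v, triangle η v = (fun x => max 0 (η - x) / η ^ 2) |v| := fun v => rfl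
  simp_rw [e]
  rw [integral_comp_abs (f := fun x => max 0 (η - x) / η ^ 2), ← Ioc_union_Ioi_eq_Ioi hη.le]
  have hz : ∀ x ∈ Ioi η, max 0 (η - x) / η ^ 2 = 0 := fun x hx => by
    have : η < x := hx
    rw [max_eq_left (by linarith), zero_div]
  have i1 : IntegrableOn (fun x => max 0 (η - x) / η ^ 2) (Ioc 0 η) :=
    (Continuous.integrableOn_Icc (by fun_prop)).mono_set Ioc_subset_Icc_self
  have i2 : IntegrableOn (fun x => max 0 (η - x) / η ^ 2) (Ioi η) :=
    (integrableOn_zero).congr_fun (fun x hx => (hz x hx).symm) measurableSet_Ioi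
  rw [setIntegral_union (Ioc_disjoint_Ioi le_rfl) measurableSet_Ioi i1 i2,
    setIntegral_congr_fun measurableSet_Ioi hz, integral_zero, add_zero,
    setIntegral_congr_fun (g := fun x => (η - x) / η ^ 2) measurableSet_Ioc (fun x hx => by
      dsimp only; rw [max_eq_right (by linarith [hx.2])]), ← intervalIntegral.integral_of_le hη.le,
    intervalIntegral.integral_div, intervalIntegral.integral_sub (by simp) (by simp)]
  simp
  field_simp
  ring

end triangle

/-- Convolution with the triangular approximate identity converges at Lebesgue points. -/
lemma IsLebesguePoint.tendsto_integral_triangle {m : ℝ → ℂ} (hm : MemLp m 2) {u : ℝ}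
    (h : IsLebesguePoint m u) :
    Tendsto (fun η => ∫ w, (triangle η (u - w) : ℂ) * m w) (𝓝[>] 0) (𝓝 (m u)) := by
  have := h.tendsto_integral_of_le_poisson hm (E := fun η v => (triangle η v : ℂ)) (C := 2)
    (c := 1) (Eventually.of_forall fun η =>
      (Complex.continuous_ofReal.comp (continuous_triangle η)).aestronglyMeasurable)
    (by
      filter_upwards [self_mem_nhdsWithin] with η hη v
      rw [Complex.norm_real, Real.norm_of_nonneg (triangle_nonneg η v)]
      exact triangle_le hη v)
    (by
      refine tendsto_const_nhds.congr' ?_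
      filter_upwards [self_mem_nhdsWithin] with η hη
      rw [integral_complex_ofReal, integral_triangle hη, Complex.ofReal_one])
  rwa [one_mul] at this

/-! ### Almost everywhere existence of principal values -/

/-- The kernel `1 / (2 sinh (v/2))` restricted to `|v| > a`. -/
def cutCsch (a v : ℝ) : ℝ := {v : ℝ | a < |v|}.indicator kCsch v

lemma measurableSet_lt_abs (a : ℝ) : MeasurableSet {v : ℝ | a < |v|} :=
  measurableSet_lt measurable_const (by fun_prop)

lemma measurable_cutCsch (a : ℝ) : Measurable (cutCsch a) :=
  measurable_kCsch.indicator (measurableSet_lt_abs a)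

lemma cutCsch_neg (a v : ℝ) : cutCsch a (-v) = -cutCsch a v := by
  by_cases h : a < |v|
  · rw [cutCsch, cutCsch, indicator_of_mem (show -v ∈ {v : ℝ | a < |v|} by simpa using h),
      indicator_of_mem (show v ∈ {v : ℝ | a < |v|} from h), kCsch_neg]
  · rw [cutCsch, cutCsch, indicator_of_notMem (show -v ∉ {v : ℝ | a < |v|} by simpa using h),
      indicator_of_notMem (show v ∉ {v : ℝ | a < |v|} from h), neg_zero]

section cutCsch

variable {a : ℝ}

lemma abs_cutCsch_le_kLog (ha : 0 < a) (v : ℝ) : |cutCsch a v| ≤ kLog v / a := by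
  by_cases h : a < |v|
  · rw [cutCsch, indicator_of_mem (show v ∈ {v : ℝ | a < |v|} from h), le_div_iff₀ ha,
      ← abs_of_nonneg (kLog_nonneg v), kLog, abs_mul, mul_comm]
    exact mul_le_mul_of_nonneg_right h.le (abs_nonneg _)
  · rw [cutCsch, indicator_of_notMem (show v ∉ {v : ℝ | a < |v|} from h), abs_zero]
    exact div_nonneg (kLog_nonneg v) ha.le

lemma abs_cutCsch_le_inv (ha : 0 < a) (v : ℝ) : |cutCsch a v| ≤ 1 / a :=
  (abs_cutCsch_le_kLog ha v).trans (div_le_div_of_nonneg_right (kLog_le_one v) ha.le)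

lemma integrable_cutCsch (ha : 0 < a) : Integrable fun v => (cutCsch a v : ℂ) := by
  have : Integrable (cutCsch a) := (integrable_kLog_real.div_const a).mono'
    (measurable_cutCsch a).aestronglyMeasurable (Eventually.of_forall (abs_cutCsch_le_kLog ha))
  exact this.ofReal

lemma integral_cutCsch_mul (ha : 0 < a) {q : ℝ → ℂ} (hq : Continuous q) {B : ℝ}
    (hB : ∀ v, ‖q v‖ ≤ B) :
    ∫ v, (cutCsch a v : ℂ) * q v = ∫ v in Ioi a, (kCsch v : ℂ) * (q v - q (-v)) := by
  have hF : Integrable fun v => (cutCsch a v : ℂ) * q v :=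
    (integrable_cutCsch ha).mul_bdd (c := B) hq.aestronglyMeasurable (Eventually.of_forall hB)
  have hF' : Integrable fun v => (cutCsch a (-v) : ℂ) * q (-v) := hF.comp_neg
  rw [← intervalIntegral.integral_Iic_add_Ioi (b := 0) hF.integrableOn hF.integrableOn]
  have h1 := integral_comp_neg_Ioi 0 (fun v => (cutCsch a v : ℂ) * q v)
  rw [neg_zero] at h1
  rw [← h1, ← integral_add hF'.integrableOn hF.integrableOn,
    ← inter_eq_self_of_subset_right (Ioi_subset_Ioi ha.le), ← setIntegral_indicator measurableSet_Ioi]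
  refine setIntegral_congr_fun measurableSet_Ioi fun v hv => ?_
  have hv' : (0 : ℝ) < v := hv
  rw [cutCsch_neg]
  by_cases h : a < v
  · rw [indicator_of_mem (show v ∈ Ioi a from h), cutCsch,
      indicator_of_mem (show v ∈ {v : ℝ | a < |v|} from h.trans_le (le_abs_self v))]
    push_cast
    ring
  · rw [indicator_of_notMem (show v ∉ Ioi a from h), cutCsch, indicator_of_notMem
      (show v ∉ {v : ℝ | a < |v|} by rw [mem_ofPred_eq, abs_of_pos hv']; exact h)]
    simp

lemma fourier_cutCsch (ha : 0 < a) (ξ : ℝ) :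
    𝓕 (fun v => (cutCsch a v : ℂ)) ξ
      = 2 * Complex.I * ((∫ v in Ioi a, kCsch v * Real.sin (freq ξ * v) : ℝ) : ℂ) := by
  rw [fourier_eq_integral_freq, integral_cutCsch_mul ha (by fun_prop)
    (fun v => (norm_exp_ofReal_mul_I (freq ξ) v).le), ← integral_complex_ofReal,
    ← integral_const_mul]
  refine integral_congr_ae (Eventually.of_forall fun v => ?_)
  have h2 : (freq ξ : ℂ) * ((-v : ℝ) : ℂ) * Complex.I = -((freq ξ : ℂ) * v) * Complex.I := by
    push_cast; ring
  have h3 := Complex.two_sin ((freq ξ : ℂ) * v)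
  dsimp only
  rw [h2]
  push_cast
  linear_combination (-(kCsch v : ℂ) * Complex.I) * h3 - (kCsch v : ℂ) *
    (Complex.exp (-((freq ξ : ℂ) * v) * Complex.I) - Complex.exp ((freq ξ : ℂ) * v * Complex.I)) *
      Complex.I_sq

lemma norm_fourier_cutCsch_le (ha : 0 < a) (ξ : ℝ) :
    ‖𝓕 (fun v => (cutCsch a v : ℂ)) ξ‖ ≤ 6 := by
  rw [fourier_cutCsch ha, norm_mul, norm_mul, Complex.norm_I, Complex.norm_real, Real.norm_eq_abs]
  have := abs_integral_Ioi_kCsch_mul_sin_le ha (freq ξ)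
  norm_num
  linarith

lemma tendsto_fourier_cutCsch (ξ : ℝ) :
    Tendsto (fun a => 𝓕 (fun v => (cutCsch a v : ℂ)) ξ) (𝓝[>] 0)
      (𝓝 ((Real.pi * Real.tanh (Real.pi * freq ξ) : ℝ) * Complex.I)) := by
  have h := tendsto_integral_indicator (l := 𝓝[>] (0 : ℝ)) (μ := volume.restrict (Ioi (0 : ℝ)))
    (s := fun a => Ioi a)
    (integrable_kCsch_mul_sin (freq ξ)).integrableOn (fun _ => measurableSet_Ioi) (by
      refine (ae_restrict_iff' measurableSet_Ioi).2 (Eventually.of_forall fun v hv => ?_)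
      exact nhdsWithin_le_nhds (gt_mem_nhds hv))
  have h2 := ((Complex.continuous_ofReal.tendsto _).comp h).const_mul (2 * Complex.I)
  have e : 2 * Complex.I * ((∫ v in Ioi (0 : ℝ), kCsch v * Real.sin (freq ξ * v) : ℝ) : ℂ)
      = (Real.pi * Real.tanh (Real.pi * freq ξ) : ℝ) * Complex.I := by
    rw [← two_mul_integral_Ioi_kCsch_mul_sin]; push_cast; ring
  rw [e] at h2
  refine h2.congr' ?_
  filter_upwards [self_mem_nhdsWithin] with a ha
  have ha' : (0 : ℝ) < a := ha
  simp only [Function.comp]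
  rw [fourier_cutCsch ha', setIntegral_indicator measurableSet_Ioi,
    inter_eq_self_of_subset_right (Ioi_subset_Ioi ha'.le)]

end cutCsch

/-! ### The smoothed principal value kernel. -/

/-- The symmetrized integrand of the principal value convolution of `kCsch` with `triangle η`. -/
def pvIntegrand (η v z : ℝ) : ℝ := kCsch z * (triangle η (v - z) - triangle η (v + z))

/-- The principal value convolution of `kCsch` with `triangle η`. -/
def pvTriangle (η v : ℝ) : ℝ := ∫ z in Ioi (0 : ℝ), pvIntegrand η v z

lemma pvIntegrand_neg (η v z : ℝ) : pvIntegrand η (-v) z = -pvIntegrand η v z := by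
  have h1 : triangle η (-v - z) = triangle η (v + z) := by rw [← triangle_neg]; ring_nf
  have h2 : triangle η (-v + z) = triangle η (v - z) := by rw [← triangle_neg]; ring_nf
  rw [pvIntegrand, pvIntegrand, h1, h2]; ring

lemma pvTriangle_neg (η v : ℝ) : pvTriangle η (-v) = -pvTriangle η v := by
  simp only [pvTriangle, pvIntegrand_neg, integral_neg]

lemma measurable_pvIntegrand (η : ℝ) :
    Measurable (Function.uncurry fun v z => pvIntegrand η v z) := by
  have := (continuous_triangle η).measurable
  have h2 := measurable_kCsch
  unfold pvIntegrand Function.uncurry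
  exact (h2.comp measurable_snd).mul ((this.comp (measurable_fst.sub measurable_snd)).sub
    (this.comp (measurable_fst.add measurable_snd)))

lemma measurable_pvTriangle (η : ℝ) : Measurable (pvTriangle η) :=
  (StronglyMeasurable.integral_prod_right
    (ν := volume.restrict (Ioi (0 : ℝ))) (measurable_pvIntegrand η).stronglyMeasurable).measurable

section pv

variable {η : ℝ}

/-- The factor `kCsch z` ≤ 1/z is compensated by the Lipschitz bound 2z/η² of the difference, and
both triangles vanish once z exceeds |v| + η. -/
lemma abs_pvIntegrand_le (hη : 0 < η) (v : ℝ) {z : ℝ} (hz : 0 < z) :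
    |pvIntegrand η v z| ≤ (Ioc 0 (|v| + η)).indicator (fun _ => 2 / η ^ 2) z := by
  by_cases h : z ≤ |v| + η
  · rw [indicator_of_mem (show z ∈ Ioc 0 (|v| + η) from ⟨hz, h⟩), pvIntegrand, abs_mul,
      abs_of_pos (kCsch_pos hz)]
    have h1 := abs_triangle_sub_le hη (v - z) (v + z)
    have h2 : |v - z - (v + z)| = 2 * z := by
      rw [show v - z - (v + z) = -(2 * z) by ring, abs_neg, abs_of_pos (by linarith)]
    rw [h2] at h1
    refine (mul_le_mul (kCsch_le_inv hz) h1 (abs_nonneg _) (by positivity)).trans (le_of_eq ?_)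
    field_simp
  · have h' := not_le.1 h
    have h1 : η ≤ |v - z| := by
      have := abs_sub_abs_le_abs_sub z v
      rw [abs_of_pos hz, abs_sub_comm] at this
      linarith
    have h2 : η ≤ |v + z| := by
      have := abs_sub_abs_le_abs_sub z (-v)
      rw [abs_of_pos hz, abs_neg, sub_neg_eq_add, add_comm z v] at this
      linarith
    rw [pvIntegrand, triangle_eq_zero h1, triangle_eq_zero h2, sub_zero, mul_zero, abs_zero]
    exact indicator_nonneg (fun _ _ => by positivity) _

lemma integrableOn_pvIntegrand (hη : 0 < η) (v : ℝ) :
    IntegrableOn (pvIntegrand η v) (Ioi 0) := by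
  have hb : Integrable ((Ioc 0 (|v| + η)).indicator fun _ : ℝ => 2 / η ^ 2) :=
    (integrable_indicator_iff measurableSet_Ioc).2 (integrableOn_const (by simp))
  refine Integrable.mono' hb.integrableOn
    ((measurable_pvIntegrand η).comp measurable_prodMk_left).aestronglyMeasurable ?_
  exact (ae_restrict_iff' measurableSet_Ioi).2
    (Eventually.of_forall fun z hz => abs_pvIntegrand_le hη v hz)

lemma abs_setIntegral_pvIntegrand_le_div (hη : 0 < η) {v : ℝ} (hv : |v| ≤ 2 * η) {a : ℝ}
    (ha : 0 ≤ a) : |∫ z in Ioi a, pvIntegrand η v z| ≤ 6 / η := by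
  have hb : Integrable ((Ioc 0 (|v| + η)).indicator fun _ : ℝ => 2 / η ^ 2) :=
    (integrable_indicator_iff measurableSet_Ioc).2 (integrableOn_const (by simp))
  calc |∫ z in Ioi a, pvIntegrand η v z|
      ≤ ∫ z in Ioi a, (Ioc 0 (|v| + η)).indicator (fun _ => 2 / η ^ 2) z :=
        norm_integral_le_of_norm_le (f := pvIntegrand η v) hb.integrableOn
          ((ae_restrict_iff' measurableSet_Ioi).2
            (Eventually.of_forall fun z hz => abs_pvIntegrand_le hη v (ha.trans_lt hz)))
    _ ≤ ∫ z, (Ioc 0 (|v| + η)).indicator (fun _ => 2 / η ^ 2) z :=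
        setIntegral_le_integral hb (Eventually.of_forall fun z =>
          indicator_nonneg (fun _ _ => by positivity) _)
    _ = (|v| + η) * (2 / η ^ 2) := by
        rw [integral_indicator measurableSet_Ioc, setIntegral_const,
          Real.volume_real_Ioc_of_le (by positivity), smul_eq_mul, sub_zero]
    _ ≤ 3 * η * (2 / η ^ 2) := mul_le_mul_of_nonneg_right (by linarith) (by positivity)
    _ = 6 / η := by field_simp; norm_num

lemma pvIntegrand_of_lt (hη : 0 < η) {v z : ℝ} (hv : 2 * η < v) (hz : 0 < z) :
    pvIntegrand η v z = kCsch z * triangle η (v - z) := by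
  rw [pvIntegrand, triangle_eq_zero (v := v + z) (by rw [abs_of_pos (by linarith)]; linarith),
    sub_zero]

lemma half_lt_of_triangle_ne_zero {v z : ℝ} (hv : 2 * η < v) (h : triangle η (v - z) ≠ 0) :
    v / 2 < z ∧ |z - v| ≤ η := by
  have h1 : |v - z| < η := by
    by_contra h2
    exact h (triangle_eq_zero (not_lt.1 h2))
  rw [abs_sub_comm] at h1
  exact ⟨by linarith [(abs_lt.1 h1).1], h1.le⟩

lemma integral_triangle_sub (hη : 0 < η) (v : ℝ) : ∫ z, triangle η (v - z) = 1 := by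
  rw [integral_sub_left_eq_self (triangle η) volume v, integral_triangle hη]

lemma abs_setIntegral_pvIntegrand_le_of_pos (hη : 0 < η) {v : ℝ} (hv : 2 * η < v) {a : ℝ}
    (ha : 0 ≤ a) : |∫ z in Ioi a, pvIntegrand η v z| ≤ 2 / v := by
  have hv0 : 0 < v := by linarith
  have hb : Integrable fun z => 2 / v * triangle η (v - z) :=
    ((integrable_triangle hη).comp_sub_left v).const_mul _
  calc |∫ z in Ioi a, pvIntegrand η v z|
      ≤ ∫ z in Ioi a, 2 / v * triangle η (v - z) := by
        refine norm_integral_le_of_norm_le (f := pvIntegrand η v) hb.integrableOn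
          ((ae_restrict_iff' measurableSet_Ioi).2 (Eventually.of_forall fun z hz => ?_))
        have hz0 : 0 < z := ha.trans_lt hz
        rw [pvIntegrand_of_lt hη hv hz0, norm_mul, Real.norm_of_nonneg (triangle_nonneg _ _),
          Real.norm_of_nonneg (kCsch_pos hz0).le]
        by_cases h : triangle η (v - z) = 0
        · simp [h]
        · refine mul_le_mul_of_nonneg_right ((kCsch_le_inv hz0).trans ?_) (triangle_nonneg _ _)
          have := (half_lt_of_triangle_ne_zero hv h).1
          rw [div_le_div_iff₀ hz0 hv0]
          linarith
    _ ≤ ∫ z, 2 / v * triangle η (v - z) :=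
        setIntegral_le_integral hb (Eventually.of_forall fun z =>
          mul_nonneg (by positivity) (triangle_nonneg _ _))
    _ = 2 / v := by rw [integral_const_mul, integral_triangle_sub hη, mul_one]

/-- An L² majorant independent of the truncation a. For |v| ≤ 2η the square is at most 36/η², and η²
+ v² ≤ 5η² gives the constant 180; for |v| > 2η the square is at most 4/v². -/
lemma abs_setIntegral_pvIntegrand_le (hη : 0 < η) (v : ℝ) {a : ℝ} (ha : 0 ≤ a) :
    |∫ z in Ioi a, pvIntegrand η v z| ≤ Real.sqrt (180 / η * poisson η v) := by
  refine Real.abs_le_sqrt ?_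
  have e : 180 / η * poisson η v = 180 / (η ^ 2 + v ^ 2) := by
    rw [poisson]; field_simp
  rw [e]
  rcases le_or_gt |v| (2 * η) with h | h
  · have h1 := abs_setIntegral_pvIntegrand_le_div hη h ha
    rw [← sq_abs]
    refine (pow_le_pow_left₀ (abs_nonneg _) h1 2).trans ?_
    have h2 : v ^ 2 ≤ (2 * η) ^ 2 := by rw [← sq_abs v]; exact pow_le_pow_left₀ (abs_nonneg v) h 2
    rw [div_pow, div_le_div_iff₀ (by positivity) (by positivity)]
    nlinarith
  · have hv0 : 0 < |v| := by linarith
    have h1 : |∫ z in Ioi a, pvIntegrand η v z| ≤ 2 / |v| := by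
      rcases le_total 0 v with hv | hv
      · rw [abs_of_nonneg hv] at h ⊢
        exact abs_setIntegral_pvIntegrand_le_of_pos hη h ha
      · rw [abs_of_nonpos hv] at h ⊢
        have := abs_setIntegral_pvIntegrand_le_of_pos hη h ha
        simpa only [pvIntegrand_neg, integral_neg, abs_neg] using this
    rw [← sq_abs]
    refine (pow_le_pow_left₀ (abs_nonneg _) h1 2).trans ?_
    have h2 : (2 * η) ^ 2 ≤ v ^ 2 := by
      rw [← sq_abs v]; exact pow_le_pow_left₀ (by positivity) h.le 2
    have h3 : 0 < v ^ 2 := by rw [← sq_abs v]; positivity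
    rw [div_pow, sq_abs, div_le_div_iff₀ h3 (by positivity)]
    nlinarith

lemma memLp_sqrt_poisson (hη : 0 < η) :
    MemLp (fun v => ((Real.sqrt (180 / η * poisson η v) : ℝ) : ℂ)) 2 := by
  have hc : Continuous (poisson η) := by
    unfold poisson
    exact continuous_const.div (by fun_prop) fun v => by positivity
  have hm : AEStronglyMeasurable
      (fun v => ((Real.sqrt (180 / η * poisson η v) : ℝ) : ℂ)) volume :=
    Continuous.aestronglyMeasurable (by fun_prop)
  rw [memLp_two_iff_integrable_sq_norm hm]
  refine ((integrable_poisson hη).const_mul (180 / η)).congr (Eventually.of_forall fun v => ?_)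
  dsimp only
  rw [Complex.norm_real, Real.norm_of_nonneg (Real.sqrt_nonneg _), Real.sq_sqrt]
  exact mul_nonneg (by positivity) (poisson_nonneg hη v)

lemma cutCsch_convolution_triangle (hη : 0 < η) {a : ℝ} (ha : 0 < a) (v : ℝ) :
    ((fun v => (cutCsch a v : ℂ)) ⋆[ContinuousLinearMap.mul ℂ ℂ] fun v => (triangle η v : ℂ)) v
      = ((∫ z in Ioi a, pvIntegrand η v z : ℝ) : ℂ) := by
  have hct := continuous_triangle η
  rw [convolution_def]
  simp only [ContinuousLinearMap.mul_apply']
  rw [integral_cutCsch_mul ha (q := fun z => (triangle η (v - z) : ℂ)) (by fun_prop)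
    (B := 2 * (1 / η)) (fun z => by
      rw [Complex.norm_real, Real.norm_of_nonneg (triangle_nonneg η _)]
      exact (triangle_le hη _).trans (mul_le_mul_of_nonneg_left (poisson_le_inv hη _) two_pos.le)),
    ← integral_complex_ofReal]
  refine integral_congr_ae (Eventually.of_forall fun z => ?_)
  simp only [pvIntegrand, sub_neg_eq_add]
  push_cast
  rfl

lemma tendsto_setIntegral_pvIntegrand (hη : 0 < η) (v : ℝ) :
    Tendsto (fun a => ∫ z in Ioi a, pvIntegrand η v z) (𝓝[>] 0) (𝓝 (pvTriangle η v)) := by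
  have h := tendsto_integral_indicator (l := 𝓝[>] (0 : ℝ)) (μ := volume.restrict (Ioi (0 : ℝ)))
    (s := fun a => Ioi a) (integrableOn_pvIntegrand hη v) (fun _ => measurableSet_Ioi) (by
      refine (ae_restrict_iff' measurableSet_Ioi).2 (Eventually.of_forall fun v hv => ?_)
      exact nhdsWithin_le_nhds (gt_mem_nhds hv))
  refine h.congr' ?_
  filter_upwards [self_mem_nhdsWithin] with a ha
  have ha' : (0 : ℝ) < a := ha
  rw [setIntegral_indicator measurableSet_Ioi,
    inter_eq_self_of_subset_right (Ioi_subset_Ioi ha'.le)]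

/-- Smoothing the principal value convolution by the triangular kernel. -/
lemma integral_pvTriangle_mul (hη : 0 < η) {m G W : ℝ → ℂ} (hm : IsFourierPair m G)
    (hW : IsFourierPair W
      fun ξ => (Real.pi * Real.tanh (Real.pi * freq ξ) : ℝ) * Complex.I * G ξ) (u : ℝ) :
    ∫ w, (pvTriangle η (u - w) : ℂ) * m w = ∫ w, (triangle η (u - w) : ℂ) * W w := by
  set t : ℝ → ℂ := fun v => (triangle η v : ℂ) with ht
  have ht1 : Integrable t := (integrable_triangle hη).ofReal
  have ht2 : MemLp t 2 := memLp_triangle hη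
  have htp := isFourierPair_fourier ht1 ht2
  set κ : ℝ → ℝ → ℂ := fun a v => ((∫ z in Ioi a, pvIntegrand η v z : ℝ) : ℂ) with hκ
  have hconv : ∀ a, 0 < a →
      (fun v => (cutCsch a v : ℂ)) ⋆[ContinuousLinearMap.mul ℂ ℂ] t = κ a := fun a ha =>
    funext (cutCsch_convolution_triangle hη ha)
  have hκ1 : ∀ a, 0 < a → Integrable (κ a) := fun a ha => by
    rw [← hconv a ha]
    exact (integrable_cutCsch ha).integrable_convolution _ ht1
  have hκ2 : ∀ a, 0 < a → MemLp (κ a) 2 := fun a ha => by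
    refine (memLp_sqrt_poisson hη).of_le (hκ1 a ha).1 (Eventually.of_forall fun v => ?_)
    rw [Complex.norm_real, Complex.norm_real, Real.norm_of_nonneg (Real.sqrt_nonneg _)]
    exact abs_setIntegral_pvIntegrand_le hη v ha.le
  have hκF : ∀ a, 0 < a → ∀ ξ, 𝓕 (κ a) ξ = 𝓕 (fun v => (cutCsch a v : ℂ)) ξ * 𝓕 t ξ :=
    fun a ha ξ => by
      rw [← hconv a ha]
      exact Real.fourier_mul_convolution_eq (integrable_cutCsch ha) ht1 ξ
  -- The same limit a → 0 is computed twice: here in space with the L² majorant, and in `lim2` in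
  -- frequency with the uniform bound 6 on the truncated multipliers.
  have lim1 : Tendsto (fun a => ∫ w, κ a (u - w) * m w) (𝓝[>] 0)
      (𝓝 (∫ w, (pvTriangle η (u - w) : ℂ) * m w)) := by
    refine tendsto_integral_filter_of_dominated_convergence
      (fun w => ‖((Real.sqrt (180 / η * poisson η (u - w)) : ℝ) : ℂ) * m w‖) ?_ ?_
      (integrable_kernel_mul (memLp_sqrt_poisson hη) hm.memLp_left u).norm ?_
    · filter_upwards [self_mem_nhdsWithin] with a ha
      exact (integrable_kernel_mul (hκ2 a ha) hm.memLp_left u).1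
    · filter_upwards [self_mem_nhdsWithin] with a ha
      have ha' : (0 : ℝ) < a := ha
      refine Eventually.of_forall fun w => ?_
      rw [norm_mul, norm_mul]
      refine mul_le_mul_of_nonneg_right ?_ (norm_nonneg _)
      rw [Complex.norm_real, Complex.norm_real, Real.norm_of_nonneg (Real.sqrt_nonneg _)]
      exact abs_setIntegral_pvIntegrand_le hη _ ha'.le
    · refine Eventually.of_forall fun w => ?_
      exact ((Complex.continuous_ofReal.tendsto _).comp
        (tendsto_setIntegral_pvIntegrand hη (u - w))).mul_const _
  have hE : ∀ ξ : ℝ, ‖Complex.exp (↑(2 * Real.pi * inner ℝ ξ u) * Complex.I)‖ = 1 := fun ξ =>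
    Complex.norm_exp_ofReal_mul_I _
  have hEc : Continuous fun ξ : ℝ =>
      Complex.exp (↑(2 * Real.pi * inner ℝ ξ u) * Complex.I) := by fun_prop
  have hint : Integrable fun ξ => 𝓕 t ξ * G ξ := htp.memLp_right.integrable_mul hm.memLp_right
  have lim2 : Tendsto (fun a => ∫ w, κ a (u - w) * m w) (𝓝[>] 0)
      (𝓝 (∫ w, t (u - w) * W w)) := by
    rw [hW.integral_kernel_mul ht1 ht2, Real.fourierInv_eq']
    have h1 : Tendsto (fun a => ∫ ξ, Complex.exp (↑(2 * Real.pi * inner ℝ ξ u) * Complex.I) •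
        (𝓕 (κ a) ξ * G ξ)) (𝓝[>] 0) (𝓝 (∫ ξ, Complex.exp (↑(2 * Real.pi * inner ℝ ξ u) *
        Complex.I) • (𝓕 t ξ *
          ((Real.pi * Real.tanh (Real.pi * freq ξ) : ℝ) * Complex.I * G ξ)))) := by
      refine tendsto_integral_filter_of_dominated_convergence
        (fun ξ => 6 * ‖𝓕 t ξ * G ξ‖) ?_ ?_ (hint.norm.const_mul 6) ?_
      · filter_upwards [self_mem_nhdsWithin] with a ha
        exact hEc.aestronglyMeasurable.smul
          ((continuous_fourier (hκ1 a ha)).aestronglyMeasurable.mul hm.memLp_right.1)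
      · filter_upwards [self_mem_nhdsWithin] with a ha
        have ha' : (0 : ℝ) < a := ha
        refine Eventually.of_forall fun ξ => ?_
        rw [norm_smul, hE, one_mul, hκF a ha', mul_assoc, norm_mul]
        exact mul_le_mul_of_nonneg_right (norm_fourier_cutCsch_le ha' ξ) (norm_nonneg _)
      · refine Eventually.of_forall fun ξ => ?_
        have h2 := (((tendsto_fourier_cutCsch ξ).mul_const (𝓕 t ξ)).mul_const (G ξ)).const_smul
          (Complex.exp (↑(2 * Real.pi * inner ℝ ξ u) * Complex.I))
        have e : (Real.pi * Real.tanh (Real.pi * freq ξ) : ℝ) * Complex.I * 𝓕 t ξ * G ξ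
            = 𝓕 t ξ * ((Real.pi * Real.tanh (Real.pi * freq ξ) : ℝ) * Complex.I * G ξ) := by ring
        rw [e] at h2
        refine h2.congr' ?_
        filter_upwards [self_mem_nhdsWithin] with a ha
        rw [hκF a ha]
    refine h1.congr' ?_
    filter_upwards [self_mem_nhdsWithin] with a ha
    rw [hm.integral_kernel_mul (hκ1 a ha) (hκ2 a ha), Real.fourierInv_eq']
  exact tendsto_nhds_unique lim1 lim2

/-- Mean value inequality on [v/2, ∞). Halving the argument, cosh(x/2) ≤ 2 cosh²(x/4), bounds the
derivative by 1/(8 sinh²(x/4)) ≤ 2/x² ≤ 8/v². -/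
lemma abs_kCsch_sub_kCsch_le {v z : ℝ} (hv : 0 < v) (hz : v / 2 < z) :
    |kCsch z - kCsch v| ≤ 8 / v ^ 2 * |z - v| := by
  have hbound : ∀ x ∈ Ici (v / 2),
      ‖-(Real.cosh (x / 2) / (4 * Real.sinh (x / 2) ^ 2))‖ ≤ 8 / v ^ 2 := by
    intro x hx
    have hx' : v / 2 ≤ x := hx
    have hx0 : 0 < x := by linarith
    have hc := Real.cosh_pos (x / 2)
    have hs := Real.sinh_pos_iff.2 (half_pos hx0)
    rw [norm_neg, Real.norm_of_nonneg (by positivity), div_le_div_iff₀ (by positivity)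
      (by positivity)]
    have h1 : Real.sinh (x / 2) = 2 * Real.sinh (x / 4) * Real.cosh (x / 4) := by
      rw [← Real.sinh_two_mul]; ring_nf
    have h2 : Real.cosh (x / 2) = Real.cosh (x / 4) ^ 2 + Real.sinh (x / 4) ^ 2 := by
      rw [← Real.cosh_two_mul]; ring_nf
    have h3 : x / 4 ≤ Real.sinh (x / 4) := Real.self_le_sinh_iff.2 (by linarith)
    have h4 := Real.cosh_sq (x / 4)
    have h5 : v ^ 2 ≤ 64 * Real.sinh (x / 4) ^ 2 := by nlinarith
    have h6 : Real.cosh (x / 2) ≤ 2 * Real.cosh (x / 4) ^ 2 := by rw [h2]; linarith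
    calc Real.cosh (x / 2) * v ^ 2
        ≤ 2 * Real.cosh (x / 4) ^ 2 * (64 * Real.sinh (x / 4) ^ 2) :=
          mul_le_mul h6 h5 (by positivity) (by positivity)
      _ = 8 * (4 * Real.sinh (x / 2) ^ 2) := by rw [h1]; ring
  have hder : ∀ x ∈ Ici (v / 2), HasDerivWithinAt kCsch
      (-(Real.cosh (x / 2) / (4 * Real.sinh (x / 2) ^ 2))) (Ici (v / 2)) x := fun x hx =>
    (hasDerivAt_kCsch (lt_of_lt_of_le (half_pos hv) hx)).hasDerivWithinAt
  exact Convex.norm_image_sub_le_of_norm_hasDerivWithin_le hder hbound (convex_Ici _)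
    (show v ∈ Ici (v / 2) from (by linarith : v / 2 ≤ v)) (show z ∈ Ici (v / 2) from hz.le)

/-- Away from the origin only one triangle contributes, so `pvTriangle` is an average of `kCsch`
over |z - v| ≤ η. -/
lemma abs_pvTriangle_sub_kCsch_le (hη : 0 < η) {v : ℝ} (hv : 2 * η < v) :
    |pvTriangle η v - kCsch v| ≤ 8 * η / v ^ 2 := by
  have hv0 : 0 < v := by linarith
  have htri : Integrable fun z => triangle η (v - z) := (integrable_triangle hη).comp_sub_left v
  have hone : ∫ z in Ioi (0 : ℝ), triangle η (v - z) = 1 := by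
    rw [← integral_triangle_sub hη v]
    refine setIntegral_eq_integral_of_forall_compl_eq_zero fun z hz => ?_
    by_contra h
    exact hz (lt_trans (half_pos hv0) (half_lt_of_triangle_ne_zero hv h).1)
  have e1 : kCsch v = ∫ z in Ioi (0 : ℝ), kCsch v * triangle η (v - z) := by
    rw [integral_const_mul, hone, mul_one]
  have e2 : pvTriangle η v - kCsch v
      = ∫ z in Ioi (0 : ℝ), (pvIntegrand η v z - kCsch v * triangle η (v - z)) := by
    rw [integral_sub (integrableOn_pvIntegrand hη v) (htri.const_mul _).integrableOn, ← e1]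
    rfl
  have hb : Integrable fun z => 8 * η / v ^ 2 * triangle η (v - z) := htri.const_mul _
  rw [e2]
  calc |∫ z in Ioi (0 : ℝ), (pvIntegrand η v z - kCsch v * triangle η (v - z))|
      ≤ ∫ z in Ioi (0 : ℝ), 8 * η / v ^ 2 * triangle η (v - z) := by
        refine norm_integral_le_of_norm_le
          (f := fun z => pvIntegrand η v z - kCsch v * triangle η (v - z)) hb.integrableOn
          ((ae_restrict_iff' measurableSet_Ioi).2 (Eventually.of_forall fun z hz => ?_))
        rw [pvIntegrand_of_lt hη hv hz, ← sub_mul, norm_mul,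
          Real.norm_of_nonneg (triangle_nonneg _ _)]
        by_cases h : triangle η (v - z) = 0
        · simp [h]
        · obtain ⟨h1, h2⟩ := half_lt_of_triangle_ne_zero hv h
          refine mul_le_mul_of_nonneg_right ?_ (triangle_nonneg _ _)
          refine (abs_kCsch_sub_kCsch_le hv0 h1).trans ?_
          refine (mul_le_mul_of_nonneg_left h2 (by positivity)).trans (le_of_eq ?_)
          ring
    _ = 8 * η / v ^ 2 := by rw [integral_const_mul, hone, mul_one]

/-- Smoothing and truncation at comparable scales differ by a Poisson kernel: near the origin both
are O(1/η), farther out the difference is O(η/v²). The range of a admits a = -log(1-η) for η ≤ 1/2.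
-/
lemma abs_pvTriangle_sub_cutCsch_le (hη : 0 < η) {a : ℝ} (h1 : η / 2 ≤ a) (h2 : a ≤ 2 * η)
    (v : ℝ) : |pvTriangle η v - cutCsch a v| ≤ 40 * poisson η v := by
  have ha : 0 < a := by linarith
  rcases le_or_gt |v| (2 * η) with h | h
  · have b1 : |pvTriangle η v| ≤ 6 / η := abs_setIntegral_pvIntegrand_le_div hη h le_rfl
    have b2 : |cutCsch a v| ≤ 2 / η := by
      refine (abs_cutCsch_le_inv ha v).trans ?_
      rw [div_le_div_iff₀ ha hη]
      linarith
    have b3 : 8 / η ≤ 40 * poisson η v := by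
      have h3 : v ^ 2 ≤ (2 * η) ^ 2 := by
        rw [← sq_abs v]; exact pow_le_pow_left₀ (abs_nonneg v) h 2
      rw [poisson, mul_div_assoc', div_le_div_iff₀ hη (by positivity)]
      nlinarith
    have b4 := abs_sub (pvTriangle η v) (cutCsch a v)
    have b5 : 6 / η + 2 / η = 8 / η := by ring
    linarith
  · have key : ∀ v : ℝ, 2 * η < v → |pvTriangle η v - cutCsch a v| ≤ 40 * poisson η v := by
      intro v hv
      have hv0 : 0 < v := by linarith
      rw [cutCsch, indicator_of_mem (show v ∈ {v : ℝ | a < |v|} by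
        rw [mem_ofPred_eq, abs_of_pos hv0]; linarith)]
      refine (abs_pvTriangle_sub_kCsch_le hη hv).trans ?_
      rw [poisson, mul_div_assoc', div_le_div_iff₀ (by positivity) (by positivity)]
      have h3 : (2 * η) ^ 2 ≤ v ^ 2 := pow_le_pow_left₀ (by positivity) hv.le 2
      nlinarith [mul_pos hη hη]
    rcases le_total 0 v with hv | hv
    · rw [abs_of_nonneg hv] at h
      exact key v h
    · rw [abs_of_nonpos hv] at h
      have := key (-v) h
      rw [pvTriangle_neg, cutCsch_neg, ← neg_sub', abs_neg] at this
      simpa [poisson] using this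

end pv

/-! ### The principal value operator -/

section strip

variable {ε : ℝ}

lemma neg_log_one_sub_le (h0 : 0 < ε) (h1 : ε ≤ 1 / 2) : -Real.log (1 - ε) ≤ 2 * ε := by
  have h2 := neg_log_one_sub_sub_le h0 h1
  have h3 := Real.log_le_sub_one_of_pos (x := 1 + ε) (by linarith)
  nlinarith

lemma half_le_neg_log_one_sub (h0 : 0 < ε) (h1 : ε ≤ 1 / 2) : ε / 2 ≤ -Real.log (1 - ε) :=
  (log_one_add_ge h0 h1).trans (log_one_add_le_neg_log_one_sub h0 h1)

/-- The asymmetric part of `cutSet ε`. -/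
def strip (ε : ℝ) : Set ℝ := Ico (-(-Real.log (1 - ε))) (-Real.log (1 + ε))

lemma indicator_cutSet_kCsch (h0 : 0 < ε) (h1 : ε ≤ 1 / 2) (v : ℝ) :
    (cutSet ε).indicator kCsch v
      = cutCsch (-Real.log (1 - ε)) v + (strip ε).indicator kCsch v := by
  have h2 := log_one_add_le_neg_log_one_sub h0 h1
  have h3 := log_one_add_ge h0 h1
  have e : cutSet ε = {v | -Real.log (1 - ε) < |v|} ∪ strip ε := by
    ext v
    simp only [cutSet, strip, mem_union, mem_Ioi, mem_Iio, mem_ofPred_eq, mem_Ico, lt_abs]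
    constructor
    · rintro (h | h)
      · exact Or.inl (Or.inl h)
      · rcases lt_or_ge (-Real.log (1 - ε)) (-v) with h' | h'
        · exact Or.inl (Or.inr h')
        · exact Or.inr ⟨by linarith, h⟩
    · rintro ((h | h) | h)
      · exact Or.inl h
      · exact Or.inr (by linarith)
      · exact Or.inr h.2
  have hd : Disjoint {v | -Real.log (1 - ε) < |v|} (strip ε) := by
    rw [Set.disjoint_left]
    intro v hv hv'
    rw [mem_ofPred_eq, lt_abs] at hv
    rcases hv with hv | hv <;> linarith [hv'.1, hv'.2]
  rw [e, indicator_union_of_disjoint hd, cutCsch]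

lemma abs_indicator_strip_le (h0 : 0 < ε) (h1 : ε ≤ 1 / 2) (v : ℝ) :
    |(strip ε).indicator kCsch v| ≤ (strip ε).indicator (fun _ => 2 / ε) v := by
  by_cases hv : v ∈ strip ε
  · have h3 := log_one_add_ge h0 h1
    have h4 : ε / 2 ≤ -v := by linarith [hv.2]
    rw [indicator_of_mem hv, indicator_of_mem hv]
    refine (abs_kCsch_le_inv v).trans ?_
    have h5 : ε / 2 ≤ |v| := h4.trans (neg_le_abs v)
    rw [div_le_div_iff₀ (by linarith) h0]
    linarith
  · rw [indicator_of_notMem hv, indicator_of_notMem hv, abs_zero]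

lemma abs_indicator_strip_le_poisson (h0 : 0 < ε) (h1 : ε ≤ 1 / 2) (v : ℝ) :
    |(strip ε).indicator kCsch v| ≤ 10 * poisson ε v := by
  refine (abs_indicator_strip_le h0 h1 v).trans ?_
  by_cases hv : v ∈ strip ε
  · have h2 := neg_log_one_sub_le h0 h1
    have h3 := log_one_add_ge h0 h1
    have h4 : v ^ 2 ≤ (2 * ε) ^ 2 := by
      rw [← neg_sq]
      exact pow_le_pow_left₀ (by linarith [hv.2]) (by linarith [hv.1]) 2
    rw [indicator_of_mem hv, poisson, mul_div_assoc', div_le_div_iff₀ h0 (by positivity)]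
    nlinarith
  · rw [indicator_of_notMem hv]
    exact mul_nonneg (by norm_num) (poisson_nonneg h0 v)

lemma measurableSet_strip (ε : ℝ) : MeasurableSet (strip ε) := measurableSet_Ico

lemma integrable_indicator_strip (h0 : 0 < ε) (h1 : ε ≤ 1 / 2) :
    Integrable ((strip ε).indicator kCsch) :=
  ((integrable_poisson h0).const_mul 10).mono'
    (measurable_kCsch.indicator (measurableSet_strip ε)).aestronglyMeasurable
    (Eventually.of_forall (abs_indicator_strip_le_poisson h0 h1))

/-- The strip has length at most 2ε², and the kernel there is at most 2/ε. -/
lemma abs_integral_indicator_strip_le (h0 : 0 < ε) (h1 : ε ≤ 1 / 2) :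
    |∫ v, (strip ε).indicator kCsch v| ≤ 4 * ε := by
  have h2 := neg_log_one_sub_sub_le h0 h1
  have h3 := log_one_add_le_neg_log_one_sub h0 h1
  have hi : Integrable ((strip ε).indicator fun _ : ℝ => 2 / ε) :=
    (integrable_indicator_iff (measurableSet_strip ε)).2 (integrableOn_const (by simp [strip]))
  refine (norm_integral_le_of_norm_le (f := (strip ε).indicator kCsch) hi
    (Eventually.of_forall (abs_indicator_strip_le h0 h1))).trans ?_
  rw [integral_indicator (measurableSet_strip ε), setIntegral_const, strip,
    Real.volume_real_Ico_of_le (by linarith), smul_eq_mul]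
  refine (mul_le_mul_of_nonneg_right (show _ ≤ 2 * ε ^ 2 by linarith) (by positivity)).trans
    (le_of_eq ?_)
  field_simp
  ring

/-- The integrand is odd. -/
lemma integral_pvTriangle_sub_cutCsch (η a : ℝ) : ∫ v, (pvTriangle η v - cutCsch a v) = 0 := by
  have h := integral_neg_eq_self (fun v => pvTriangle η v - cutCsch a v) volume
  simp only [pvTriangle_neg, cutCsch_neg, ← neg_sub', integral_neg] at h
  linarith

end strip

lemma eventually_cut : ∀ᶠ ε in 𝓝[>] (0 : ℝ), 0 < ε ∧ ε ≤ 1 / 2 := by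
  filter_upwards [self_mem_nhdsWithin,
    nhdsWithin_le_nhds (Iic_mem_nhds (by norm_num : (0 : ℝ) < 1 / 2))] with ε h0 h1
  exact ⟨h0, h1⟩

lemma memLp_indicator_cutSet_kCsch {ε : ℝ} (h0 : 0 < ε) (h1 : ε ≤ 1 / 2) :
    MemLp (fun v => (((cutSet ε).indicator kCsch v : ℝ) : ℂ)) 2 := by
  have hi : Integrable fun v => (((cutSet ε).indicator kCsch v : ℝ) : ℂ) := by
    simp_rw [indicator_cutSet_kCsch h0 h1, Complex.ofReal_add]
    exact (integrable_cutCsch ((half_pos h0).trans_le (half_le_neg_log_one_sub h0 h1))).add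
      (integrable_indicator_strip h0 h1).ofReal
  refine memLp_two_of_bounded hi (2 / ε) fun v => ?_
  rw [Complex.norm_real, Real.norm_eq_abs]
  by_cases hv : v ∈ cutSet ε
  · rw [indicator_of_mem hv]
    have h5 := le_abs_of_mem_cutSet h0 h1 hv
    refine (abs_kCsch_le_inv v).trans ?_
    rw [div_le_div_iff₀ (by linarith) h0]
    linarith
  · rw [indicator_of_notMem hv, abs_zero]
    exact div_nonneg two_pos.le h0.le

/-- At Lebesgue points the truncated integrals with kernel `kCsch` converge. -/
lemma IsLebesguePoint.tendsto_integral_cutSet_kCsch {m G W : ℝ → ℂ} {u : ℝ}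
    (hu : IsLebesguePoint m u) (huW : IsLebesguePoint W u) (hm : IsFourierPair m G)
    (hW : IsFourierPair W
      fun ξ => (Real.pi * Real.tanh (Real.pi * freq ξ) : ℝ) * Complex.I * G ξ) :
    Tendsto (fun ε => ∫ w, (((cutSet ε).indicator kCsch (u - w) : ℝ) : ℂ) * m w) (𝓝[>] 0)
      (𝓝 (W u)) := by
  -- The error kernel is odd except on the strip, so its mass is O(ε). It acts as an approximate
  -- identity with constant 0 and drops out at Lebesgue points of m.
  set E : ℝ → ℝ → ℝ := fun ε v => pvTriangle ε v - (cutSet ε).indicator kCsch v with hE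
  have hsplit : ∀ ε, 0 < ε → ε ≤ 1 / 2 → ∀ v, E ε v
      = (pvTriangle ε v - cutCsch (-Real.log (1 - ε)) v) - (strip ε).indicator kCsch v :=
    fun ε h0 h1 v => by rw [hE]; dsimp only; rw [indicator_cutSet_kCsch h0 h1]; ring
  have hdiff : ∀ ε, 0 < ε → ε ≤ 1 / 2 →
      Integrable fun v => pvTriangle ε v - cutCsch (-Real.log (1 - ε)) v := fun ε h0 h1 =>
    ((integrable_poisson h0).const_mul 40).mono'
      ((measurable_pvTriangle ε).sub (measurable_cutCsch _)).aestronglyMeasurable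
      (Eventually.of_forall (abs_pvTriangle_sub_cutCsch_le h0 (half_le_neg_log_one_sub h0 h1)
        (neg_log_one_sub_le h0 h1)))
  have hmeas : ∀ ε, Measurable (E ε) := fun ε =>
    (measurable_pvTriangle ε).sub (measurable_kCsch.indicator (measurableSet_cutSet ε))
  have hbound : ∀ ε, 0 < ε → ε ≤ 1 / 2 → ∀ v, ‖(E ε v : ℂ)‖ ≤ 50 * poisson ε v :=
    fun ε h0 h1 v => by
      rw [Complex.norm_real, Real.norm_eq_abs, hsplit ε h0 h1]
      have b1 := abs_pvTriangle_sub_cutCsch_le h0 (half_le_neg_log_one_sub h0 h1)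
        (neg_log_one_sub_le h0 h1) v
      have b2 := abs_indicator_strip_le_poisson h0 h1 v
      have b3 := abs_sub (pvTriangle ε v - cutCsch (-Real.log (1 - ε)) v)
        ((strip ε).indicator kCsch v)
      linarith
  have h4 : Tendsto (fun ε : ℝ => 4 * ε) (𝓝[>] 0) (𝓝 0) := by
    have : Tendsto (fun ε : ℝ => 4 * ε) (𝓝 0) (𝓝 (4 * 0)) := tendsto_id.const_mul 4
    rw [mul_zero] at this
    exact this.mono_left nhdsWithin_le_nhds
  have hc : Tendsto (fun ε => ∫ v, (E ε v : ℂ)) (𝓝[>] 0) (𝓝 0) := by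
    refine squeeze_zero_norm' ?_ h4
    filter_upwards [eventually_cut] with ε hε
    rw [integral_complex_ofReal, Complex.norm_real, Real.norm_eq_abs,
      integral_congr_ae (Eventually.of_forall (hsplit ε hε.1 hε.2)),
      integral_sub (hdiff ε hε.1 hε.2) (integrable_indicator_strip hε.1 hε.2),
      integral_pvTriangle_sub_cutCsch, zero_sub, abs_neg]
    exact abs_integral_indicator_strip_le hε.1 hε.2
  have t1 := hu.tendsto_integral_of_le_poisson hm.memLp_left (E := fun ε v => (E ε v : ℂ))
    (C := 50) (Eventually.of_forall fun ε =>
      (Complex.measurable_ofReal.comp (hmeas ε)).aestronglyMeasurable)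
    (by filter_upwards [eventually_cut] with ε hε v using hbound ε hε.1 hε.2 v) hc
  have t2 := (huW.tendsto_integral_triangle hW.memLp_left).sub t1
  rw [zero_mul, sub_zero] at t2
  refine t2.congr' ?_
  filter_upwards [eventually_cut] with ε hε
  have hE1 : Integrable fun v => (E ε v : ℂ) :=
    ((integrable_poisson hε.1).const_mul 50).mono'
      (Complex.measurable_ofReal.comp (hmeas ε)).aestronglyMeasurable
      (Eventually.of_forall (hbound ε hε.1 hε.2))
  have hE2 : MemLp (fun v => (E ε v : ℂ)) 2 :=
    memLp_two_of_bounded hE1 (50 * (1 / ε)) fun v => (hbound ε hε.1 hε.2 v).trans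
      (mul_le_mul_of_nonneg_left (poisson_le_inv hε.1 v) (by norm_num))
  have i1 := integrable_kernel_mul (memLp_indicator_cutSet_kCsch hε.1 hε.2) hm.memLp_left u
  have i2 := integrable_kernel_mul hE2 hm.memLp_left u
  rw [← integral_pvTriangle_mul hε.1 hm hW, sub_eq_iff_eq_add, ← integral_add i1 i2]
  refine integral_congr_ae (Eventually.of_forall fun w => ?_)
  simp only [hE]
  push_cast
  ring

lemma memLp_regularKernel : MemLp (fun v => (regularKernel v : ℂ)) 2 :=
  memLp_two_of_bounded integrable_regularKernel 3 fun v => by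
    rw [Complex.norm_real]; exact abs_regularKernel_le v

lemma memLp_indicator_cutSet_regularKernel (ε : ℝ) :
    MemLp (fun v => (((cutSet ε).indicator regularKernel v : ℝ) : ℂ)) 2 :=
  memLp_regularKernel.of_le (Complex.measurable_ofReal.comp
      (measurable_regularKernel.indicator (measurableSet_cutSet ε))).aestronglyMeasurable
    (Eventually.of_forall fun v => by
      rw [Complex.norm_real, Complex.norm_real]; exact norm_indicator_le_norm_self _ _)

lemma tendsto_integral_cutSet_regularKernel {m : ℝ → ℂ} (hm : MemLp m 2) (u : ℝ) :
    Tendsto (fun ε => ∫ w, (((cutSet ε).indicator regularKernel (u - w) : ℝ) : ℂ) * m w) (𝓝[>] 0)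
      (𝓝 (∫ w, (regularKernel (u - w) : ℂ) * m w)) := by
  have h := tendsto_integral_indicator (l := 𝓝[>] (0 : ℝ))
    (s := fun ε => (fun w => u - w) ⁻¹' cutSet ε)
    (integrable_kernel_mul memLp_regularKernel hm u)
    (fun ε => (measurableSet_cutSet ε).preimage (by fun_prop)) (by
      filter_upwards [(Measure.measurePreserving_sub_left volume u).quasiMeasurePreserving.ae
        ae_ne_zero] with w hw using eventually_mem_cutSet hw)
  refine h.congr fun ε => integral_congr_ae (Eventually.of_forall fun w => ?_)
  by_cases hw : u - w ∈ cutSet ε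
  · simp only [indicator_of_mem hw,
      indicator_of_mem (show w ∈ (fun w => u - w) ⁻¹' cutSet ε from hw)]
  · simp only [indicator_of_notMem hw,
      indicator_of_notMem (show w ∉ (fun w => u - w) ⁻¹' cutSet ε from hw)]
    simp

lemma norm_tanh_multiplier_le (ξ : ℝ) :
    ‖((Real.pi * Real.tanh (Real.pi * freq ξ) : ℝ) : ℂ) * Complex.I‖ ≤ 6 := by
  refine le_of_tendsto (tendsto_fourier_cutCsch ξ).norm ?_
  filter_upwards [self_mem_nhdsWithin] with a ha using norm_fourier_cutCsch_le ha ξ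

lemma continuous_tanh_multiplier :
    Continuous fun ξ => ((Real.pi * Real.tanh (Real.pi * freq ξ) : ℝ) : ℂ) * Complex.I := by
  have h1 : Continuous Real.tanh := by
    rw [show Real.tanh = fun x => Real.sinh x / Real.cosh x from
      funext Real.tanh_eq_sinh_div_cosh]
    exact Real.continuous_sinh.div Real.continuous_cosh fun x => (Real.cosh_pos x).ne'
  have h2 : Continuous freq := by unfold freq; fun_prop
  fun_prop

lemma fourier_regularKernel (ξ : ℝ) : 1 / 2 * (𝓕 (fun v => (regularKernel v : ℂ)) ξ
    - (Real.pi * Real.tanh (Real.pi * freq ξ) : ℝ) * Complex.I) = multiplier (freq ξ) := by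
  rw [fourier_eq_integral_freq, integral_regularKernel_mul_exp, multiplier]

/-- The truncated integrals converge almost everywhere to the image under the multiplier. -/
theorem exists_isFourierPair_multiplier {m G : ℝ → ℂ} (hm : IsFourierPair m G) :
    ∃ W : ℝ → ℂ, IsFourierPair W (fun ξ => multiplier (freq ξ) * G ξ) ∧
      ∀ᵐ u, Tendsto (fun ε => ∫ w, cutKernel ε (u - w) * m w) (𝓝[>] 0) (𝓝 (W u)) := by
  have hM : MemLp (fun ξ =>
      (Real.pi * Real.tanh (Real.pi * freq ξ) : ℝ) * Complex.I * G ξ) 2 :=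
    hm.memLp_right.of_le_mul (c := 6)
      (continuous_tanh_multiplier.aestronglyMeasurable.mul hm.memLp_right.1) <|
      Eventually.of_forall fun ξ => by
        rw [norm_mul]
        exact mul_le_mul_of_nonneg_right (norm_tanh_multiplier_le ξ) (norm_nonneg _)
  obtain ⟨H, hH⟩ := exists_isFourierPair_left hM
  have hR := hm.convolution integrable_regularKernel memLp_regularKernel
  refine ⟨_, ((hR.sub hH).const_smul (1 / 2 : ℂ)).congr_right
    (Eventually.of_forall fun ξ => ?_), ?_⟩
  · simp only [Pi.smul_apply, Pi.sub_apply, smul_eq_mul]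
    rw [← fourier_regularKernel]
    ring
  · filter_upwards [ae_isLebesguePoint hm.memLp_left, ae_isLebesguePoint hH.memLp_left]
      with u hu huH
    have t := ((tendsto_integral_cutSet_regularKernel hm.memLp_left u).sub
      (hu.tendsto_integral_cutSet_kCsch huH hm hH)).const_mul (1 / 2 : ℂ)
    refine t.congr' ?_
    filter_upwards [eventually_cut] with ε hε
    have i1 := integrable_kernel_mul (memLp_indicator_cutSet_regularKernel ε) hm.memLp_left u
    have i2 := integrable_kernel_mul (memLp_indicator_cutSet_kCsch hε.1 hε.2) hm.memLp_left u
    rw [← integral_sub i1 i2, ← integral_const_mul]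
    refine integral_congr_ae (Eventually.of_forall fun w => ?_)
    by_cases hw : u - w ∈ cutSet ε
    · simp only [cutKernel, indicator_of_mem hw, hartleyKernel]
      push_cast
      ring
    · simp [cutKernel, indicator_of_notMem hw]

/-! ### The integro-functional equation on the Mellin side -/

lemma exp_mul_indicator_kernel_mul (f : ℝ → ℂ) {ε : ℝ} (h0 : 0 < ε) (h1 : ε ≤ 1 / 2) (u w : ℝ) :
    (Real.exp w : ℂ) * {t : ℝ | ε * Real.exp u < |t - Real.exp u|}.indicator
        (fun t => (kernel (Real.exp u) t : ℂ) * f t) (Real.exp w)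
      = (Real.exp (-(u / 2)) : ℂ) * (cutKernel ε (u - w) * logPullback f w) := by
  by_cases hw : u - w ∈ cutSet ε
  · have hne : u ≠ w := by
      rintro rfl
      have := le_abs_of_mem_cutSet h0 h1 hw
      simp at this
      linarith
    have hmem : Real.exp w ∈ {t : ℝ | ε * Real.exp u < |t - Real.exp u|} :=
      (mem_cutSet_iff h0 h1 u w).1 hw
    rw [indicator_of_mem hmem, exp_mul_kernel_mul f hne, cutKernel,
      indicator_of_mem hw]
  · have hmem : Real.exp w ∉ {t : ℝ | ε * Real.exp u < |t - Real.exp u|} :=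
      fun h => hw ((mem_cutSet_iff h0 h1 u w).2 h)
    rw [indicator_of_notMem hmem, cutKernel,
      indicator_of_notMem hw]
    simp

lemma measurableSet_lt_abs_sub (a x : ℝ) : MeasurableSet {t : ℝ | a < |t - x|} :=
  measurableSet_lt measurable_const (by fun_prop)

lemma setIntegral_kernel_mul (f : ℝ → ℂ) {ε : ℝ} (h0 : 0 < ε) (h1 : ε ≤ 1 / 2) (u : ℝ) :
    ∫ t in {t : ℝ | 0 < t ∧ ε * Real.exp u < |t - Real.exp u|},
        (kernel (Real.exp u) t : ℂ) * f t
      = (Real.exp (-(u / 2)) : ℂ) * ∫ w, cutKernel ε (u - w) * logPullback f w := by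
  have e : {t : ℝ | 0 < t ∧ ε * Real.exp u < |t - Real.exp u|}
      = Ioi 0 ∩ {t : ℝ | ε * Real.exp u < |t - Real.exp u|} := rfl
  rw [e, ← setIntegral_indicator (measurableSet_lt_abs_sub _ _), integral_Ioi_eq_integral_exp,
    ← integral_const_mul]
  simp_rw [exp_mul_indicator_kernel_mul f h0 h1]

lemma integrableOn_kernel_mul {f : ℝ → ℂ} (hf : MemLp (logPullback f) 2) {ε : ℝ} (h0 : 0 < ε)
    (h1 : ε ≤ 1 / 2) (u : ℝ) :
    IntegrableOn (fun t => (kernel (Real.exp u) t : ℂ) * f t)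
      {t : ℝ | 0 < t ∧ ε * Real.exp u < |t - Real.exp u|} := by
  have e : {t : ℝ | 0 < t ∧ ε * Real.exp u < |t - Real.exp u|}
      = {t : ℝ | ε * Real.exp u < |t - Real.exp u|} ∩ Ioi 0 := inter_comm _ _
  have hs := measurableSet_lt_abs_sub (ε * Real.exp u) (Real.exp u)
  have key : IntegrableOn ({t : ℝ | ε * Real.exp u < |t - Real.exp u|}.indicator
      fun t => (kernel (Real.exp u) t : ℂ) * f t) (Ioi 0) := by
    rw [integrableOn_Ioi_iff_exp]
    simp_rw [exp_mul_indicator_kernel_mul f h0 h1]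
    exact (integrable_kernel_mul (memLp_cutKernel h0 h1) hf u).const_mul _
  rwa [IntegrableOn, integrable_indicator_iff hs, IntegrableOn, Measure.restrict_restrict hs,
    ← e] at key

/-- For fixed x = e^u the absolute radius of the principal value and the relative radius of `cutSet`
differ by the positive factor e^u, so they define the same limit. -/
lemma hasPV_kernel_mul_iff {f : ℝ → ℂ} (hf : MemLp (logPullback f) 2) (u : ℝ) (v : ℂ) :
    HasPV (fun t => (kernel (Real.exp u) t : ℂ) * f t) (Real.exp u) v ↔
      Tendsto (fun ε => ∫ w, cutKernel ε (u - w) * logPullback f w) (𝓝[>] 0)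
        (𝓝 ((Real.exp (u / 2) : ℂ) * v)) := by
  have hmul : ∀ c : ℝ, 0 < c → Tendsto (fun ε : ℝ => ε * c) (𝓝[>] 0) (𝓝[>] 0) := fun c hc => by
    refine tendsto_nhdsWithin_iff.2 ⟨?_, ?_⟩
    · have : Tendsto (fun ε : ℝ => ε * c) (𝓝 0) (𝓝 (0 * c)) := tendsto_id.mul_const c
      rw [zero_mul] at this
      exact this.mono_left nhdsWithin_le_nhds
    · filter_upwards [self_mem_nhdsWithin] with ε hε
      exact mul_pos hε hc
  constructor
  · intro h
    refine ((h.2.comp (hmul _ (Real.exp_pos u))).const_mul (Real.exp (u / 2) : ℂ)).congr' ?_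
    filter_upwards [eventually_cut] with ε hε
    simp only [Function.comp]
    rw [setIntegral_kernel_mul f hε.1 hε.2, ← mul_assoc, exp_neg_half_mul_exp_half, one_mul]
  · intro h
    refine ⟨fun ε hε => ?_, ?_⟩
    -- Capping the relative radius at 1/2 makes the estimates for `cutSet` available; a smaller
    -- radius only enlarges the domain of integration.
    · set δ := min (ε * Real.exp (-u)) (1 / 2) with hδ
      have h0 : 0 < δ := lt_min (mul_pos hε (Real.exp_pos _)) (by norm_num)
      refine (integrableOn_kernel_mul hf h0 (min_le_right _ _) u).mono_set fun t ht => ⟨ht.1, ?_⟩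
      refine lt_of_le_of_lt ?_ ht.2
      calc δ * Real.exp u ≤ ε * Real.exp (-u) * Real.exp u :=
            mul_le_mul_of_nonneg_right (min_le_left _ _) (Real.exp_pos u).le
        _ = ε := by rw [mul_assoc, ← Real.exp_add]; simp
    · have h2 := (h.comp (hmul _ (Real.exp_pos (-u)))).const_mul (Real.exp (-(u / 2)) : ℂ)
      have e : (Real.exp (-(u / 2)) : ℂ) * ((Real.exp (u / 2) : ℂ) * v) = v := by
        rw [← mul_assoc, mul_comm (Real.exp (-(u / 2)) : ℂ), exp_neg_half_mul_exp_half, one_mul]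
      rw [e] at h2
      refine h2.congr' ?_
      filter_upwards [(hmul _ (Real.exp_pos (-u))).eventually eventually_cut] with ε hε
      simp only [Function.comp]
      rw [← setIntegral_kernel_mul f hε.1 hε.2, mul_assoc, ← Real.exp_add, neg_add_cancel,
        Real.exp_zero, mul_one]

/-- The principal values exist almost everywhere and are given by the `L²` Fourier multiplier. -/
theorem ae_hasPV_iff_isFourierPair {f V G : ℝ → ℂ} (hf : IsFourierPair (logPullback f) G) :
    (∀ᵐ x ∂halfLine, HasPV (fun t => (kernel x t : ℂ) * f t) x (V x)) ↔
      IsFourierPair (logPullback V) (fun ξ => multiplier (freq ξ) * G ξ) := by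
  obtain ⟨W, hW, hlim⟩ := exists_isFourierPair_multiplier hf
  rw [ae_halfLine_iff]
  simp_rw [hasPV_kernel_mul_iff hf.memLp_left]
  constructor
  · intro h
    refine hW.congr_left ?_
    filter_upwards [h, hlim] with u h1 h2 using tendsto_nhds_unique h2 h1
  · intro h
    filter_upwards [hlim, hW.unique_left h] with u h1 h2
    rwa [h2] at h1

lemma logPullback_comp_inv (c : ℂ) (f : ℝ → ℂ) :
    logPullback (fun x => c / (x : ℂ) * f (1 / x)) = c • fun u => logPullback f (-u) := by
  ext u
  have h1 : (Real.exp (u / 2) : ℂ) / (Real.exp u : ℂ) = (Real.exp (-u / 2) : ℂ) := by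
    rw [← Complex.ofReal_div, ← Real.exp_sub]; ring_nf
  have h2 : 1 / Real.exp u = Real.exp (-u) := by rw [Real.exp_neg, one_div]
  simp only [logPullback, Pi.smul_apply, smul_eq_mul, h2, ← h1]
  ring

/-- On the Mellin side the integro-functional equation reads `symbol · F(s) = λ F(1 - s)`. -/
theorem solvesIntegroFunctional_iff {lam : ℂ} {f G : ℝ → ℂ}
    (hf : IsFourierPair (logPullback f) G) :
    SolvesIntegroFunctional lam f ↔
      ∀ᵐ ξ : ℝ, symbol (line (freq ξ)) * G ξ = lam * G (-ξ) := by
  set c : ℂ := (((2 : ℝ) ^ ((3 : ℝ) / 2) / Real.sqrt Real.pi : ℝ) : ℂ) with hc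
  have hc0 : c ≠ 0 := by
    have := Real.sqrt_pos.2 Real.pi_pos
    rw [hc, Ne, Complex.ofReal_eq_zero]
    positivity
  -- The value that the equation forces on the principal value.
  set V : ℝ → ℂ := fun x => c⁻¹ * lam / (x : ℂ) * f (1 / x) with hV
  have e1 : SolvesIntegroFunctional lam f ↔
      ∀ᵐ x ∂halfLine, HasPV (fun t => (kernel x t : ℂ) * f t) x (V x) := by
    refine eventually_congr (Eventually.of_forall fun x => ?_)
    have hVx : c * V x = lam / (x : ℂ) * f (1 / x) := by
      simp only [hV]
      field_simp
    constructor
    · rintro ⟨v, hv, hve⟩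
      rw [← hVx] at hve
      rwa [← mul_left_cancel₀ hc0 hve]
    · exact fun h => ⟨V x, h, hVx⟩
  have hR := hf.comp_neg.const_smul (c⁻¹ * lam)
  rw [e1, ae_hasPV_iff_isFourierPair hf, hV, logPullback_comp_inv]
  have e2 : ∀ ξ, symbol (line (freq ξ)) * G ξ = lam * G (-ξ) ↔
      multiplier (freq ξ) * G ξ = c⁻¹ * lam * G (-ξ) := fun ξ => by
    rw [← symbol_line, ← hc, mul_assoc, mul_assoc, eq_inv_mul_iff_mul_eq₀ hc0]
  simp_rw [e2]
  exact ⟨fun h => h.unique_right hR, fun h => hR.congr_right (EventuallyEq.symm h)⟩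

/-! ### Division by the symbol plus λ, and the theorem. -/

lemma symbol_line_add_ne_zero {lam : ℂ} (hlam : ‖lam‖ < Real.sqrt (2 * Real.pi)) (τ : ℝ) :
    symbol (line τ) + lam ≠ 0 := by
  intro h
  have h1 := sqrt_lt_norm_symbol_line τ
  rw [eq_neg_of_add_eq_zero_left h, norm_neg] at h1
  linarith

lemma continuous_symbol_line : Continuous fun τ => symbol (line τ) := by
  simp_rw [symbol_line_eq]
  refine Continuous.div ?_ ?_ one_add_sinh_mul_I_ne_zero
  · have : Continuous fun τ : ℝ => Real.cosh (Real.pi * τ) := by fun_prop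
    fun_prop
  · have : Continuous fun τ : ℝ => Real.sinh (Real.pi * τ) := by fun_prop
    fun_prop

/-- Since |S + λ| ≥ |S| - |λ| > √(2π) - |λ| > 0 on the line, dividing by S + λ is a bounded
operation. -/
lemma MemL2Line.inv_symbol_add_mul {lam : ℂ} (hlam : ‖lam‖ < Real.sqrt (2 * Real.pi)) {φ : ℂ → ℂ}
    (hφ : MemL2Line φ) : MemL2Line fun s => (symbol s + lam)⁻¹ * φ s := by
  refine MemLp.of_le_mul (c := (Real.sqrt (2 * Real.pi) - ‖lam‖)⁻¹) hφ
    (((continuous_symbol_line.add continuous_const).inv₀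
      (symbol_line_add_ne_zero hlam)).aestronglyMeasurable.mul hφ.1)
    (Eventually.of_forall fun τ => ?_)
  rw [norm_mul, norm_inv]
  refine mul_le_mul_of_nonneg_right (inv_anti₀ (by linarith) ?_) (norm_nonneg _)
  have h1 := sqrt_lt_norm_symbol_line τ
  have h2 := norm_sub_le (symbol (line τ) + lam) lam
  rw [add_sub_cancel_right] at h2
  linarith

lemma MemL2Line.exists_isInvMellin {F : ℂ → ℂ} (hF : MemL2Line F) : ∃ f, IsInvMellin F f := by
  obtain ⟨g, hg⟩ := exists_isFourierPair_left (memLp_comp_freq_iff.2 hF)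
  refine ⟨fun x => (Real.exp (-(Real.log x / 2)) : ℂ) * g (Real.log x),
    isInvMellin_iff_isFourierPair.2 (hg.congr_left (Eventually.of_forall fun u => ?_))⟩
  rw [logPullback, Real.log_exp, ← mul_assoc, exp_neg_half_mul_exp_half, one_mul]

end HartleyFourier

end

open HartleyFourier in
theorem theorem11 (lam : ℂ) (hlam : ‖lam‖ < Real.sqrt (2 * Real.pi)) :
    -- necessity
    (∀ f : ℝ → ℂ, MemLp f 2 HartleyFourier.halfLine →
      HartleyFourier.SolvesIntegroFunctional lam f →
      ∃ φ : ℂ → ℂ, HartleyFourier.MemL2Line φ ∧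
        (∀ s : ℂ, s.re = 1 / 2 → φ s = φ (1 - s)) ∧
        HartleyFourier.IsInvMellin (fun s => (HartleyFourier.symbol s + lam)⁻¹ * φ s) f) ∧
    -- sufficiency
    (∀ (φ : ℂ → ℂ) (μ : ℝ → ℂ), HartleyFourier.MemL2Line φ →
      (∀ᵐ τ : ℝ, φ (HartleyFourier.line τ) = φ (1 - HartleyFourier.line τ)) →
      HartleyFourier.IsInvMellin φ μ →
      (∀ x : ℝ, 0 < x → HartleyFourier.IntegralsConverge μ x) ∧
      (HartleyFourier.SolvesIntegralEquation lam μ →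
        (∃ f : ℝ → ℂ,
          HartleyFourier.IsInvMellin (fun s => (HartleyFourier.symbol s + lam)⁻¹ * φ s) f) ∧
        ∀ f : ℝ → ℂ,
          HartleyFourier.IsInvMellin (fun s => (HartleyFourier.symbol s + lam)⁻¹ * φ s) f →
          HartleyFourier.SolvesIntegroFunctional lam f)) := by
  constructor
  · intro f hf hsol
    obtain ⟨G, hG⟩ := exists_isFourierPair (memLp_halfLine_iff.1 hf)
    have key := (solvesIntegroFunctional_iff hG).1 hsol
    -- The Mellin transform of f in the variable τ, obtained by inverting `freq`.
    set F : ℝ → ℂ := fun τ => G (τ / (-(2 * Real.pi))) with hF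
    have hFG : ∀ ξ, F (freq ξ) = G ξ := fun ξ => by
      have : freq ξ / (-(2 * Real.pi)) = ξ := by rw [freq]; field_simp
      rw [hF]; dsimp only; rw [this]
    have hF2 : MemLp F 2 := by
      refine memLp_comp_freq_iff.1 ?_
      simpa only [hFG] using hG.memLp_right
    have him : ∀ τ, (line τ).im = τ := fun τ => by simp [line]
    -- This is (S + λ)F after SF = λF(1-s) is used. Expressing it through `s.im` makes the symmetry
    -- hold at every point, not only almost everywhere.
    refine ⟨fun s => lam * (F s.im + F (-s.im)), ?_, fun s _ => ?_, ?_⟩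
    · have : MemLp (fun τ => F (-τ)) 2 :=
        hF2.comp_measurePreserving (Measure.measurePreserving_neg volume)
      simpa only [MemL2Line, him] using! (hF2.add this).const_mul lam
    · simp [add_comm]
    · refine isInvMellin_iff_isFourierPair.2 (hG.congr_right ?_)
      filter_upwards [key] with ξ hξ
      rw [eq_inv_mul_iff_mul_eq₀ (symbol_line_add_ne_zero hlam _), him, ← freq_neg, hFG, hFG,
        add_mul, hξ]
      ring
  · intro φ μ hφ hsymm hμ
    refine ⟨fun x hx => integralsConverge_of_memLp hμ.memLp hx, fun hsol => ?_⟩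
    refine ⟨(hφ.inv_symbol_add_mul hlam).exists_isInvMellin, fun f hf => ?_⟩
    refine (solvesIntegroFunctional_iff (isInvMellin_iff_isFourierPair.1 hf)).2 ?_
    filter_upwards [ae_freq_iff.2 hsymm, ae_freq_iff.2 (hsol.multiplier_mul_eq_zero hμ)]
      with ξ hs hz
    have h1 := symbol_line_add_ne_zero hlam (freq ξ)
    have h2 := symbol_line_add_ne_zero hlam (-freq ξ)
    rw [one_sub_line] at hs
    rw [freq_neg, ← hs]
    -- Clearing denominators gives S(s)(S(1-s) + λ)φ = λ(S(s) + λ)φ. The terms λS(s)φ cancel,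
    -- leaving `hz`.
    field_simp
    linear_combination hz
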